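/- Let $k$ be an algebraically closed field of characteristic $0$. A variety is an integral separated scheme of finite type over $k$. For a strictly convex rational polyhedral cone $\sigma\subset N_{\mathbb R}$, with $N\cong\mathbb Z^n$ a lattice and $M$ its dual, let $X_\sigma=\operatorname{Spec}k[\sigma^\vee\cap M]$ be the affine toric variety of $\sigma$ and $T\subset X_\sigma$ its torus. A toric morphism $g\colon X_\sigma\to X_\tau$ is a dominant morphism defined by a linear map of lattices $N_\sigma\to N_\tau$ that maps $\sigma$ into $\tau$. Let $X$ be a normal variety and $U_X\subset X$ an open subset. A local model of $U_X\subset X$ at $x\in X$ is an affine toric variety $X_\sigma$ with a point $s\in X_\sigma$ and an isomorphism of $k$-algebras $\hat{\mathcal O}_{X,x}\cong\hat{\mathcal O}_{X_\sigma,s}$ under which the ideal of $X\smallsetminus U_X$ corresponds to the ideal of $X_\sigma\smallsetminus T$. The pair $U_X\subset X$ is a toroidal embedding if there is a local model at every closed point of $X$. It is without self-intersection if moreover all irreducible components of $X\smallsetminus U_X$ are normal. A morphism $f\colon(U_X\subset X)\to(U_B\subset B)$ of toroidal embeddings, that is, a morphism of varieties over $k$ with $f(U_X)\subset U_B$, is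 toroidal if it is dominant and for every closed point $x\in X$ there are local models $(X_\sigma,s)$ at $x$ and $(X_\tau,t)$ at $f(x)$ and a toric morphism $g\colon X_\sigma\to X_\tau$ with $g(s)=t$ such that the isomorphisms $\hat{\mathcal O}_{X,x}\cong\hat{\mathcal O}_{X_\sigma,s}$ and $\hat{\mathcal O}_{B,f(x)}\cong\hat{\mathcal O}_{X_\tau,t}$ identify $\hat f^{*}$ with $\hat g^{*}$. **Proposition.** Let $U_X\subset X$ and $U_B\subset B$ be toroidal embeddings with $X$ and $B$ nonsingular, and let $f\colon X\to B$ be a surjective toroidal morphism. Put $U_X'=f^{-1}(U_B)$. Then $U_X\subset U_X'$, the pair $U_X'\subset X$ is a toroidal embedding, and $f\colon(U_X'\subset X)\to(U_B\subset B)$ is a toroidal morphism. Moreover, if $U_X\subset X$ is without self-intersection, then so is $U_X'\subset X$. -/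

import Mathlib

open CategoryTheory AlgebraicGeometry IsLocalRing

namespace Toroidal

noncomputable section

universe u

section CompletedLocalRings

/-- The ring homomorphism `R / 𝔪_R ^ n → S / 𝔪_S ^ n` induced by a local homomorphism
`φ : R → S` of local rings. -/
def quotientPowMap {R S : Type u} [CommRing R] [IsLocalRing R] [CommRing S] [IsLocalRing S]
    (φ : R →+* S) [IsLocalHom φ] (n : ℕ) : R ⧸ maximalIdeal R ^ n →+* S ⧸ maximalIdeal S ^ n :=
  Ideal.quotientMap (maximalIdeal S ^ n) φ
    (Ideal.map_le_iff_le_comap.mp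
      ((Ideal.map_pow φ (maximalIdeal R) n).trans_le
        (Ideal.pow_right_mono (Ideal.map_le_iff_le_comap.mpr (maximalIdeal_comap φ).ge) n)))

theorem factorPow_comp_quotientPowMap {R S : Type u} [CommRing R] [IsLocalRing R]
    [CommRing S] [IsLocalRing S] (φ : R →+* S) [IsLocalHom φ] {m n : ℕ} (hmn : m ≤ n) :
    (Ideal.Quotient.factorPow (maximalIdeal S) hmn).comp ((quotientPowMap φ n).comp
      (AdicCompletion.evalₐ (maximalIdeal R) n :
        AdicCompletion (maximalIdeal R) R →+* R ⧸ maximalIdeal R ^ n)) =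
    (quotientPowMap φ m).comp
      (AdicCompletion.evalₐ (maximalIdeal R) m :
        AdicCompletion (maximalIdeal R) R →+* R ⧸ maximalIdeal R ^ m) := by
  ext x
  induction x using AdicCompletion.induction_on with
  | _ a =>
    simp only [RingHom.comp_apply, RingHom.coe_coe, AdicCompletion.evalₐ_mk]
    rw [← AdicCompletion.Ideal.mk_eq_mk (I := maximalIdeal R) hmn a]
    rfl

/-- The ring homomorphism `R̂ → Ŝ` between the completions of two local rings with respect to their
maximal ideals, induced by a local homomorphism `φ : R → S`: it is the limit of the homomorphisms
`R / 𝔪_R ^ n → S / 𝔪_S ^ n` induced by `φ`. -/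
def completionMap {R S : Type u} [CommRing R] [IsLocalRing R] [CommRing S] [IsLocalRing S]
    (φ : R →+* S) [IsLocalHom φ] :
    AdicCompletion (maximalIdeal R) R →+* AdicCompletion (maximalIdeal S) S :=
  AdicCompletion.liftRingHom (maximalIdeal S)
    (fun n => (quotientPowMap φ n).comp
      (AdicCompletion.evalₐ (maximalIdeal R) n :
        AdicCompletion (maximalIdeal R) R →+* R ⧸ maximalIdeal R ^ n))
    (factorPow_comp_quotientPowMap φ)

/-- The completed local ring `𝒪̂_{X,x}` of a scheme at a point. -/
abbrev CompletedStalk (X : Scheme.{u}) (x : X) : Type u :=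
  AdicCompletion (maximalIdeal (X.presheaf.stalk x)) (X.presheaf.stalk x)

/-- The homomorphism `f̂^* : 𝒪̂_{Y,f(x)} → 𝒪̂_{X,x}` induced by a morphism `f : X ⟶ Y`. -/
def completedStalkMap {X Y : Scheme.{u}} (f : X ⟶ Y) (x : X) :
    CompletedStalk Y (f x) →+* CompletedStalk X x :=
  completionMap (f.stalkMap x).hom

/-- The structure homomorphism `k → 𝒪̂_{X,x}` of a scheme `X` over `k`. -/
def scalars {k : Type u} [Field k] (X : Over (Spec (.of k))) (x : X.left) :
    k →+* CompletedStalk X.left x :=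
  (algebraMap (X.left.presheaf.stalk x) (CompletedStalk X.left x)).comp
    ((Scheme.ΓSpecIso (.of k)).inv ≫ X.hom.appTop ≫
      X.left.presheaf.germ ⊤ x trivial).hom

/-- The ideal in the local ring `𝒪_{X,x}` of the subset `Z` of `X` (with its reduced structure,
when `Z` is closed): the germs which vanish at all points of `Z` in `Spec 𝒪_{X,x}`, that is, at
all points of `Z` which specialize to `x`. -/
def stalkIdeal (X : Scheme.{u}) (Z : Set X) (x : X) : Ideal (X.presheaf.stalk x) :=
  PrimeSpectrum.vanishingIdeal {p : PrimeSpectrum (X.presheaf.stalk x) | X.fromSpecStalk x p ∈ Z}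

/-- The ideal in the completed local ring `𝒪̂_{X,x}` of the subset `Z` of `X`. -/
def completedIdeal (X : Scheme.{u}) (Z : Set X) (x : X) : Ideal (CompletedStalk X x) :=
  (stalkIdeal X Z x).map (algebraMap (X.presheaf.stalk x) (CompletedStalk X x))

end CompletedLocalRings

section Varieties

/-- A variety over `k`: an integral separated scheme of finite type over `k`. -/
structure IsVariety {k : Type u} [Field k] (X : Over (Spec (.of k))) : Prop where
  isIntegral : IsIntegral X.left
  isSeparated : IsSeparated X.hom
  locallyOfFiniteType : LocallyOfFiniteType X.hom
  quasiCompact : QuasiCompact X.hom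

/-- A scheme is normal if all its local rings are integrally closed domains. -/
def IsNormalScheme (X : Scheme.{u}) : Prop :=
  ∀ x : X, IsDomain (X.presheaf.stalk x) ∧ IsIntegrallyClosed (X.presheaf.stalk x)

/-- A scheme is nonsingular if all its local rings are regular. -/
def IsNonsingular (X : Scheme.{u}) : Prop :=
  ∀ x : X, IsRegularLocalRing (X.presheaf.stalk x)

end Varieties

section ToricVarieties

/-- A strictly convex rational polyhedral cone `σ` in `N_ℝ = ℝ ^ n`, where `N = ℤ ^ n`. -/
structure RationalCone (n : ℕ) where
  cone : PointedCone ℝ (Fin n → ℝ)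
  rational : ∃ S : Finset (Fin n → ℤ),
    cone = Submodule.span {c : ℝ // 0 ≤ c} ((fun v i => (v i : ℝ)) '' (S : Set (Fin n → ℤ)))
  strictlyConvex : ∀ u ∈ cone, -u ∈ cone → u = 0

/-- The semigroup `σ^∨ ∩ M`, where the dual lattice `M` of `N = ℤ ^ n` is identified with `ℤ ^ n`
through the standard pairing. -/
def RationalCone.dualMonoid {n : ℕ} (σ : RationalCone n) : AddSubmonoid (Fin n → ℤ) where
  carrier := {m | ∀ u ∈ σ.cone, 0 ≤ (fun i => (m i : ℝ)) ⬝ᵥ u}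
  zero_mem' := by
    intro u _
    simp [dotProduct]
  add_mem' := by
    intro a b ha hb u hu
    have h := add_nonneg (ha u hu) (hb u hu)
    rw [← add_dotProduct] at h
    refine h.trans_eq (congrArg (· ⬝ᵥ u) ?_)
    ext i
    simp

/-- The semigroup algebra of `σ^∨ ∩ M` over `k`. -/
abbrev RationalCone.ring (k : Type u) [Field k] {n : ℕ} (σ : RationalCone n) : Type u :=
  AddMonoidAlgebra k σ.dualMonoid

/-- The affine toric variety `X_σ`, as a scheme over `k`. -/
def RationalCone.toricVariety (k : Type u) [Field k] {n : ℕ} (σ : RationalCone n) :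
    Over (Spec (.of k)) :=
  Over.mk (Spec.map (CommRingCat.ofHom (algebraMap k (σ.ring k))))

/-- The torus `T = Spec k[M]` inside `X_σ`: the image of the open immersion given by
the inclusion of `k[σ^∨ ∩ M]` into `k[M]`. -/
def RationalCone.torus (k : Type u) [Field k] {n : ℕ} (σ : RationalCone n) :
    Set (σ.toricVariety k).left :=
  Set.range (Spec.map (CommRingCat.ofHom
    (AddMonoidAlgebra.mapDomainRingHom k σ.dualMonoid.subtype)))

/-- A linear map of lattices `N_σ → N_τ`, given by an integral matrix, which maps `σ` into `τ`. -/
structure ConeHom {n m : ℕ} (σ : RationalCone n) (τ : RationalCone m) where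
  matrix : Matrix (Fin m) (Fin n) ℤ
  map_mem : ∀ u ∈ σ.cone, (matrix.map (Int.cast : ℤ → ℝ)).mulVec u ∈ τ.cone

/-- The dual homomorphism `τ^∨ ∩ M_τ → σ^∨ ∩ M_σ`. -/
def ConeHom.dualMap {n m : ℕ} {σ : RationalCone n} {τ : RationalCone m} (g : ConeHom σ τ) :
    τ.dualMonoid →+ σ.dualMonoid :=
  ((g.matrix.transpose.mulVecLin.toAddMonoidHom).comp τ.dualMonoid.subtype).codRestrict
    σ.dualMonoid (by
      intro m u hu
      have h := m.2 _ (g.map_mem u hu)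
      rw [Matrix.dotProduct_mulVec] at h
      convert h using 1
      congr 1
      ext i
      simp [Matrix.vecMul, dotProduct, mul_comm])

/-- The equivariant morphism `X_σ ⟶ X_τ` defined by a linear map of lattices. It is a toric
morphism when it is dominant. -/
def ConeHom.toricMap (k : Type u) [Field k] {n m : ℕ} {σ : RationalCone n} {τ : RationalCone m}
    (g : ConeHom σ τ) : σ.toricVariety k ⟶ τ.toricVariety k :=
  Over.homMk (Spec.map (CommRingCat.ofHom (AddMonoidAlgebra.mapDomainRingHom k g.dualMap)))
    (by
      change Spec.map _ ≫ Spec.map _ = Spec.map _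
      rw [← Spec.map_comp, ← CommRingCat.ofHom_comp]
      congr 2
      ext c
      simp)

end ToricVarieties

section ToroidalEmbeddings

variable {k : Type u} [Field k]

/-- The data which make `(X_σ, s)` a local model of `U ⊆ X` at the point `x`: an isomorphism
of `k`-algebras `𝒪̂_{X,x} ≅ 𝒪̂_{X_σ,s}` under which the ideal of `X ∖ U` corresponds to the ideal
of `X_σ ∖ T`. -/
structure LocalModel (X : Over (Spec (.of k))) (U : X.left.Opens) (x : X.left)
    {n : ℕ} (σ : RationalCone n) (s : (σ.toricVariety k).left) where
  iso : CompletedStalk X.left x ≃+* CompletedStalk (σ.toricVariety k).left s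
  iso_scalars : ∀ c : k, iso (scalars X x c) = scalars (σ.toricVariety k) s c
  map_ideal : (completedIdeal X.left (U : Set X.left)ᶜ x).map iso =
    completedIdeal (σ.toricVariety k).left (σ.torus k)ᶜ s

/-- `U ⊆ X` is a toroidal embedding: `X` is a normal variety, and every closed point of `X` has
a local model. -/
structure IsToroidalEmbedding (X : Over (Spec (.of k))) (U : X.left.Opens) : Prop where
  isVariety : IsVariety X
  isNormal : IsNormalScheme X.left
  exists_localModel : ∀ x : X.left, IsClosed {x} →
    ∃ (n : ℕ) (σ : RationalCone n) (s : (σ.toricVariety k).left),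
      Nonempty (LocalModel X U x σ s)

/-- The toroidal embedding `U ⊆ X` is without self-intersection (strict): every irreducible
component of `X ∖ U`, with its reduced structure, is normal. -/
def IsWithoutSelfIntersection (X : Over (Spec (.of k))) (U : X.left.Opens) : Prop :=
  ∀ E : Set X.left, Maximal (fun F : Set X.left => IsIrreducible F ∧ F ⊆ (U : Set X.left)ᶜ) E →
    ∀ x ∈ E, IsDomain (X.left.presheaf.stalk x ⧸ stalkIdeal X.left E x) ∧
      IsIntegrallyClosed (X.left.presheaf.stalk x ⧸ stalkIdeal X.left E x)

/-- `f : (U ⊆ X) ⟶ (V ⊆ B)` is a toroidal morphism of toroidal embeddings: it is dominant, maps `U`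
into `V`, and for every closed point `x` of `X` there are local models `(X_σ, s)` at `x` and
`(X_τ, t)` at `f(x)` and a toric morphism `g : X_σ ⟶ X_τ` with `g(s) = t` such that the
homomorphisms of completed local rings induced by `f` and by `g` correspond to each other. -/
structure IsToroidalMorphism {X B : Over (Spec (.of k))} (U : X.left.Opens) (V : B.left.Opens)
    (f : X ⟶ B) : Prop where
  source : IsToroidalEmbedding X U
  target : IsToroidalEmbedding B V
  isDominant : IsDominant f.left
  le_preimage : U ≤ f.left ⁻¹ᵁ V
  exists_localModel : ∀ x : X.left, IsClosed {x} →
    ∃ (n m : ℕ) (σ : RationalCone n) (τ : RationalCone m) (g : ConeHom σ τ)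
      (s : (σ.toricVariety k).left)
      (φ : LocalModel X U x σ s) (ψ : LocalModel B V (f.left x) τ ((g.toricMap k).left s)),
      IsDominant (g.toricMap k).left ∧
      ∀ a : CompletedStalk B.left (f.left x),
        φ.iso (completedStalkMap f.left x a) =
          completedStalkMap (g.toricMap k).left s (ψ.iso a)

end ToroidalEmbeddings

end

end Toroidal

/-! At a closed point take a local model X_σ → X_τ of f. First replace σ by a face for which every
character that does not vanish at s is invertible (`RationalCone.exists_face`). Since the completed
local ring is a power series ring, σ is then a regular cone: it has rays e_i and dual lattice points
p_i, and the functions x_i = χ^{p_i} are pairwise non-associated primes of the completion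
(`RationalCone.exists_coordinates_of_isRegularCompletion`). The boundary X ∖ U_X becomes ∏ x_i = 0.
Primality is detected by homomorphisms to the dual numbers: an element of order one in a power
series ring is prime.

Let m₀ be a lattice point interior to τ^∨, so that χ^{m₀} = 0 is the boundary of X_τ, and let I be
the set of those i for which e_i is positive on g^*m₀. The preimage of that boundary is ∏_{i∈I} x_i
= 0, and no character pulled back from X_τ involves the coordinates outside I. Adding 1 to those
coordinates is therefore an automorphism of X_σ over X_τ. It moves s into the affine toric variety
of the cone spanned by the rays in I, where the preimage of the torus of X_τ is exactly the torus.
This is the local model for U_X' (`LocalModel.exists_preimage`).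

The delicate point is that the ideal of X ∖ U_X' is a radical taken in the uncompleted local ring,
and its extension to the completion has to be generated by ∏_{i∈I} x_i. No excellence is invoked.
The ideal of X ∖ U_X descends to a principal ideal (h) by faithful flatness, and
`map_radical_eq_span_prod` splits h inside the local ring into factors belonging to I and to its
complement (`map_completedIdeal_preimage`).

For self-intersections, X ∖ U_X' is locally principal and lies in the proper closed subset X ∖ U_X.
By Krull's theorem its components have codimension at most one, so they are already components of X
∖ U_X (`maximal_isIrreducible_of_subset`), which are normal by assumption. -/

namespace Toroidal

universe u

/-! ### Leading forms in a regular local ring. -/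

section RegularLocalRings

theorem aeval_algebraMap_mul {k R ι : Type*} [Field k] [CommRing R] [Algebra k R] [Fintype ι]
    {n : ℕ} {F : MvPolynomial ι k} (hF : F.IsHomogeneous n) (c : ι → k) (r : R) :
    MvPolynomial.aeval (fun i => algebraMap k R (c i) * r) F =
      r ^ n * algebraMap k R (MvPolynomial.eval c F) := by
  rw [MvPolynomial.aeval_def, MvPolynomial.eval₂_eq', MvPolynomial.eval_eq', map_sum,
    Finset.mul_sum]
  refine Finset.sum_congr rfl fun d hd => ?_
  have hdeg : ∑ i, d i = n := by
    have := hF (MvPolynomial.mem_support_iff.mp hd)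
    rw [← this, Finsupp.weight_apply, Finsupp.sum_fintype]
    · simp
    · simp
  simp only [mul_pow, Finset.prod_mul_distrib, Finset.prod_pow_eq_pow_sum, hdeg, map_mul, map_prod,
    map_pow]
  ring

/-- The monomials in a regular system of parameters of a regular local ring are independent
to leading order. -/
theorem eq_zero_of_aeval_mem_pow {k R ι : Type*} [Field k] [Infinite k] [CommRing R] [Algebra k R]
    [IsRegularLocalRing R] [Fintype ι] (t : ι → R)
    (ht : Ideal.span (Set.range t) = maximalIdeal R)
    (hcard : (Fintype.card ι : WithBot ℕ∞) = ringKrullDim R) {n : ℕ} {F : MvPolynomial ι k}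
    (hF : F.IsHomogeneous n) (hmem : MvPolynomial.aeval t F ∈ maximalIdeal R ^ (n + 1)) :
    F = 0 := by
  classical
  by_contra hF0
  -- A nonzero polynomial over an infinite field has a nonzero value.
  obtain ⟨c, hc⟩ : ∃ c : ι → k, MvPolynomial.eval c F ≠ 0 := by
    by_contra! h
    exact hF0 (MvPolynomial.funext fun c => by simpa using h c)
  have hunit : ∀ a : k, a ≠ 0 → algebraMap k R a ∉ maximalIdeal R := fun a ha h =>
    (mem_maximalIdeal _).mp h ((isUnit_iff_ne_zero.mpr ha).map (algebraMap k R))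
  by_cases hc0 : ∃ j, c j ≠ 0
  · obtain ⟨j, hj⟩ := hc0
    set e : ι → k := fun i => c i / c j with he
    have hce : MvPolynomial.eval e F ≠ 0 := by
      have h := aeval_algebraMap_mul hF e (c j)
      have h2 : (fun i => algebraMap k k (e i) * c j) = c := by
        ext i
        simp [he, hj]
      rw [h2] at h
      intro h0
      rw [h0, map_zero, mul_zero] at h
      exact hc ((congr($(MvPolynomial.coe_aeval_eq_eval c) F)).symm.trans h)
    let s : Finset R := (Finset.univ.erase j).image fun i => t i - algebraMap k R (e i) * t j
    -- Restriction to the line through c: modulo J the parameters become e i * t j, so the maximal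
    -- ideal is generated by t j and F(t) becomes t j ^ n * F(e) with F(e) a unit. Membership in the
    -- power n + 1 then forces t j ^ n into J.
    set J : Ideal R := Ideal.span (s : Set R) with hJ
    have hrel : ∀ i, t i - algebraMap k R (e i) * t j ∈ J := by
      intro i
      by_cases hi : i = j
      · subst hi
        simp [he, hj]
      · exact Ideal.subset_span (by
          simp only [s, Finset.coe_image, Set.mem_image]
          exact ⟨i, by simpa using hi, rfl⟩)
    have htj : t j ∈ maximalIdeal R := ht ▸ Ideal.subset_span ⟨j, rfl⟩
    have hJm : J ≤ maximalIdeal R := by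
      rw [hJ, Ideal.span_le]
      intro x hx
      simp only [s, Finset.coe_image, Set.mem_image] at hx
      obtain ⟨i, -, rfl⟩ := hx
      exact sub_mem (ht ▸ Ideal.subset_span ⟨i, rfl⟩) (Ideal.mul_mem_left _ _ htj)
    have hm : maximalIdeal R ≤ J ⊔ Ideal.span {t j} := by
      rw [← ht, Ideal.span_le]
      rintro _ ⟨i, rfl⟩
      rw [← sub_add_cancel (t i) (algebraMap k R (e i) * t j)]
      exact add_mem (Ideal.mem_sup_left (hrel i))
        (Ideal.mem_sup_right (Ideal.mul_mem_left _ _ (Ideal.mem_span_singleton_self _)))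
    let q : R →ₐ[k] R ⧸ J := Ideal.Quotient.mkₐ k J
    have hq0 : ∀ x, q x = 0 ↔ x ∈ J := fun x => Ideal.Quotient.eq_zero_iff_mem
    have hq : ∀ i, q (t i) = algebraMap k (R ⧸ J) (e i) * q (t j) := by
      intro i
      have := (hq0 _).mpr (hrel i)
      rwa [map_sub, sub_eq_zero, map_mul, AlgHom.commutes] at this
    have hqF : q (MvPolynomial.aeval t F) =
        q (t j ^ n * algebraMap k R (MvPolynomial.eval e F)) := by
      rw [MvPolynomial.comp_aeval_apply, map_mul, map_pow, AlgHom.commutes,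
        ← aeval_algebraMap_mul hF]
      congr 1
      exact congrArg _ (funext hq)
    have hqm : (maximalIdeal R).map q ≤ Ideal.span {q (t j)} := by
      refine (Ideal.map_mono hm).trans ?_
      rw [Ideal.map_sup, Ideal.map_span _ {t j}, Set.image_singleton]
      refine sup_le ?_ le_rfl
      rw [Ideal.map_le_iff_le_comap]
      intro x hx
      simp [Ideal.mem_comap, (hq0 x).mpr hx]
    obtain ⟨r, hr⟩ : ∃ r, q (MvPolynomial.aeval t F) = q (t j ^ (n + 1) * r) := by
      have h1 := Ideal.mem_map_of_mem q hmem
      rw [Ideal.map_pow] at h1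
      have h2 := Ideal.pow_right_mono hqm (n + 1) h1
      rw [Ideal.span_singleton_pow, Ideal.mem_span_singleton] at h2
      obtain ⟨r, hr⟩ := h2
      obtain ⟨r, rfl⟩ := Ideal.Quotient.mk_surjective r
      exact ⟨r, by rw [hr, map_mul, map_pow]; rfl⟩
    have hu : IsUnit (algebraMap k R (MvPolynomial.eval e F) - t j * r) := by
      by_contra h
      refine hunit _ hce ?_
      rw [← sub_add_cancel (algebraMap k R (MvPolynomial.eval e F)) (t j * r)]
      exact add_mem ((mem_maximalIdeal _).mpr h) (Ideal.mul_mem_right _ _ htj)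
    have htjn : t j ^ n ∈ J := by
      have h : q (t j ^ n * (algebraMap k R (MvPolynomial.eval e F) - t j * r)) = 0 := by
        rw [mul_sub, map_sub, ← hqF, hr, ← mul_assoc, ← pow_succ, sub_self]
      rw [hq0] at h
      exact (Ideal.mul_unit_mem_iff_mem J hu).mp h
    -- J has one generator fewer than the dimension, so Krull's height theorem excludes this.
    have hmin : maximalIdeal R ∈ J.minimalPrimes := by
      refine ⟨⟨inferInstance, hJm⟩, fun p ⟨hp, hJp⟩ _ => hm.trans (sup_le hJp ?_)⟩
      rw [Ideal.span_singleton_le_iff_mem]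
      exact hp.mem_of_pow_mem n (hJp htjn)
    have hle := Ideal.height_le_card_of_mem_minimalPrimes_span_finset hmin
    have hcard2 : s.card < Fintype.card ι := by
      refine Finset.card_image_le.trans_lt ?_
      rw [← Finset.card_univ]
      exact Finset.card_erase_lt_of_mem (Finset.mem_univ j)
    have h1 : (Fintype.card ι : ℕ∞) ≤ s.card := by
      refine le_trans (WithBot.coe_le_coe.mp ?_) hle
      rw [IsLocalRing.maximalIdeal_height_eq_ringKrullDim, ← hcard]
      rfl
    exact absurd (by exact_mod_cast h1) hcard2.not_ge
  -- The only nonzero value found is at the origin, so F has degree 0 and is a nonzero constant.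
  · push Not at hc0
    have hn : n = 0 := by
      by_contra hn
      refine hc ?_
      have h := aeval_algebraMap_mul hF c (0 : k)
      have h2 : (fun i => algebraMap k k (c i) * 0) = c := by
        ext i
        simp [hc0]
      rw [h2, zero_pow hn, zero_mul] at h
      exact (congr($(MvPolynomial.coe_aeval_eq_eval c) F)).symm.trans h
    subst hn
    have h := aeval_algebraMap_mul (R := R) hF c (0 : R)
    obtain ⟨a, rfl⟩ : ∃ a, F = MvPolynomial.C a :=
      ⟨_, MvPolynomial.totalDegree_eq_zero_iff_eq_C.mp (hF.totalDegree hF0)⟩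
    rw [MvPolynomial.aeval_C, zero_add, pow_one] at hmem
    rw [MvPolynomial.eval_C] at hc
    exact hunit _ hc hmem

/-- Induction on n: the terms of degree above n evaluate into the next power of the maximal ideal,
hence so does the component of degree n, which therefore vanishes. -/
theorem mem_pow_idealOfVars_of_aeval_mem {k R ι : Type*} [Field k] [Infinite k] [CommRing R]
    [Algebra k R] [IsRegularLocalRing R] [Fintype ι] (t : ι → R)
    (ht : Ideal.span (Set.range t) = maximalIdeal R)
    (hcard : (Fintype.card ι : WithBot ℕ∞) = ringKrullDim R) {n : ℕ} {F : MvPolynomial ι k}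
    (hmem : MvPolynomial.aeval t F ∈ maximalIdeal R ^ n) :
    F ∈ MvPolynomial.idealOfVars ι k ^ n := by
  induction n with
  | zero => simp
  | succ n ih =>
    have hF := ih (Ideal.pow_le_pow_right n.le_succ hmem)
    have hI : (MvPolynomial.idealOfVars ι k).map (MvPolynomial.aeval t) ≤ maximalIdeal R := by
      rw [MvPolynomial.idealOfVars, Ideal.map_span, ← ht, Ideal.span_le]
      rintro _ ⟨_, ⟨i, rfl⟩, rfl⟩
      exact Ideal.subset_span ⟨i, by simp⟩
    have hpow : ∀ (m : ℕ) (G : MvPolynomial ι k), G ∈ MvPolynomial.idealOfVars ι k ^ m →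
        MvPolynomial.aeval t G ∈ maximalIdeal R ^ m := fun m G hG =>
      Ideal.pow_right_mono hI m (by
        rw [← Ideal.map_pow]
        exact Ideal.mem_map_of_mem (MvPolynomial.aeval t) hG)
    have hdiff : F - MvPolynomial.homogeneousComponent n F ∈
        MvPolynomial.idealOfVars ι k ^ (n + 1) := by
      rw [MvPolynomial.mem_pow_idealOfVars_iff'] at hF ⊢
      intro x hx
      rw [MvPolynomial.coeff_sub, MvPolynomial.coeff_homogeneousComponent]
      rcases (Nat.lt_succ_iff.mp hx).lt_or_eq with h | h
      · rw [hF x h]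
        split_ifs <;> simp
      · simp [h]
    have h0 := eq_zero_of_aeval_mem_pow t ht hcard
      (MvPolynomial.homogeneousComponent_isHomogeneous n F) (by
        rw [← sub_sub_cancel F (MvPolynomial.homogeneousComponent n F), map_sub]
        exact sub_mem hmem (hpow _ _ hdiff))
    rwa [h0, sub_zero] at hdiff

end RegularLocalRings

/-! ### Completions of regular local rings as power series rings. -/

section RegularLocalRings

theorem factorPow_evalₐ {A : Type*} [CommRing A] (I : Ideal A) {m n : ℕ} (hmn : m ≤ n)
    (x : AdicCompletion I A) : Ideal.Quotient.factorPow I hmn (AdicCompletion.evalₐ I n x) =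
      AdicCompletion.evalₐ I m x := by
  induction x using AdicCompletion.induction_on with
  | _ a =>
    simp only [AdicCompletion.evalₐ_mk]
    rw [← AdicCompletion.Ideal.mk_eq_mk (I := I) hmn a]
    rfl

/-- Compatible homomorphisms `A / I ^ n → B / J ^ n` induce a homomorphism of the completions. -/
noncomputable def adicCompletionHom {A B : Type*} [CommRing A] [CommRing B] {I : Ideal A}
    {J : Ideal B} (e : ∀ n, A ⧸ I ^ n →+* B ⧸ J ^ n)
    (he : ∀ (m n : ℕ) (hmn : m ≤ n) (x : A ⧸ I ^ n),
      Ideal.Quotient.factorPow J hmn (e n x) = e m (Ideal.Quotient.factorPow I hmn x)) :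
    AdicCompletion I A →+* AdicCompletion J B :=
  AdicCompletion.liftRingHom J (fun n => (e n).comp
    (AdicCompletion.evalₐ I n : AdicCompletion I A →+* A ⧸ I ^ n)) (fun hmn => by
      ext x
      simp [he, factorPow_evalₐ])

theorem evalₐ_adicCompletionHom {A B : Type*} [CommRing A] [CommRing B] {I : Ideal A}
    {J : Ideal B} (e : ∀ n, A ⧸ I ^ n →+* B ⧸ J ^ n)
    (he : ∀ (m n : ℕ) (hmn : m ≤ n) (x : A ⧸ I ^ n),
      Ideal.Quotient.factorPow J hmn (e n x) = e m (Ideal.Quotient.factorPow I hmn x))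
    (n : ℕ) (x : AdicCompletion I A) :
    AdicCompletion.evalₐ J n (adicCompletionHom e he x) = e n (AdicCompletion.evalₐ I n x) :=
  AdicCompletion.evalₐ_liftRingHom J (fun n => (e n).comp
    (AdicCompletion.evalₐ I n : AdicCompletion I A →+* A ⧸ I ^ n)) (fun hmn => by
      ext x
      simp [he, factorPow_evalₐ]) n x

/-- Compatible isomorphisms `A / I ^ n ≃ B / J ^ n` induce an isomorphism of the completions. -/
noncomputable def adicCompletionEquiv {A B : Type*} [CommRing A] [CommRing B] {I : Ideal A}
    {J : Ideal B} (e : ∀ n, A ⧸ I ^ n ≃+* B ⧸ J ^ n)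
    (he : ∀ (m n : ℕ) (hmn : m ≤ n) (x : A ⧸ I ^ n),
      Ideal.Quotient.factorPow J hmn (e n x) = e m (Ideal.Quotient.factorPow I hmn x)) :
    AdicCompletion I A ≃+* AdicCompletion J B :=
  have he' (m n : ℕ) (hmn : m ≤ n) (x : B ⧸ J ^ n) :
      Ideal.Quotient.factorPow I hmn (((e n).symm : B ⧸ J ^ n →+* A ⧸ I ^ n) x) =
        ((e m).symm : B ⧸ J ^ m →+* A ⧸ I ^ m) (Ideal.Quotient.factorPow J hmn x) := by
    apply (e m).injective
    simp [← he]
  RingEquiv.ofRingHom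
    (adicCompletionHom (fun n => (e n : A ⧸ I ^ n →+* B ⧸ J ^ n)) he)
    (adicCompletionHom (fun n => ((e n).symm : B ⧸ J ^ n →+* A ⧸ I ^ n)) he')
    (RingHom.ext fun x => AdicCompletion.ext_evalₐ fun n =>
      (evalₐ_adicCompletionHom _ he n _).trans
        ((congrArg (e n) (evalₐ_adicCompletionHom _ he' n x)).trans ((e n).apply_symm_apply _)))
    (RingHom.ext fun x => AdicCompletion.ext_evalₐ fun n =>
      (evalₐ_adicCompletionHom _ he' n _).trans
        ((congrArg (e n).symm (evalₐ_adicCompletionHom _ he n x)).trans ((e n).symm_apply_apply _)))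

theorem evalₐ_adicCompletionEquiv {A B : Type*} [CommRing A] [CommRing B] {I : Ideal A}
    {J : Ideal B} (e : ∀ n, A ⧸ I ^ n ≃+* B ⧸ J ^ n)
    (he : ∀ (m n : ℕ) (hmn : m ≤ n) (x : A ⧸ I ^ n),
      Ideal.Quotient.factorPow J hmn (e n x) = e m (Ideal.Quotient.factorPow I hmn x))
    (n : ℕ) (x : AdicCompletion I A) :
    AdicCompletion.evalₐ J n (adicCompletionEquiv e he x) = e n (AdicCompletion.evalₐ I n x) := by
  rw [adicCompletionEquiv, RingEquiv.ofRingHom_apply]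
  exact evalₐ_adicCompletionHom (fun n => (e n : A ⧸ I ^ n →+* B ⧸ J ^ n)) he n x

/-- Separating one variable gives univariate power series over a domain, where the variable is
prime. -/
theorem mvPowerSeries_X_none_prime {k ι : Type*} [Field k] :
    Prime (MvPowerSeries.X none : MvPowerSeries (Option ι) k) := by
  rw [← MulEquiv.prime_iff (MvPowerSeries.optionEquivLeft ι k).toMulEquiv]
  have : (MvPowerSeries.optionEquivLeft ι k).toMulEquiv (MvPowerSeries.X none) =
    PowerSeries.X := MvPowerSeries.optionEquivLeft_X_none
  rw [this]
  have : IsDomain (MvPowerSeries ι k) := NoZeroDivisors.to_isDomain _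
  exact PowerSeries.X_prime

/-- Taylor expansion: subtract the constant term, write the rest as a combination of the parameters,
and expand the coefficients to one order less. -/
theorem exists_sub_aeval_mem_pow {k R ι : Type*} [Field k] [CommRing R] [Algebra k R]
    [IsLocalRing R] (hres : ∀ a : R, ∃ c : k, a - algebraMap k R c ∈ maximalIdeal R)
    [Fintype ι] (t : ι → R) (ht : Ideal.span (Set.range t) = maximalIdeal R) (n : ℕ) (r : R) :
    ∃ F : MvPolynomial ι k, r - MvPolynomial.aeval t F ∈ maximalIdeal R ^ n := by
  induction n generalizing r with
  | zero => exact ⟨0, by simp⟩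
  | succ n ih =>
    obtain ⟨c, hc⟩ := hres r
    rw [← ht, Ideal.mem_span_range_iff_exists_fun] at hc
    obtain ⟨a, ha⟩ := hc
    choose F hF using fun i => ih (a i)
    refine ⟨MvPolynomial.C c + ∑ i, F i * MvPolynomial.X i, ?_⟩
    have : r - MvPolynomial.aeval t (MvPolynomial.C c + ∑ i, F i * MvPolynomial.X i) =
        ∑ i, (a i - MvPolynomial.aeval t (F i)) * t i := by
      simp only [map_add, map_sum, map_mul, MvPolynomial.aeval_X, MvPolynomial.algHom_C, sub_mul,
        Finset.sum_sub_distrib, ha]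
      ring
    rw [this]
    refine Ideal.sum_mem _ fun i _ => ?_
    rw [pow_succ]
    exact Ideal.mul_mem_mul (hF i) (ht ▸ Ideal.subset_span ⟨i, rfl⟩)

/-- The completion of a regular local ring with an infinite coefficient field is a ring of formal
power series in any lift of a regular system of parameters. -/
theorem exists_mvPowerSeries_equiv {k R ι : Type*} [Field k] [Infinite k] [CommRing R]
    [Algebra k R] [IsRegularLocalRing R]
    (hres : ∀ a : R, ∃ c : k, a - algebraMap k R c ∈ maximalIdeal R) [Fintype ι]
    (t : ι → R) (ht : Ideal.span (Set.range t) = maximalIdeal R)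
    (hcard : (Fintype.card ι : WithBot ℕ∞) = ringKrullDim R)
    (m : Ideal R) (hm : m = maximalIdeal R) (T : ι → AdicCompletion m R)
    (hT : ∀ i, AdicCompletion.evalₐ m 2 (T i) = Ideal.Quotient.mk _ (t i)) :
    ∃ E : MvPowerSeries ι k ≃+* AdicCompletion m R, ∀ i, E (MvPowerSeries.X i) = T i := by
  classical
  rw [← hm] at ht hres
  -- The lift is taken modulo the power max n 2, so that t' agrees with t modulo m ^ 2 even for
  -- small n; by Nakayama t' still generates m.
  have hlift : ∀ n, ∃ t' : ι → R, Ideal.span (Set.range t') = m ∧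
      ∀ i, AdicCompletion.evalₐ m n (T i) = Ideal.Quotient.mk _ (t' i) := by
    intro n
    choose t' ht' using fun i =>
      Ideal.Quotient.mk_surjective (AdicCompletion.evalₐ m (max n 2) (T i))
    have h2 : ∀ i, t' i - t i ∈ m ^ 2 := by
      intro i
      rw [← Ideal.Quotient.mk_eq_mk_iff_sub_mem, ← hT, ← factorPow_evalₐ m (le_max_right n 2),
        ← ht']
      rfl
    have htm : ∀ i, t i ∈ m := fun i => ht ▸ Ideal.subset_span ⟨i, rfl⟩
    refine ⟨t', le_antisymm ?_ ?_, fun i => ?_⟩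
    · rw [Ideal.span_le]
      rintro _ ⟨i, rfl⟩
      rw [← sub_add_cancel (t' i) (t i)]
      exact add_mem (Ideal.pow_le_self two_ne_zero (h2 i)) (htm i)
    · refine Submodule.le_of_le_smul_of_le_jacobson_bot (I := m)
        ((isNoetherianRing_iff_ideal_fg R).mp inferInstance m)
        (hm ▸ IsLocalRing.maximalIdeal_le_jacobson _) ?_
      conv_lhs => rw [← ht]
      rw [Ideal.span_le]
      rintro _ ⟨i, rfl⟩
      rw [← sub_sub_cancel (t' i) (t i)]
      refine sub_mem (Ideal.mem_sup_left (Ideal.subset_span ⟨i, rfl⟩)) (Ideal.mem_sup_right ?_)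
      have := h2 i
      rwa [pow_two] at this
    · rw [← factorPow_evalₐ m (le_max_left n 2), ← ht']
      rfl
  let φ : ∀ n, MvPolynomial ι k →+* R ⧸ m ^ n := fun n =>
    ((AdicCompletion.evalₐ m n : AdicCompletion m R →+* R ⧸ m ^ n)).comp
      (MvPolynomial.aeval T : MvPolynomial ι k →ₐ[k] AdicCompletion m R)
  have hφ : ∀ n (t' : ι → R),
      (∀ i, AdicCompletion.evalₐ m n (T i) = Ideal.Quotient.mk _ (t' i)) → ∀ F,
      φ n F = Ideal.Quotient.mk _ (MvPolynomial.aeval t' F) := by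
    intro n t' ht' F
    have : φ n = (Ideal.Quotient.mk (m ^ n)).comp
        (MvPolynomial.aeval t' : MvPolynomial ι k →ₐ[k] R) := by
      refine MvPolynomial.ringHom_ext (fun c => ?_) fun i => ?_
      · have : AdicCompletion.evalₐ m n (algebraMap k (AdicCompletion m R) c) =
            Ideal.Quotient.mk (m ^ n) (algebraMap k R c) := by
          exact AlgHom.commutes _ (algebraMap k R c)
        simp [φ, this]
      · simp [φ, ht']
    rw [this]
    rfl
  have hφs : ∀ n, Function.Surjective (φ n) := by
    intro n x
    obtain ⟨r, rfl⟩ := Ideal.Quotient.mk_surjective x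
    obtain ⟨t', ht'm, ht'⟩ := hlift n
    obtain ⟨F, hF⟩ := exists_sub_aeval_mem_pow (by rwa [← hm]) t' (ht'm.trans hm) n r
    exact ⟨F, by rw [hφ n t' ht', eq_comm, Ideal.Quotient.mk_eq_mk_iff_sub_mem, hm]; exact hF⟩
  -- Independence of leading forms gives the nontrivial inclusion. With surjectivity, the
  -- truncations of both rings are identified compatibly and the limit is the required isomorphism.
  have hφk : ∀ n, RingHom.ker (φ n) = MvPolynomial.idealOfVars ι k ^ n := by
    intro n
    obtain ⟨t', ht'm, ht'⟩ := hlift n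
    refine le_antisymm (fun F hF => ?_) ?_
    · rw [RingHom.mem_ker, hφ n t' ht', Ideal.Quotient.eq_zero_iff_mem] at hF
      exact mem_pow_idealOfVars_of_aeval_mem t' (ht'm.trans hm) hcard (hm ▸ hF)
    · intro F hF
      rw [RingHom.mem_ker, hφ n t' ht', Ideal.Quotient.eq_zero_iff_mem]
      have h1 : (MvPolynomial.idealOfVars ι k).map (MvPolynomial.aeval t') ≤ m := by
        rw [MvPolynomial.idealOfVars, Ideal.map_span, ← ht'm, Ideal.span_le]
        rintro _ ⟨_, ⟨i, rfl⟩, rfl⟩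
        exact Ideal.subset_span ⟨i, by simp⟩
      refine Ideal.pow_right_mono h1 n ?_
      rw [← Ideal.map_pow]
      exact Ideal.mem_map_of_mem (MvPolynomial.aeval t') hF
  let e : ∀ n, (MvPolynomial ι k ⧸ MvPolynomial.idealOfVars ι k ^ n) ≃+*
      R ⧸ m ^ n := fun n =>
    (Ideal.quotEquivOfEq (hφk n).symm).trans (RingHom.quotientKerEquivOfSurjective (hφs n))
  have he : ∀ n F, e n (Ideal.Quotient.mk _ F) = φ n F := fun n F => rfl
  let E := adicCompletionEquiv e (fun a b hab x => by
    obtain ⟨F, rfl⟩ := Ideal.Quotient.mk_surjective x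
    rw [he]
    change _ = e a (Ideal.Quotient.mk _ F)
    rw [he]
    exact factorPow_evalₐ _ _ _)
  refine ⟨(MvPowerSeries.toAdicCompletionAlgEquiv ι k).toRingEquiv.trans E, fun i => ?_⟩
  have hX : MvPowerSeries.toAdicCompletionAlgEquiv ι k (MvPowerSeries.X i) =
      AdicCompletion.of _ _ (MvPolynomial.X i) := by
    rw [MvPowerSeries.toAdicCompletionAlgEquiv_apply, ← MvPowerSeries.toAdicCompletion_coe,
      MvPolynomial.coe_X]
  change E (MvPowerSeries.toAdicCompletionAlgEquiv ι k (MvPowerSeries.X i)) = T i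
  rw [hX]
  refine AdicCompletion.ext_evalₐ fun n => ?_
  rw [evalₐ_adicCompletionEquiv, AdicCompletion.evalₐ_of, he]
  simp [φ]

/-- An element whose class modulo m ^ 2 belongs to a regular system of parameters can serve as one
of the power series variables. -/
theorem prime_of_span_eq {k R ι : Type*} [Field k] [Infinite k] [CommRing R]
    [Algebra k R] [IsRegularLocalRing R]
    (hres : ∀ a : R, ∃ c : k, a - algebraMap k R c ∈ maximalIdeal R) [Fintype ι]
    (t : Option ι → R) (ht : Ideal.span (Set.range t) = maximalIdeal R)
    (hcard : (Fintype.card (Option ι) : WithBot ℕ∞) = ringKrullDim R)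
    (m : Ideal R) (hm : m = maximalIdeal R) (y : AdicCompletion m R)
    (hy : AdicCompletion.evalₐ m 2 y = Ideal.Quotient.mk _ (t none)) :
    Prime y := by
  obtain ⟨E, hE⟩ := exists_mvPowerSeries_equiv hres t ht hcard m hm
    (fun i => i.elim y (fun j => algebraMap R _ (t (some j)))) (by
      rintro (_ | j)
      · exact hy
      · exact AlgHom.commutes _ _)
  have h := hE none
  change _ = y at h
  rw [← h]
  exact (MulEquiv.prime_iff E.toMulEquiv).mpr mvPowerSeries_X_none_prime

/-- The completion of a regular local ring with an infinite coefficient field is a noetherian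
domain. -/
theorem adicCompletion_isDomain_and_isNoetherianRing {k R : Type*} [Field k] [Infinite k]
    [CommRing R] [Algebra k R] [IsRegularLocalRing R]
    (hres : ∀ a : R, ∃ c : k, a - algebraMap k R c ∈ maximalIdeal R) :
    IsDomain (AdicCompletion (maximalIdeal R) R) ∧
      IsNoetherianRing (AdicCompletion (maximalIdeal R) R) := by
  have hfg : (maximalIdeal R).FG := (isNoetherianRing_iff_ideal_fg R).mp inferInstance _
  let G := (maximalIdeal R).generators
  have : Finite G := Submodule.FG.finite_generators hfg
  have : Fintype G := Fintype.ofFinite G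
  obtain ⟨E, -⟩ := exists_mvPowerSeries_equiv hres (fun g : G => (g : R))
    (by rw [Subtype.range_coe]; exact Submodule.span_generators _)
    (by
      rw [← IsRegularLocalRing.spanFinrank_maximalIdeal, ← Submodule.FG.generators_ncard hfg,
        ← Nat.card_coe_set_eq, Nat.card_eq_fintype_card]) _ rfl
    (fun g => algebraMap R _ (g : R)) fun g => AlgHom.commutes _ _
  have : IsDomain (MvPowerSeries G k) := NoZeroDivisors.to_isDomain _
  exact ⟨E.symm.toMulEquiv.isDomain _, isNoetherianRing_of_ringEquiv _ E⟩

/-- For a finitely generated ideal, the kernel of a truncation is the extension of the corresponding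
power. Order in the completion can thus be read off in R. -/
theorem mem_maximalIdeal_pow_iff_evalₐ_eq_zero {R : Type*} [CommRing R] [IsLocalRing R]
    [IsNoetherianRing R] (n : ℕ) (z : AdicCompletion (maximalIdeal R) R) :
    z ∈ maximalIdeal (AdicCompletion (maximalIdeal R) R) ^ n ↔
      AdicCompletion.evalₐ (maximalIdeal R) n z = 0 := by
  rw [AdicCompletion.maximalIdeal_eq_map, ← Ideal.map_pow, ← Submodule.restrictScalars_mem R,
    ← Ideal.smul_top_eq_map, AdicCompletion.pow_smul_top_eq_ker_eval
      ((isNoetherianRing_iff_ideal_fg R).mp inferInstance _), LinearMap.mem_ker]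
  rw [← AdicCompletion.factor_eval_eq_evalₐ (maximalIdeal R) z (Ideal.mul_top _).le]
  constructor
  · intro h
    rw [h, map_zero]
  · intro h
    obtain ⟨w, hw⟩ := Ideal.Quotient.mk_surjective
      (AdicCompletion.eval (maximalIdeal R) R n z)
    rw [← hw] at h ⊢
    have h : Ideal.Quotient.mk (maximalIdeal R ^ n) w = 0 := h
    rw [Ideal.Quotient.eq_zero_iff_mem] at h ⊢
    simpa using h

/-- In the completion of a regular local ring with an infinite coefficient field, every element
of order one is prime. -/
theorem prime_of_notMem_sq {k R : Type*} [Field k] [Infinite k] [CommRing R]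
    [Algebra k R] [IsRegularLocalRing R]
    (hres : ∀ a : R, ∃ c : k, a - algebraMap k R c ∈ maximalIdeal R)
    (y : AdicCompletion (maximalIdeal R) R)
    (hy : y ∈ maximalIdeal (AdicCompletion (maximalIdeal R) R))
    (hy2 : y ∉ maximalIdeal (AdicCompletion (maximalIdeal R) R) ^ 2) :
    Prime y := by
  classical
  obtain ⟨y₀, hy₀⟩ := Ideal.Quotient.mk_surjective (AdicCompletion.evalₐ (maximalIdeal R) 2 y)
  have h1 : y₀ ∈ maximalIdeal R := by
    rw [← pow_one (maximalIdeal (AdicCompletion _ R)),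
      mem_maximalIdeal_pow_iff_evalₐ_eq_zero, ← factorPow_evalₐ _ one_le_two, ← hy₀] at hy
    have := Ideal.Quotient.eq_zero_iff_mem.mp hy
    rwa [pow_one] at this
  have h2 : y₀ ∉ maximalIdeal R ^ 2 := by
    rw [mem_maximalIdeal_pow_iff_evalₐ_eq_zero, ← hy₀, Ideal.Quotient.eq_zero_iff_mem] at hy2
    exact hy2
  -- The class of y₀ is nonzero, so it extends to a basis of the cotangent space. By Nakayama, lifts
  -- of the basis with y₀ as lift of v form a regular system of parameters.
  let v : CotangentSpace R := (maximalIdeal R).toCotangent ⟨y₀, h1⟩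
  have hv : v ≠ 0 := by
    intro h
    exact h2 ((Ideal.toCotangent_eq_zero _ _).mp h)
  have hs : LinearIndepOn (ResidueField R) id ({v} : Set (CotangentSpace R)) :=
    (LinearIndepOn.singleton (v := id) hv)
  let b := Module.Basis.extend hs
  let B := hs.extend (Set.subset_univ _)
  have hvB : v ∈ B := Module.Basis.subset_extend hs rfl
  have : Finite B := Module.Finite.finite_basis b
  have : Fintype B := Fintype.ofFinite B
  have hcardB : (Fintype.card B : WithBot ℕ∞) = ringKrullDim R := by
    rw [← Module.finrank_eq_card_basis b]
    exact (IsRegularLocalRing.iff_finrank_cotangentSpace R).mp inferInstance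
  let vB : B := ⟨v, hvB⟩
  let ε : Option {w : B // w ≠ vB} ≃ B := Equiv.optionSubtypeNe vB
  obtain ⟨tm, htm, htm0⟩ : ∃ tm : Option {w : B // w ≠ vB} → maximalIdeal R,
      (∀ o, (maximalIdeal R).toCotangent (tm o) = ε o) ∧ tm none = ⟨y₀, h1⟩ := by
    choose l hl using fun w : CotangentSpace R => Ideal.toCotangent_surjective (maximalIdeal R) w
    refine ⟨fun o => o.elim ⟨y₀, h1⟩ (fun w => l w), ?_, rfl⟩
    rintro (_ | w)
    · rfl
    · exact hl _
  have hspan : Submodule.span R (Set.range tm) = ⊤ := by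
    rw [← CotangentSpace.span_image_eq_top_iff, eq_top_iff, ← b.span_eq]
    refine Submodule.span_mono ?_
    rintro _ ⟨w, rfl⟩
    refine ⟨tm (ε.symm w), ⟨_, rfl⟩, ?_⟩
    rw [htm, Equiv.apply_symm_apply]
    exact (Module.Basis.extend_apply_self hs w).symm
  refine prime_of_span_eq hres (fun o => (tm o : R)) ?_ ?_ _ rfl y (by rw [htm0, hy₀])
  · have := congrArg (Submodule.map (Submodule.subtype (maximalIdeal R))) hspan
    rw [Submodule.map_span, Submodule.map_top, Submodule.range_subtype, ← Set.range_comp] at this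
    exact this
  · rw [← hcardB, Fintype.card_congr ε]

end RegularLocalRings

/-! ### Descent of principal ideals and of factorizations. -/

section FaithfullyFlatDescent

/-- Elements of I are multiples of ξ. If no cofactor were a unit, ξ would be ξ times a nonunit and
hence zero. So some element of I (possibly 0) generates the extended ideal, and by faithful flatness
it generates I. -/
theorem exists_eq_span_of_map_eq_span {R R' : Type*} [CommRing R] [CommRing R'] [Algebra R R']
    [Module.FaithfullyFlat R R'] [IsLocalRing R'] {I : Ideal R} {ξ : R'}
    (hI : I.map (algebraMap R R') = Ideal.span {ξ}) :
    ∃ h : R, I = Ideal.span {h} ∧ Ideal.span {algebraMap R R' h} = Ideal.span {ξ} := by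
  have hdvd : ∀ a ∈ I, ∃ c, algebraMap R R' a = ξ * c := fun a ha =>
    Ideal.mem_span_singleton.mp (hI ▸ Ideal.mem_map_of_mem _ ha)
  suffices ∃ h ∈ I, Ideal.span {algebraMap R R' h} = Ideal.span {ξ} by
    obtain ⟨h, hh, hspan⟩ := this
    refine ⟨h, ?_, hspan⟩
    rw [← Ideal.comap_map_eq_self_of_faithfullyFlat (B := R') I, hI, ← hspan,
      ← Set.image_singleton, ← Ideal.map_span, Ideal.comap_map_eq_self_of_faithfullyFlat]
  by_cases hu : ∃ h ∈ I, ∃ c, IsUnit c ∧ algebraMap R R' h = ξ * c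
  · obtain ⟨h, hh, c, hc, hhc⟩ := hu
    exact ⟨h, hh, by rw [hhc, Ideal.span_singleton_mul_right_unit hc]⟩
  · push Not at hu
    have hle : Ideal.span {ξ} ≤ Ideal.span {ξ} * maximalIdeal R' := by
      conv_lhs => rw [← hI]
      rw [Ideal.map_le_iff_le_comap]
      intro a ha
      obtain ⟨c, hc⟩ := hdvd a ha
      rw [Ideal.mem_comap, hc]
      refine Ideal.mul_mem_mul (Ideal.mem_span_singleton_self _) ?_
      by_contra hcm
      rw [mem_maximalIdeal, mem_nonunits_iff, not_not] at hcm
      exact hu a ha c hcm hc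
    obtain ⟨c, hc, hξ⟩ := Ideal.mem_span_singleton_mul.mp
      (hle (Ideal.mem_span_singleton_self ξ))
    have hξ0 : ξ = 0 := by
      have hu : IsUnit (1 - c) := by
        by_contra h
        have := add_mem ((mem_maximalIdeal _).mpr h) hc
        rw [sub_add_cancel] at this
        exact (mem_maximalIdeal _).mp this isUnit_one
      rw [← hu.mul_left_eq_zero, mul_sub, hξ, mul_one, sub_self]
    exact ⟨0, I.zero_mem, by rw [hξ0, map_zero]⟩

theorem dvd_of_algebraMap_dvd {R : Type*} (R' : Type*) [CommRing R] [CommRing R'] [Algebra R R']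
    [Module.FaithfullyFlat R R'] {a b : R} (h : algebraMap R R' a ∣ algebraMap R R' b) : a ∣ b := by
  rw [← Ideal.mem_span_singleton, ← Ideal.comap_map_eq_self_of_faithfullyFlat (B := R')
    (Ideal.span {a}), Ideal.mem_comap, Ideal.map_span, Set.image_singleton,
    Ideal.mem_span_singleton]
  exact h

theorem prod_dvd_of_forall_prime_dvd {R ι : Type*} [CommRing R] [IsDomain R] (s : Finset ι)
    (x : ι → R) (hx : ∀ i ∈ s, Prime (x i)) (hass : ∀ i ∈ s, ∀ j ∈ s, x i ∣ x j → i = j) (a : R)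
    (ha : ∀ i ∈ s, x i ∣ a) : ∏ i ∈ s, x i ∣ a := by
  classical
  induction s using Finset.induction_on with
  | empty => simp
  | insert i s hi ih =>
    obtain ⟨c, rfl⟩ := ih (fun j hj => hx j (Finset.mem_insert_of_mem hj))
      (fun j hj l hl => hass j (Finset.mem_insert_of_mem hj) l (Finset.mem_insert_of_mem hl))
      fun j hj => ha j (Finset.mem_insert_of_mem hj)
    have hp := hx i (Finset.mem_insert_self i s)
    rcases hp.dvd_or_dvd (ha i (Finset.mem_insert_self i s)) with h | ⟨d, rfl⟩
    · obtain ⟨j, hj, hij⟩ := (hp.dvd_finsetProd_iff _).mp h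
      exact absurd (hass i (Finset.mem_insert_self i s) j (Finset.mem_insert_of_mem hj) hij ▸ hj) hi
    · rw [Finset.prod_insert hi]
      exact ⟨d, by ring⟩

theorem map_radical_le_span_prod {R R' ι : Type*} [CommRing R] [CommRing R'] [Algebra R R']
    [IsDomain R'] (s : Finset ι) (x : ι → R')
    (hx : ∀ i ∈ s, Prime (x i)) (hass : ∀ i ∈ s, ∀ j ∈ s, x i ∣ x j → i = j) {I : Ideal R}
    (hI : ∀ i ∈ s, ∀ a ∈ I, x i ∣ algebraMap R R' a) :
    I.radical.map (algebraMap R R') ≤ Ideal.span {∏ i ∈ s, x i} := by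
  rw [Ideal.map_le_iff_le_comap]
  rintro a ⟨n, ha⟩
  rw [Ideal.mem_comap, Ideal.mem_span_singleton]
  refine prod_dvd_of_forall_prime_dvd s x hx hass _ fun i hi => ?_
  have := hI i hi _ ha
  rw [map_pow] at this
  exact (hx i hi).dvd_of_dvd_pow this

/-- Extension need not commute with radicals, but the reduced equation h, which contains all x i,
supplies the missing element. In R' the part ξ₀ of h prime to b is characterized by h dividing b *
ξ₀; flatness descends this divisibility, so h factors in R into parts associated to ξ₀ and ξ₁. -/
theorem map_radical_eq_span_prod {R R' ι : Type*} [CommRing R] [CommRing R'] [Algebra R R']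
    [Module.FaithfullyFlat R R'] [IsLocalRing R'] [IsDomain R'] [Fintype ι] [DecidableEq ι]
    (x : ι → R') (hx : ∀ i, Prime (x i)) (hass : ∀ i j, x i ∣ x j → i = j) (h b : R)
    (hh : Ideal.span {algebraMap R R' h} = Ideal.span {∏ i, x i}) (s : Finset ι)
    (hsb : ∀ i ∈ s, x i ∣ algebraMap R R' b)
    (hbs : ∃ N, algebraMap R R' b ∣ (∏ i ∈ s, x i) ^ N) :
    (Ideal.span {b}).radical.map (algebraMap R R') = Ideal.span {∏ i ∈ s, x i} := by
  rw [Ideal.span_singleton_eq_span_singleton] at hh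
  have hprod : (∏ i ∈ s, x i) * ∏ i ∈ sᶜ, x i = ∏ i, x i := Finset.prod_mul_prod_compl s x
  set ξ₁ := ∏ i ∈ s, x i with hξ₁
  set ξ₀ := ∏ i ∈ sᶜ, x i with hξ₀
  have hξ₀0 : ξ₀ ≠ 0 := Finset.prod_ne_zero_iff.mpr fun i _ => (hx i).ne_zero
  refine le_antisymm (map_radical_le_span_prod s x (fun i _ => hx i) (fun i _ j _ => hass i j) ?_) ?_
  · intro i hi a ha
    exact (hsb i hi).trans (map_dvd _ (Ideal.mem_span_singleton.mp ha))
  have hξ₁b : ξ₁ ∣ algebraMap R R' b :=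
    prod_dvd_of_forall_prime_dvd s x (fun i _ => hx i) (fun i _ j _ => hass i j) _ hsb
  have hndvd : ∀ i ∉ s, ¬ x i ∣ algebraMap R R' b := by
    intro i hi hdvd
    obtain ⟨N, hN⟩ := hbs
    obtain ⟨j, hj, hij⟩ := ((hx i).dvd_finsetProd_iff _).mp
      ((hx i).dvd_of_dvd_pow (hdvd.trans hN))
    exact hi (hass i j hij ▸ hj)
  obtain ⟨c, hc⟩ : algebraMap R R' h ∣ algebraMap R R' b * ξ₀ := by
    rw [hh.dvd_iff_dvd_left, ← hprod]
    exact mul_dvd_mul_right hξ₁b _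
  have hrel : ∑ i : Fin 2, (![b, -h] i) • (![ξ₀, c] i) = 0 := by
    simp [Fin.sum_univ_two, Algebra.smul_def, hc]
  -- The equational criterion: the relation b ξ₀ = h c over R' is a combination of relations b a₀ⱼ =
  -- h a₁ⱼ over R.
  obtain ⟨m, a, y, hy, ha⟩ := Module.Flat.isTrivialRelation_of_sum_smul_eq_zero
    (R := R) (M := R') (f := ![b, -h]) (x := ![ξ₀, c]) hrel
  have hy0 : ξ₀ = ∑ j, algebraMap R R' (a 0 j) * y j := by
    simpa [Algebra.smul_def] using hy 0
  -- A prime outside s divides h, hence b a₀ⱼ, but it does not divide b.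
  have hcol : ∀ j, ξ₀ ∣ algebraMap R R' (a 0 j) := by
    intro j
    refine prod_dvd_of_forall_prime_dvd _ x (fun i _ => hx i) (fun i _ j _ => hass i j) _ ?_
    intro i hi
    have h1 : b * a 0 j = h * a 1 j := by
      have := ha j
      rw [Fin.sum_univ_two] at this
      simp only [Matrix.cons_val_zero, Matrix.cons_val_one] at this
      linear_combination this
    have h2 : x i ∣ algebraMap R R' b * algebraMap R R' (a 0 j) := by
      rw [← map_mul, h1, map_mul]
      refine Dvd.dvd.mul_right ?_ _
      rw [hh.dvd_iff_dvd_right]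
      exact Finset.dvd_prod_of_mem x (Finset.mem_univ i)
    exact ((hx i).dvd_or_dvd h2).resolve_left (hndvd i (Finset.mem_compl.mp hi))
  choose d hd using hcol
  -- Cancelling ξ₀ in ξ₀ = ∑ ξ₀ dⱼ yⱼ leaves 1 = ∑ dⱼ yⱼ in a local ring.
  obtain ⟨j, hj⟩ : ∃ j, IsUnit (d j) := by
    by_contra! hno
    have h1 : ξ₀ * 1 = ξ₀ * ∑ j, d j * y j := by
      rw [Finset.mul_sum, mul_one]
      conv_lhs => rw [hy0]
      exact Finset.sum_congr rfl fun j _ => by rw [hd, mul_assoc]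
    have h2 : (1 : R') ∈ maximalIdeal R' := by
      rw [mul_left_cancel₀ hξ₀0 h1]
      exact Ideal.sum_mem _ fun j _ => Ideal.mul_mem_right _ _ ((mem_maximalIdeal _).mpr (hno j))
    exact (mem_maximalIdeal _).mp h2 isUnit_one
  have hη₀ : Associated (algebraMap R R' (a 0 j)) ξ₀ := by
    rw [hd]
    exact associated_mul_unit_left ξ₀ _ hj
  obtain ⟨η₁, hη₁⟩ : a 0 j ∣ h := by
    refine dvd_of_algebraMap_dvd R' ?_
    rw [hη₀.dvd_iff_dvd_left, hh.dvd_iff_dvd_right, ← hprod]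
    exact dvd_mul_left _ _
  have hη₁ξ : Associated (algebraMap R R' η₁) ξ₁ := by
    refine Associated.of_mul_left ?_ hη₀ (hη₀.ne_zero_iff.mpr hξ₀0)
    rw [← map_mul, ← hη₁, mul_comm ξ₀, hprod]
    exact hh
  -- The cofactor η₁ is associated to ξ₁, a power of which is divisible by b in R'; divisibility
  -- descends to R.
  have hmem : η₁ ∈ (Ideal.span {b}).radical := by
    obtain ⟨N, hN⟩ := hbs
    refine ⟨N, Ideal.mem_span_singleton.mpr (dvd_of_algebraMap_dvd R' ?_)⟩
    rw [map_pow, (hη₁ξ.pow_pow (n := N)).dvd_iff_dvd_right]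
    exact hN
  rw [Ideal.span_singleton_le_iff_mem]
  obtain ⟨u, hu⟩ := hη₁ξ
  rw [← hu]
  exact Ideal.mul_mem_right _ _ (Ideal.mem_map_of_mem _ hmem)

end FaithfullyFlatDescent

/-! ### Functoriality of completion. -/

section CompletionMap

variable {R S T : Type u} [CommRing R] [IsLocalRing R] [CommRing S] [IsLocalRing S]
  [CommRing T] [IsLocalRing T]

theorem evalₐ_completionMap (φ : R →+* S) [IsLocalHom φ] (n : ℕ)
    (x : AdicCompletion (maximalIdeal R) R) :
    AdicCompletion.evalₐ (maximalIdeal S) n (completionMap φ x) =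
      quotientPowMap φ n (AdicCompletion.evalₐ (maximalIdeal R) n x) :=
  AdicCompletion.evalₐ_liftRingHom (maximalIdeal S) (fun n => (quotientPowMap φ n).comp
      (AdicCompletion.evalₐ (maximalIdeal R) n :
        AdicCompletion (maximalIdeal R) R →+* R ⧸ maximalIdeal R ^ n))
    (factorPow_comp_quotientPowMap φ) n x

theorem evalₐ_algebraMap {A : Type*} [CommRing A] (I : Ideal A) (n : ℕ) (a : A) :
    AdicCompletion.evalₐ I n (algebraMap A (AdicCompletion I A) a) =
      Ideal.Quotient.mk (I ^ n) a :=
  AlgHom.commutes (AdicCompletion.evalₐ I n) a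

theorem completionMap_algebraMap (φ : R →+* S) [IsLocalHom φ] (r : R) :
    completionMap φ (algebraMap R _ r) = algebraMap S _ (φ r) := by
  refine AdicCompletion.ext_evalₐ fun n => ?_
  rw [evalₐ_completionMap, evalₐ_algebraMap, evalₐ_algebraMap]
  rfl

theorem completionMap_comp (φ : R →+* S) [IsLocalHom φ] (ψ : S →+* T) [IsLocalHom ψ]
    [IsLocalHom (ψ.comp φ)] (x : AdicCompletion (maximalIdeal R) R) :
    completionMap (ψ.comp φ) x = completionMap ψ (completionMap φ x) := by
  refine AdicCompletion.ext_evalₐ fun n => ?_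
  rw [evalₐ_completionMap, evalₐ_completionMap, evalₐ_completionMap]
  obtain ⟨r, hr⟩ := Ideal.Quotient.mk_surjective (AdicCompletion.evalₐ (maximalIdeal R) n x)
  rw [← hr]
  rfl

theorem completionMap_id [IsLocalHom (RingHom.id R)] (x : AdicCompletion (maximalIdeal R) R) :
    completionMap (RingHom.id R) x = x := by
  refine AdicCompletion.ext_evalₐ fun n => ?_
  rw [evalₐ_completionMap]
  obtain ⟨r, hr⟩ := Ideal.Quotient.mk_surjective (AdicCompletion.evalₐ (maximalIdeal R) n x)
  rw [← hr]
  rfl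

theorem completionMap_bijective (φ : R →+* S) [IsLocalHom φ] (hφ : Function.Bijective φ) :
    Function.Bijective (completionMap φ) := by
  let e := RingEquiv.ofBijective φ hφ
  let ψ : S →+* R := e.symm
  have : IsLocalHom ψ :=
    ⟨fun a ha => (isLocalHom_equiv e.symm).map_nonunit a ha⟩
  have h1 : ψ.comp φ = RingHom.id R := RingHom.ext fun r => e.symm_apply_apply r
  have h2 : φ.comp ψ = RingHom.id S := RingHom.ext fun r => e.apply_symm_apply r
  have key {A B : Type u} [CommRing A] [IsLocalRing A] [CommRing B] [IsLocalRing B] (f : A →+* B)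
      [IsLocalHom f] (g : B →+* A) [IsLocalHom g] (hgf : g.comp f = RingHom.id A) (x) :
      completionMap g (completionMap f x) = x := by
    have : IsLocalHom (g.comp f) := RingHom.isLocalHom_comp g f
    rw [← completionMap_comp]
    revert this
    rw [hgf]
    intro _
    exact completionMap_id x
  exact Function.bijective_iff_has_inverse.mpr ⟨completionMap ψ, key φ ψ h1, key ψ φ h2⟩

end CompletionMap

/-! ### Completed local rings and their scalars. -/

section CompletedStalkMap

theorem completedStalkMap_algebraMap {X Y : Scheme.{u}} (f : X ⟶ Y) (x : X)
    (a : Y.presheaf.stalk (f x)) :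
    completedStalkMap f x (algebraMap _ (CompletedStalk Y (f x)) a) =
      algebraMap _ (CompletedStalk X x) ((f.stalkMap x).hom a) :=
  completionMap_algebraMap _ a

theorem completedStalkMap_comp {X Y Z : Scheme.{u}} (f : X ⟶ Y) (g : Y ⟶ Z) (x : X)
    (a : CompletedStalk Z (g (f x))) :
    completedStalkMap (f ≫ g) x a = completedStalkMap f x (completedStalkMap g (f x) a) := by
  have h : ((f ≫ g).stalkMap x).hom = (f.stalkMap x).hom.comp (g.stalkMap (f x)).hom := by
    rw [Scheme.Hom.stalkMap_comp]
    rfl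
  have : IsLocalHom ((f.stalkMap x).hom.comp (g.stalkMap (f x)).hom) := RingHom.isLocalHom_comp _ _
  unfold completedStalkMap
  rw [← completionMap_comp]
  congr 1
  congr 1

/-- The isomorphism of completed local rings induced by an open immersion. -/
noncomputable def completedStalkEquiv {X Y : Scheme.{u}} (h : X ⟶ Y) [IsOpenImmersion h] (x : X) :
    CompletedStalk Y (h x) ≃+* CompletedStalk X x :=
  RingEquiv.ofBijective (completedStalkMap h x)
    (completionMap_bijective _ (ConcreteCategory.bijective_of_isIso (h.stalkMap x)))

theorem completedStalkEquiv_apply {X Y : Scheme.{u}} (h : X ⟶ Y) [IsOpenImmersion h] (x : X)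
    (a : CompletedStalk Y (h x)) : completedStalkEquiv h x a = completedStalkMap h x a :=
  rfl

variable {k : Type u} [Field k]

/-- The structure homomorphism `k → 𝒪_{X,x}` of a scheme `X` over `k`. -/
noncomputable def stalkScalars (X : Over (Spec (.of k))) (x : X.left) :
    k →+* X.left.presheaf.stalk x :=
  ((Scheme.ΓSpecIso (.of k)).inv ≫ X.hom.appTop ≫ X.left.presheaf.germ ⊤ x trivial).hom

theorem scalars_apply (X : Over (Spec (.of k))) (x : X.left) (c : k) :
    scalars X x c = algebraMap _ (CompletedStalk X.left x) (stalkScalars X x c) :=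
  rfl

theorem stalkMap_stalkScalars {X Y : Over (Spec (.of k))} (f : X ⟶ Y) (x : X.left) (c : k) :
    (f.left.stalkMap x).hom (stalkScalars Y (f.left x) c) = stalkScalars X x c := by
  have h : (Scheme.ΓSpecIso (.of k)).inv ≫ Y.hom.appTop ≫
      Y.left.presheaf.germ ⊤ (f.left x) trivial ≫ f.left.stalkMap x =
      (Scheme.ΓSpecIso (.of k)).inv ≫ X.hom.appTop ≫ X.left.presheaf.germ ⊤ x trivial := by
    have h1 := Scheme.Hom.germ_stalkMap f.left ⊤ x trivial
    rw [h1, ← Over.w f, Scheme.Hom.comp_appTop]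
    simp
  exact congr($h c)

theorem completedStalkMap_scalars {X Y : Over (Spec (.of k))} (f : X ⟶ Y) (x : X.left) (c : k) :
    completedStalkMap f.left x (scalars Y (f.left x) c) = scalars X x c := by
  rw [scalars_apply, completedStalkMap_algebraMap, stalkMap_stalkScalars, scalars_apply]

end CompletedStalkMap

/-! ### Ideals of closed subsets in local rings. -/

section StalkIdeals

theorem fromSpecStalk_comap_stalkMap {X Y : Scheme.{u}} (f : X ⟶ Y) (x : X)
    (p : PrimeSpectrum (X.presheaf.stalk x)) :
    Y.fromSpecStalk (f x) (PrimeSpectrum.comap (f.stalkMap x).hom p) = f (X.fromSpecStalk x p) := by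
  have h := Scheme.SpecMap_stalkMap_fromSpecStalk f (x := x)
  exact congr($h p)

theorem mem_stalkIdeal_preimage {X Y : Scheme.{u}} (f : X ⟶ Y) (x : X) (Z : Set Y)
    (a : X.presheaf.stalk x) : a ∈ stalkIdeal X (f ⁻¹' Z) x ↔
      ∀ p : PrimeSpectrum (X.presheaf.stalk x),
        Y.fromSpecStalk (f x) (PrimeSpectrum.comap (f.stalkMap x).hom p) ∈ Z → a ∈ p.asIdeal := by
  simp only [fromSpecStalk_comap_stalkMap]
  rw [stalkIdeal, PrimeSpectrum.mem_vanishingIdeal]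
  rfl

/-- Since Z is closed, its points in the spectrum of the local ring are exactly the primes
containing its ideal. The primes over the preimage are then those containing the extended ideal, and
their intersection is the radical. -/
theorem stalkIdeal_preimage {X Y : Scheme.{u}} (f : X ⟶ Y) (x : X) {Z : Set Y} (hZ : IsClosed Z) :
    stalkIdeal X (f ⁻¹' Z) x =
      ((stalkIdeal Y Z (f x)).map (f.stalkMap x).hom).radical := by
  have hcl : IsClosed {p : PrimeSpectrum (Y.presheaf.stalk (f x)) |
      Y.fromSpecStalk (f x) p ∈ Z} := hZ.preimage (Y.fromSpecStalk (f x)).continuous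
  ext a
  rw [mem_stalkIdeal_preimage, Ideal.radical_eq_sInf, Ideal.mem_sInf]
  constructor
  · rintro h J ⟨hJ, hprime⟩
    refine h ⟨J, hprime⟩ ?_
    change PrimeSpectrum.comap (f.stalkMap x).hom ⟨J, hprime⟩ ∈
      {p : PrimeSpectrum (Y.presheaf.stalk (f x)) | Y.fromSpecStalk (f x) p ∈ Z}
    rw [← hcl.closure_eq, ← PrimeSpectrum.zeroLocus_vanishingIdeal_eq_closure,
      PrimeSpectrum.mem_zeroLocus]
    exact Ideal.map_le_iff_le_comap.mp hJ
  · intro h p hp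
    refine h ⟨?_, p.2⟩
    rw [Ideal.map_le_iff_le_comap]
    intro b hb
    exact (PrimeSpectrum.mem_vanishingIdeal _ _).mp hb _ hp

theorem stalkIdeal_preimage_of_isOpenImmersion {X Y : Scheme.{u}} (f : X ⟶ Y) [IsOpenImmersion f]
    (x : X) (Z : Set Y) :
    stalkIdeal X (f ⁻¹' Z) x = (stalkIdeal Y Z (f x)).map (f.stalkMap x).hom := by
  have hbij : Function.Bijective (f.stalkMap x).hom :=
    ConcreteCategory.bijective_of_isIso (f.stalkMap x)
  let e := RingEquiv.ofBijective _ hbij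
  refine le_antisymm (fun a ha => ?_) ?_
  · obtain ⟨b, rfl⟩ := hbij.2 a
    refine Ideal.mem_map_of_mem _ ?_
    rw [stalkIdeal, PrimeSpectrum.mem_vanishingIdeal]
    intro q hq
    rw [mem_stalkIdeal_preimage] at ha
    have hq' : PrimeSpectrum.comap (f.stalkMap x).hom
        (PrimeSpectrum.comap (e.symm : _ →+* _) q) = q := by
      rw [← PrimeSpectrum.comap_comp_apply]
      have hid : (e.symm : _ →+* _).comp (f.stalkMap x).hom = RingHom.id _ :=
        RingHom.ext fun b => e.symm_apply_apply b
      rw [hid, PrimeSpectrum.comap_id]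
    have := ha (PrimeSpectrum.comap (e.symm : _ →+* _) q) (by rw [hq']; exact hq)
    rw [PrimeSpectrum.comap_asIdeal, Ideal.mem_comap] at this
    have hb : (e.symm : X.presheaf.stalk x →+* Y.presheaf.stalk (f x)) ((f.stalkMap x).hom b) = b :=
      e.symm_apply_apply b
    rwa [hb] at this
  · rw [Ideal.map_le_iff_le_comap]
    intro b hb
    rw [Ideal.mem_comap, mem_stalkIdeal_preimage]
    intro p hp
    exact (PrimeSpectrum.mem_vanishingIdeal _ _).mp hb _ hp

theorem completedIdeal_preimage_of_isOpenImmersion {X Y : Scheme.{u}} (f : X ⟶ Y)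
    [IsOpenImmersion f] (x : X) (Z : Set Y) :
    completedIdeal X (f ⁻¹' Z) x =
      (completedIdeal Y Z (f x)).map (completedStalkEquiv f x) := by
  rw [completedIdeal, completedIdeal, stalkIdeal_preimage_of_isOpenImmersion, Ideal.map_map,
    ← Ideal.map_coe (completedStalkEquiv f x), Ideal.map_map]
  exact congrArg (fun φ => Ideal.map φ _)
    (RingHom.ext fun a => (completedStalkMap_algebraMap f x a).symm)

theorem stalkIdeal_Spec_setOf_mem {A : Type u} [CommRing A] (a : A)
    (s : Spec (.of A)) :
    stalkIdeal (Spec (.of A)) {q : Spec (.of A) | a ∈ PrimeSpectrum.asIdeal q} s =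
      (Ideal.span {(StructureSheaf.toStalk A s).hom a}).radical := by
  rw [← PrimeSpectrum.vanishingIdeal_zeroLocus_eq_radical, stalkIdeal, PrimeSpectrum.zeroLocus_span]
  congr 1
  ext p
  have h : (Spec (.of A)).fromSpecStalk s p =
      PrimeSpectrum.comap (StructureSheaf.toStalk A s).hom p := by
    rw [Spec.fromSpecStalk_eq']
    rfl
  rw [Set.mem_ofPred_eq, h]
  change (StructureSheaf.toStalk A s).hom a ∈ p.asIdeal ↔
    {(StructureSheaf.toStalk A s).hom a} ⊆ (p.asIdeal : Set ((Spec (.of A)).presheaf.stalk s))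
  exact Set.singleton_subset_iff.symm

end StalkIdeals

/-! ### Restricting local models to open subsets. -/

section Transport

variable {k : Type u} [Field k]

/-- A local model can be restricted along an open immersion of toric varieties. -/
noncomputable def LocalModel.restrict {X : Over (Spec (.of k))} {U : X.left.Opens} {x : X.left}
    {n m : ℕ} {σ : RationalCone n} {σ' : RationalCone m}
    (h : σ'.toricVariety k ⟶ σ.toricVariety k) [IsOpenImmersion h.left]
    (s : (σ'.toricVariety k).left) (φ : LocalModel X U x σ (h.left s)) (U' : X.left.Opens)
    (W : Set (σ.toricVariety k).left) (hW : h.left ⁻¹' W = σ'.torus k)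
    (hU' : (completedIdeal X.left (U' : Set X.left)ᶜ x).map φ.iso =
      completedIdeal (σ.toricVariety k).left Wᶜ (h.left s)) :
    LocalModel X U' x σ' s where
  iso := φ.iso.trans (completedStalkEquiv h.left s)
  iso_scalars c := by
    rw [RingEquiv.trans_apply, φ.iso_scalars, completedStalkEquiv_apply, completedStalkMap_scalars]
  map_ideal := by
    rw [← hW, ← Set.preimage_compl, completedIdeal_preimage_of_isOpenImmersion, ← hU',
      ← Ideal.map_coe (completedStalkEquiv h.left s), ← Ideal.map_coe φ.iso, Ideal.map_map]
    rfl

end Transport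

/-! ### Closed points over an algebraically closed field. -/

section RationalPoints

variable {k : Type u} [Field k]

theorem fromSpecStalk_comp_hom (X : Over (Spec (.of k))) (x : X.left) :
    X.left.fromSpecStalk x ≫ X.hom =
      Spec.map (CommRingCat.ofHom (stalkScalars X x)) := by
  have h1 : X.hom = X.left.toSpecΓ ≫ Spec.map X.hom.appTop ≫
      Spec.map (Scheme.ΓSpecIso (.of k)).inv := by
    rw [← Scheme.toSpecΓ_naturality_assoc, toSpecΓ_SpecMap_ΓSpecIso_inv, Category.comp_id]
  rw [h1, Scheme.fromSpecStalk_toSpecΓ_assoc, ← Spec.map_comp, ← Spec.map_comp]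
  rfl

/-- Over an algebraically closed field, the local ring of a variety at a closed point has
coefficient field `k`. -/
theorem exists_sub_stalkScalars_mem_maximalIdeal [IsAlgClosed k] (X : Over (Spec (.of k)))
    [LocallyOfFiniteType X.hom] (x : X.left) (hx : IsClosed {x})
    (a : X.left.presheaf.stalk x) :
    ∃ c : k, a - stalkScalars X x c ∈ maximalIdeal (X.left.presheaf.stalk x) := by
  -- The Nullstellensatz isomorphism between k and the residue field is the map on scalars followed
  -- by reduction.
  have h1 : (residueFieldIsoBase X.hom x hx).inv =
      CommRingCat.ofHom (stalkScalars X x) ≫ X.left.residue x := by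
    apply Spec.map_injective
    rw [SpecMap_residueFieldIsoBase_inv, Spec.map_comp, ← fromSpecStalk_comp_hom]
    rfl
  obtain ⟨c, hc⟩ := (ConcreteCategory.bijective_of_isIso (residueFieldIsoBase X.hom x hx).inv).2
    (X.left.residue x a)
  refine ⟨c, ?_⟩
  rw [h1] at hc
  exact (Ideal.Quotient.mk_eq_mk_iff_sub_mem _ _).mp hc.symm

end RationalPoints

/-! ### Localizing monoid algebras at a character. -/

section MonoidAlgebras

/-- The hypotheses say that S' arises from S by inverting f: g is the inverse of f, and every
element of S' enters S after adding a multiple of f. -/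
theorem isLocalization_mapDomainRingHom {k S S' : Type*} [Field k] [AddCommMonoid S]
    [AddCommMonoid S'] (i : S →+ S') (hi : Function.Injective i) (f : S) (g : S')
    (hg : g + i f = 0) (hsurj : ∀ m : S', ∃ (N : ℕ) (s : S), m + N • i f = i s) :
    let := (AddMonoidAlgebra.mapDomainRingHom k i).toAlgebra
    IsLocalization.Away (AddMonoidAlgebra.single f (1 : k)) (AddMonoidAlgebra k S') := by
  let := (AddMonoidAlgebra.mapDomainRingHom k i).toAlgebra
  have hmap : ∀ (s : S) (c : k), algebraMap (AddMonoidAlgebra k S) (AddMonoidAlgebra k S')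
      (AddMonoidAlgebra.single s c) = AddMonoidAlgebra.single (i s) c := fun s c =>
    AddMonoidAlgebra.mapDomain_single
  have hpow : ∀ N : ℕ, algebraMap (AddMonoidAlgebra k S) (AddMonoidAlgebra k S')
      (AddMonoidAlgebra.single f (1 : k) ^ N) = AddMonoidAlgebra.single (N • i f) 1 := by
    intro N
    rw [map_pow, hmap, AddMonoidAlgebra.single_pow, one_pow]
  rw [IsLocalization.Away, isLocalization_iff]
  refine ⟨?_, ?_, ?_⟩
  · rintro ⟨_, N, rfl⟩
    rw [map_pow, hmap]
    refine IsUnit.pow N (IsUnit.of_mul_eq_one (AddMonoidAlgebra.single g 1) ?_)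
    rw [AddMonoidAlgebra.single_mul_single, add_comm, hg, mul_one]
    rfl
  · intro z
    suffices ∃ (N : ℕ) (w : AddMonoidAlgebra k S),
        z * algebraMap _ _ (AddMonoidAlgebra.single f (1 : k) ^ N) = algebraMap _ _ w by
      obtain ⟨N, w, h⟩ := this
      exact ⟨⟨w, ⟨_, N, rfl⟩⟩, h⟩
    induction z using AddMonoidAlgebra.induction_linear with
    | zero => exact ⟨0, 0, by simp⟩
    | add a b ha hb =>
      obtain ⟨N, v, hv⟩ := ha
      obtain ⟨N', w, hw⟩ := hb
      refine ⟨N + N', v * AddMonoidAlgebra.single f (1 : k) ^ N' +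
        w * AddMonoidAlgebra.single f (1 : k) ^ N, ?_⟩
      rw [map_add, map_mul _ v, map_mul _ w, ← hv, ← hw, pow_add, map_mul]
      ring
    | single m c =>
      obtain ⟨N, s, hs⟩ := hsurj m
      refine ⟨N, AddMonoidAlgebra.single s c, ?_⟩
      rw [hpow, hmap, AddMonoidAlgebra.single_mul_single, hs, mul_one]
  · intro a b hab
    exact ⟨1, by rw [AddMonoidAlgebra.mapDomain_injective hi hab]⟩

theorem isOpenImmersion_mapDomainRingHom {k : Type u} {S S' : Type} [Field k]
    [AddCommMonoid S] [AddCommMonoid S'] (i : S →+ S') (hi : Function.Injective i) (f : S) (g : S')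
    (hg : g + i f = 0) (hsurj : ∀ m : S', ∃ (N : ℕ) (s : S), m + N • i f = i s) :
    IsOpenImmersion (Spec.map (CommRingCat.ofHom (AddMonoidAlgebra.mapDomainRingHom k i))) ∧
    Set.range (Spec.map (CommRingCat.ofHom (AddMonoidAlgebra.mapDomainRingHom k i))) =
      {q : Spec (.of (AddMonoidAlgebra k S)) |
        AddMonoidAlgebra.single f (1 : k) ∉ PrimeSpectrum.asIdeal q} := by
  let := (AddMonoidAlgebra.mapDomainRingHom k i).toAlgebra
  have := isLocalization_mapDomainRingHom (k := k) i hi f g hg hsurj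
  refine ⟨IsOpenImmersion.of_isLocalization (AddMonoidAlgebra.single f (1 : k)), ?_⟩
  exact PrimeSpectrum.localization_away_comap_range (AddMonoidAlgebra k S')
    (AddMonoidAlgebra.single f (1 : k))

end MonoidAlgebras

/-! ### Morphisms of affine toric varieties. -/

section ToricMorphisms

variable {k : Type u} [Field k]

/-- The coordinate ring embeds in the ring of Laurent polynomials. -/
instance {n : ℕ} (σ : RationalCone n) : IsDomain (σ.ring k) := by
  have : IsDomain (AddMonoidAlgebra k (Fin n → ℤ)) := NoZeroDivisors.to_isDomain _
  exact Function.Injective.isDomain (AddMonoidAlgebra.mapDomainRingHom k σ.dualMonoid.subtype)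
    (AddMonoidAlgebra.mapDomain_injective Subtype.val_injective)

/-- The morphism of affine toric varieties defined by a homomorphism of their coordinate rings. -/
noncomputable def toricHom {n m : ℕ} {σ : RationalCone n} {τ : RationalCone m}
    (θ : τ.ring k →ₐ[k] σ.ring k) : σ.toricVariety k ⟶ τ.toricVariety k :=
  Over.homMk (Spec.map (CommRingCat.ofHom (θ : τ.ring k →+* σ.ring k))) (by
    change Spec.map _ ≫ Spec.map _ = Spec.map _
    rw [← Spec.map_comp, ← CommRingCat.ofHom_comp]
    congr 2
    ext c
    simp)

end ToricMorphisms

/-! ### Rational cones and interior points of the dual. -/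

section Cones

variable {n : ℕ}

/-- The image of an integral vector in `ℝ ^ n`. -/
abbrev castVec (v : Fin n → ℤ) : Fin n → ℝ := fun i => (v i : ℝ)

theorem castVec_dotProduct (m v : Fin n → ℤ) : castVec m ⬝ᵥ castVec v = ((m ⬝ᵥ v : ℤ) : ℝ) := by
  simp [dotProduct]

/-- The integral vectors `V` generate the cone `σ`. -/
def RationalCone.IsGeneratedBy (σ : RationalCone n) (V : Finset (Fin n → ℤ)) : Prop :=
  σ.cone = Submodule.span {c : ℝ // 0 ≤ c} ((fun v i => (v i : ℝ)) '' (V : Set (Fin n → ℤ)))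

theorem RationalCone.IsGeneratedBy.castVec_mem {σ : RationalCone n} {V : Finset (Fin n → ℤ)}
    (hV : σ.IsGeneratedBy V) {v : Fin n → ℤ} (hv : v ∈ V) : castVec v ∈ σ.cone := by
  rw [hV]
  exact Submodule.subset_span ⟨v, hv, rfl⟩

theorem RationalCone.IsGeneratedBy.mem_dualMonoid_iff {σ : RationalCone n}
    {V : Finset (Fin n → ℤ)} (hV : σ.IsGeneratedBy V) {m : Fin n → ℤ} :
    m ∈ σ.dualMonoid ↔ ∀ v ∈ V, 0 ≤ m ⬝ᵥ v := by
  constructor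
  · intro h v hv
    have := h _ (hV.castVec_mem hv)
    rw [castVec_dotProduct] at this
    exact_mod_cast this
  · intro h u hu
    rw [hV] at hu
    induction hu using Submodule.span_induction with
    | mem u hu =>
      obtain ⟨v, hv, rfl⟩ := hu
      change 0 ≤ castVec m ⬝ᵥ castVec v
      rw [castVec_dotProduct]
      exact_mod_cast h v hv
    | zero => simp
    | add a b _ _ ha hb =>
      rw [dotProduct_add]
      exact add_nonneg ha hb
    | smul c a _ ha =>
      have : c • a = (c : ℝ) • a := rfl
      rw [this, dotProduct_smul]
      exact smul_nonneg c.2 ha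

/-- The cone generated by integral vectors in a strictly convex cone. -/
def RationalCone.generate (σ : RationalCone n) (V : Finset (Fin n → ℤ))
    (hV : ∀ v ∈ V, castVec v ∈ σ.cone) : RationalCone n where
  cone := Submodule.span {c : ℝ // 0 ≤ c} ((fun v i => (v i : ℝ)) '' (V : Set (Fin n → ℤ)))
  rational := ⟨V, rfl⟩
  strictlyConvex := by
    have hle : Submodule.span {c : ℝ // 0 ≤ c}
        ((fun v i => (v i : ℝ)) '' (V : Set (Fin n → ℤ))) ≤ σ.cone := by
      rw [Submodule.span_le]
      rintro _ ⟨v, hv, rfl⟩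
      exact hV v hv
    exact fun u hu hu' => σ.strictlyConvex u (hle hu) (hle hu')

theorem RationalCone.generate_isGeneratedBy (σ : RationalCone n) (V : Finset (Fin n → ℤ))
    (hV : ∀ v ∈ V, castVec v ∈ σ.cone) : (σ.generate V hV).IsGeneratedBy V :=
  rfl

theorem RationalCone.generate_le (σ : RationalCone n) (V : Finset (Fin n → ℤ))
    (hV : ∀ v ∈ V, castVec v ∈ σ.cone) : (σ.generate V hV).cone ≤ σ.cone :=
  Submodule.span_le.mpr (by
    rintro _ ⟨v, hv, rfl⟩
    exact hV v hv)

theorem exists_floor_dotProduct_pos (V : Finset (Fin n → ℤ)) (w : Fin n → ℝ)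
    (hw : ∀ v ∈ V, 0 < w ⬝ᵥ castVec v) : ∃ m : Fin n → ℤ, ∀ v ∈ V, 0 < m ⬝ᵥ v := by
  -- Rounding N w down changes its pairing with v by at most the sum of the |v i|, so any large N
  -- works.
  have hev : ∀ᶠ N : ℕ in Filter.atTop, ∀ v ∈ V, ∑ i, |(v i : ℝ)| < N * (w ⬝ᵥ castVec v) := by
    rw [Filter.eventually_all_finset]
    intro v hv
    obtain ⟨N₀, hN₀⟩ := exists_nat_gt ((∑ i, |(v i : ℝ)|) / (w ⬝ᵥ castVec v))
    filter_upwards [Filter.eventually_ge_atTop N₀] with N hN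
    rw [← div_lt_iff₀ (hw v hv)]
    exact hN₀.trans_le (by exact_mod_cast hN)
  obtain ⟨N, hN⟩ := hev.exists
  refine ⟨fun i => ⌊N * w i⌋, fun v hv => ?_⟩
  have h1 : (N : ℝ) * (w ⬝ᵥ castVec v) - ∑ i, |(v i : ℝ)| ≤
      ((fun i => ⌊N * w i⌋) ⬝ᵥ v : ℤ) := by
    rw [← castVec_dotProduct]
    simp only [dotProduct, Finset.mul_sum]
    rw [← Finset.sum_sub_distrib]
    refine Finset.sum_le_sum fun i _ => ?_
    have h2 : |Int.fract ((N : ℝ) * w i) * v i| ≤ |(v i : ℝ)| := by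
      rw [abs_mul, abs_of_nonneg (Int.fract_nonneg _)]
      exact mul_le_of_le_one_left (abs_nonneg _) (Int.fract_lt_one _).le
    have h3 : (⌊(N : ℝ) * w i⌋ : ℝ) = N * w i - Int.fract (N * w i) := by
      rw [← Int.self_sub_floor]
      ring
    rw [castVec, castVec, h3, sub_mul]
    have := le_abs_self (Int.fract ((N : ℝ) * w i) * v i)
    nlinarith
  have h2 := hN v hv
  have h3 : (0 : ℝ) < ((fun i => ⌊N * w i⌋) ⬝ᵥ v : ℤ) := by linarith
  exact_mod_cast h3

/-- The dual of a strictly convex cone contains a lattice point which is positive on all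
generators. -/
theorem RationalCone.IsGeneratedBy.exists_dotProduct_pos {σ : RationalCone n}
    {V : Finset (Fin n → ℤ)} (hV : σ.IsGeneratedBy V) :
    ∃ m : Fin n → ℤ, ∀ v ∈ V, v ≠ 0 → 0 < m ⬝ᵥ v := by
  classical
  let V' := V.filter (· ≠ 0)
  suffices ∃ w : Fin n → ℝ, ∀ v ∈ V', 0 < w ⬝ᵥ castVec v by
    obtain ⟨w, hw⟩ := this
    obtain ⟨m, hm⟩ := exists_floor_dotProduct_pos V' w hw
    exact ⟨m, fun v hv hv0 => hm v (Finset.mem_filter.mpr ⟨hv, hv0⟩)⟩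
  let K : Finset (Fin n → ℝ) := V'.image castVec
  -- Strict convexity keeps 0 out of the hull of the nonzero generators; Hahn–Banach then provides a
  -- real functional positive on them, which is rounded to a lattice point.
  have hK : (0 : Fin n → ℝ) ∉ convexHull ℝ (K : Set (Fin n → ℝ)) := by
    intro h0
    obtain ⟨c, hc0, hc1, hc⟩ := Finset.mem_convexHull'.mp h0
    have hmem : ∀ y ∈ K, y ∈ σ.cone ∧ y ≠ 0 := by
      intro y hy
      obtain ⟨v, hv, rfl⟩ := Finset.mem_image.mp hy
      obtain ⟨hv, hv0⟩ := Finset.mem_filter.mp hv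
      refine ⟨hV.castVec_mem hv, fun h => hv0 ?_⟩
      ext i
      have := congrFun h i
      simpa using this
    obtain ⟨y, hy, hcy⟩ : ∃ y ∈ K, 0 < c y := by
      by_contra! h
      have : ∑ y ∈ K, c y ≤ 0 := Finset.sum_nonpos h
      linarith
    have hsmul : ∀ z ∈ K, c z • z ∈ σ.cone := fun z hz =>
      σ.cone.smul_mem (hc0 z hz) (hmem z hz).1
    have hneg : -(c y • y) ∈ σ.cone := by
      rw [← Finset.add_sum_erase _ _ hy] at hc
      rw [neg_eq_of_add_eq_zero_right hc]
      exact Submodule.sum_mem _ fun z hz => hsmul z (Finset.mem_of_mem_erase hz)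
    have := σ.strictlyConvex _ (hsmul y hy) hneg
    rcases smul_eq_zero.mp this with h | h
    · exact hcy.ne' h
    · exact (hmem y hy).2 h
  obtain ⟨f, a, hf0, hf⟩ := geometric_hahn_banach_point_closed (convex_convexHull ℝ _)
    (K.finite_toSet.isClosed_convexHull ℝ) hK
  rw [map_zero] at hf0
  refine ⟨fun i => f (fun j => if i = j then 1 else 0), fun v hv => hf0.trans ?_⟩
  refine (hf (castVec v) (subset_convexHull ℝ _ (by
    exact_mod_cast Finset.mem_image_of_mem castVec hv))).trans_eq ?_
  have h := LinearMap.pi_apply_eq_sum_univ (f : (Fin n → ℝ) →ₗ[ℝ] ℝ) (castVec v)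
  refine h.trans (Finset.sum_congr rfl fun i _ => ?_)
  rw [smul_eq_mul, mul_comm]
  rfl

end Cones

/-! ### The torus as a principal open subset. -/

section Torus

variable {k : Type u} [Field k] {n : ℕ}

/-- Where m₀ is positive it is at least 1 by integrality, so adding it ∑ |m·v| times outweighs every
negative value of m. This is the surjectivity condition for inverting χ^{m₀}. -/
theorem RationalCone.IsGeneratedBy.exists_add_nsmul_mem {σ : RationalCone n}
    {V : Finset (Fin n → ℤ)} (hV : σ.IsGeneratedBy V) {m₀ : Fin n → ℤ}
    (hm₀ : ∀ v ∈ V, 0 ≤ m₀ ⬝ᵥ v) (m : Fin n → ℤ)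
    (hm : ∀ v ∈ V, m₀ ⬝ᵥ v = 0 → 0 ≤ m ⬝ᵥ v) :
    ∃ N : ℕ, m + N • m₀ ∈ σ.dualMonoid := by
  refine ⟨∑ v ∈ V, (m ⬝ᵥ v).natAbs, hV.mem_dualMonoid_iff.mpr fun v hv => ?_⟩
  rw [add_dotProduct, smul_dotProduct]
  rcases (hm₀ v hv).eq_or_lt with h | h
  · rw [← h, smul_zero, add_zero]
    exact hm v hv h.symm
  · have h1 : (m ⬝ᵥ v).natAbs ≤ ∑ v ∈ V, (m ⬝ᵥ v).natAbs :=
      Finset.single_le_sum (f := fun v => (m ⬝ᵥ v).natAbs) (fun _ _ => Nat.zero_le _) hv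
    have h2 : ((∑ v ∈ V, (m ⬝ᵥ v).natAbs : ℕ) : ℤ) ≤
        (∑ v ∈ V, (m ⬝ᵥ v).natAbs : ℕ) • (m₀ ⬝ᵥ v) := by
      rw [nsmul_eq_mul]
      exact le_mul_of_one_le_right (by positivity) h
    have h3 : -(m ⬝ᵥ v) ≤ (m ⬝ᵥ v).natAbs := by omega
    have h4 : ((m ⬝ᵥ v).natAbs : ℤ) ≤ (∑ v ∈ V, (m ⬝ᵥ v).natAbs : ℕ) := by exact_mod_cast h1
    linarith

/-- The torus is the locus where a character in the interior of the dual cone does not vanish. -/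
theorem RationalCone.IsGeneratedBy.torus_eq {σ : RationalCone n} {V : Finset (Fin n → ℤ)}
    (hV : σ.IsGeneratedBy V) (m₀ : σ.dualMonoid)
    (hm₀ : ∀ v ∈ V, v ≠ 0 → 0 < (m₀ : Fin n → ℤ) ⬝ᵥ v) :
    σ.torus k = {q : Spec (.of (σ.ring k)) |
      AddMonoidAlgebra.single m₀ (1 : k) ∉ PrimeSpectrum.asIdeal q} := by
  refine (isOpenImmersion_mapDomainRingHom (k := k) σ.dualMonoid.subtype Subtype.val_injective m₀
    (-(m₀ : Fin n → ℤ)) (neg_add_cancel _) fun m => ?_).2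
  obtain ⟨N, hN⟩ := hV.exists_add_nsmul_mem (hV.mem_dualMonoid_iff.mp m₀.2) m fun v hv h => by
    by_cases hv0 : v = 0
    · simp [hv0]
    · exact absurd h (hm₀ v hv hv0).ne'
  exact ⟨N, ⟨_, hN⟩, rfl⟩

end Torus

/-! ### Composition of toric morphisms. -/

section ConeHoms

variable {k : Type u} [Field k] {n m l : ℕ} {σ : RationalCone n} {τ : RationalCone m}
  {ρ : RationalCone l}

theorem ConeHom.dualMap_coe (g : ConeHom σ τ) (a : τ.dualMonoid) :
    (g.dualMap a : Fin n → ℤ) = g.matrix.transpose.mulVec a :=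
  rfl

/-- The composition of linear maps of lattices with cones. -/
def ConeHom.comp (g : ConeHom τ ρ) (h : ConeHom σ τ) : ConeHom σ ρ where
  matrix := g.matrix * h.matrix
  map_mem u hu := by
    change ((g.matrix * h.matrix).map (Int.castRingHom ℝ)).mulVec u ∈ _
    rw [Matrix.map_mul, ← Matrix.mulVec_mulVec]
    exact g.map_mem _ (h.map_mem u hu)

/-- The inclusion of a subcone. -/
def ConeHom.ofLE {σ τ : RationalCone n} (h : σ.cone ≤ τ.cone) : ConeHom σ τ where
  matrix := 1
  map_mem u hu := by
    rw [Matrix.map_one _ Int.cast_zero Int.cast_one, Matrix.one_mulVec]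
    exact h hu

theorem ConeHom.ofLE_dualMap_coe {σ τ : RationalCone n} (h : σ.cone ≤ τ.cone) (a : τ.dualMonoid) :
    ((ConeHom.ofLE h).dualMap a : Fin n → ℤ) = a := by
  rw [ConeHom.dualMap_coe]
  simp [ConeHom.ofLE]

theorem ConeHom.toricMap_comp (g : ConeHom τ ρ) (h : ConeHom σ τ) :
    h.toricMap k ≫ g.toricMap k = (g.comp h).toricMap k := by
  ext1
  change Spec.map _ ≫ Spec.map _ = Spec.map _
  rw [← Spec.map_comp, ← CommRingCat.ofHom_comp, ← AddMonoidAlgebra.mapDomainRingHom_comp]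
  congr 3
  ext1 a
  refine Subtype.ext ?_
  change (h.dualMap (g.dualMap a)).1 = ((g.comp h).dualMap a).1
  rw [ConeHom.dualMap_coe, ConeHom.dualMap_coe, ConeHom.dualMap_coe, Matrix.mulVec_mulVec,
    ← Matrix.transpose_mul]
  rfl

theorem ConeHom.single_mem_toricMap (g : ConeHom σ τ) (s : (σ.toricVariety k).left)
    (a : τ.dualMonoid) :
    AddMonoidAlgebra.single a (1 : k) ∈ PrimeSpectrum.asIdeal ((g.toricMap k).left s) ↔
      AddMonoidAlgebra.single (g.dualMap a) (1 : k) ∈ PrimeSpectrum.asIdeal s := by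
  change AddMonoidAlgebra.mapDomainRingHom k g.dualMap _ ∈ PrimeSpectrum.asIdeal s ↔ _
  rw [AddMonoidAlgebra.mapDomainRingHom_apply, AddMonoidAlgebra.mapDomain_single]

end ConeHoms

/-! ### The face adapted to a point. -/

section Faces

variable {k : Type u} [Field k] {n : ℕ}

theorem single_add_mem_iff {S : Type*} [AddCommMonoid S] (P : Ideal (AddMonoidAlgebra k S))
    [P.IsPrime] (a b : S) : AddMonoidAlgebra.single (a + b) (1 : k) ∈ P ↔
      AddMonoidAlgebra.single a (1 : k) ∈ P ∨ AddMonoidAlgebra.single b (1 : k) ∈ P := by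
  rw [← Ideal.IsPrime.mul_mem_iff_mem_or_mem ‹P.IsPrime›, AddMonoidAlgebra.single_mul_single,
    one_mul]

theorem single_zero_notMem {S : Type*} [AddCommMonoid S] (P : Ideal (AddMonoidAlgebra k S))
    [P.IsPrime] : AddMonoidAlgebra.single (0 : S) (1 : k) ∉ P :=
  (Ideal.ne_top_iff_one P).mp Ideal.IsPrime.ne_top'

theorem single_nsmul_notMem {S : Type*} [AddCommMonoid S] (P : Ideal (AddMonoidAlgebra k S))
    [P.IsPrime] {a : S} (ha : AddMonoidAlgebra.single a (1 : k) ∉ P) (N : ℕ) :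
    AddMonoidAlgebra.single (N • a) (1 : k) ∉ P := by
  induction N with
  | zero => simpa using single_zero_notMem P
  | succ N ih =>
    rw [succ_nsmul, single_add_mem_iff]
    tauto

theorem single_sum_notMem {S ι : Type*} [AddCommMonoid S] (P : Ideal (AddMonoidAlgebra k S))
    [P.IsPrime] (s : Finset ι) (f : ι → S)
    (hf : ∀ i ∈ s, AddMonoidAlgebra.single (f i) (1 : k) ∉ P) :
    AddMonoidAlgebra.single (∑ i ∈ s, f i) (1 : k) ∉ P := by
  classical
  induction s using Finset.induction_on with
  | empty => simpa using single_zero_notMem P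
  | insert i s hi ih =>
    rw [Finset.sum_insert hi, single_add_mem_iff]
    have h1 := hf i (Finset.mem_insert_self i s)
    have h2 := ih fun j hj => hf j (Finset.mem_insert_of_mem hj)
    tauto

theorem RationalCone.exists_isGeneratedBy (σ : RationalCone n) :
    ∃ V : Finset (Fin n → ℤ), σ.IsGeneratedBy V :=
  σ.rational

/-- Every point of an affine toric variety lies in the affine toric variety of a face on which all
characters which do not vanish at the point are invertible. -/
theorem RationalCone.exists_face (σ : RationalCone n) (s : (σ.toricVariety k).left) :
    ∃ (γ : RationalCone n) (h : γ.cone ≤ σ.cone) (s' : (γ.toricVariety k).left),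
      IsOpenImmersion ((ConeHom.ofLE h).toricMap k).left ∧
      ((ConeHom.ofLE h).toricMap k).left s' = s ∧
      ((ConeHom.ofLE h).toricMap k).left ⁻¹' σ.torus k = γ.torus k ∧
      ∀ a : γ.dualMonoid, AddMonoidAlgebra.single a (1 : k) ∉ PrimeSpectrum.asIdeal s' →
        -(a : Fin n → ℤ) ∈ γ.dualMonoid := by
  classical
  obtain ⟨V, hV⟩ := σ.exists_isGeneratedBy
  have hsprime : (PrimeSpectrum.asIdeal s).IsPrime := PrimeSpectrum.isPrime s
  -- For each v, f v is a character not vanishing at s that is positive on v whenever some such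
  -- character is. The sum f₀ over the generators has the largest possible set of positive values,
  -- and the face is cut out by f₀ = 0.
  have hex (v : Fin n → ℤ) : ∃ f : σ.dualMonoid,
      AddMonoidAlgebra.single f (1 : k) ∉ PrimeSpectrum.asIdeal s ∧
      ∀ a : σ.dualMonoid, AddMonoidAlgebra.single a (1 : k) ∉ PrimeSpectrum.asIdeal s →
        0 < (a : Fin n → ℤ) ⬝ᵥ v → 0 < (f : Fin n → ℤ) ⬝ᵥ v := by
    by_cases h : ∃ a : σ.dualMonoid,
      AddMonoidAlgebra.single a (1 : k) ∉ PrimeSpectrum.asIdeal s ∧ 0 < (a : Fin n → ℤ) ⬝ᵥ v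
    · obtain ⟨a, ha, hav⟩ := h
      exact ⟨a, ha, fun _ _ _ => hav⟩
    · exact ⟨0, single_zero_notMem _, fun a ha hav => absurd ⟨a, ha, hav⟩ h⟩
  choose f hfs hfpos using hex
  let f₀ : σ.dualMonoid := ∑ v ∈ V, f v
  have hf₀s : AddMonoidAlgebra.single f₀ (1 : k) ∉ PrimeSpectrum.asIdeal s :=
    single_sum_notMem _ _ _ fun v _ => hfs v
  have hnonneg (a : σ.dualMonoid) : ∀ v ∈ V, 0 ≤ (a : Fin n → ℤ) ⬝ᵥ v :=
    hV.mem_dualMonoid_iff.mp a.2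
  let J := V.filter fun v => (f₀ : Fin n → ℤ) ⬝ᵥ v = 0
  have hJ (v) (hv : v ∈ J) : v ∈ V ∧ (f₀ : Fin n → ℤ) ⬝ᵥ v = 0 := Finset.mem_filter.mp hv
  have hperp : ∀ a : σ.dualMonoid, AddMonoidAlgebra.single a (1 : k) ∉ PrimeSpectrum.asIdeal s →
      ∀ v ∈ J, (a : Fin n → ℤ) ⬝ᵥ v = 0 := by
    intro a ha v hv
    obtain ⟨hvV, hv0⟩ := hJ v hv
    refine le_antisymm (not_lt.mp fun hpos => ?_) (hnonneg a v hvV)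
    have h1 := hfpos v a ha hpos
    have h2 : (f₀ : Fin n → ℤ) ⬝ᵥ v = ∑ w ∈ V, (f w : Fin n → ℤ) ⬝ᵥ v := by
      rw [← sum_dotProduct]
      simp [f₀]
    have h3 : (f v : Fin n → ℤ) ⬝ᵥ v ≤ ∑ w ∈ V, (f w : Fin n → ℤ) ⬝ᵥ v :=
      Finset.single_le_sum (f := fun w => (f w : Fin n → ℤ) ⬝ᵥ v)
        (fun w _ => hnonneg (f w) v hvV) hvV
    omega
  let γ := σ.generate J fun v hv => hV.castVec_mem (hJ v hv).1
  have hγ : γ.IsGeneratedBy J := σ.generate_isGeneratedBy J _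
  have hle : γ.cone ≤ σ.cone := σ.generate_le J _
  have hneg : -(f₀ : Fin n → ℤ) ∈ γ.dualMonoid := hγ.mem_dualMonoid_iff.mpr fun v hv => by
    rw [neg_dotProduct, (hJ v hv).2, neg_zero]
  -- The lattice points of the dual of the face are those of σ with f₀ inverted.
  have hlift (a : γ.dualMonoid) : ∃ (N : ℕ) (b : σ.dualMonoid),
      a + N • (ConeHom.ofLE hle).dualMap f₀ = (ConeHom.ofLE hle).dualMap b := by
    obtain ⟨N, hN⟩ := hV.exists_add_nsmul_mem (hnonneg f₀) a fun v hv h =>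
      hγ.mem_dualMonoid_iff.mp a.2 v (Finset.mem_filter.mpr ⟨hv, h⟩)
    refine ⟨N, ⟨_, hN⟩, Subtype.ext ?_⟩
    rw [ConeHom.ofLE_dualMap_coe, AddSubmonoid.coe_add, AddSubmonoidClass.coe_nsmul,
      ConeHom.ofLE_dualMap_coe]
  have hinj : Function.Injective (ConeHom.ofLE hle).dualMap := fun a b hab => Subtype.ext (by
    rw [← ConeHom.ofLE_dualMap_coe hle a, hab, ConeHom.ofLE_dualMap_coe])
  obtain ⟨hopen, hrange⟩ := isOpenImmersion_mapDomainRingHom (k := k) (ConeHom.ofLE hle).dualMap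
    hinj f₀ ⟨_, hneg⟩ (Subtype.ext (by
      rw [AddSubmonoid.coe_add, ConeHom.ofLE_dualMap_coe]
      exact neg_add_cancel _)) hlift
  obtain ⟨s', hs'⟩ : s ∈ Set.range ((ConeHom.ofLE hle).toricMap k).left := hrange.ge hf₀s
  refine ⟨γ, hle, s', hopen, hs', ?_, fun a ha => ?_⟩
  · obtain ⟨m₀, hm₀⟩ := hV.exists_dotProduct_pos
    have hm₀V : m₀ ∈ σ.dualMonoid := hV.mem_dualMonoid_iff.mpr fun v hv => by
      by_cases hv0 : v = 0
      · simp [hv0]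
      · exact (hm₀ v hv hv0).le
    rw [hV.torus_eq ⟨m₀, hm₀V⟩ hm₀, hγ.torus_eq ((ConeHom.ofLE hle).dualMap ⟨m₀, hm₀V⟩)
      fun v hv hv0 => by
        rw [ConeHom.ofLE_dualMap_coe]
        exact hm₀ v (hJ v hv).1 hv0]
    ext q
    exact (ConeHom.single_mem_toricMap _ q _).not
  · have hs'prime : (PrimeSpectrum.asIdeal s').IsPrime := PrimeSpectrum.isPrime s'
    obtain ⟨N, b, hb⟩ := hlift a
    have hf₀s' : AddMonoidAlgebra.single ((ConeHom.ofLE hle).dualMap f₀) (1 : k) ∉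
        PrimeSpectrum.asIdeal s' := by
      rw [← ConeHom.single_mem_toricMap, hs']
      exact hf₀s
    -- Up to a multiple of f₀ the character a comes from X_σ and does not vanish at s there, hence
    -- it is orthogonal to the face.
    have hbs : AddMonoidAlgebra.single b (1 : k) ∉ PrimeSpectrum.asIdeal s := by
      rw [← hs', ConeHom.single_mem_toricMap, ← hb, single_add_mem_iff]
      exact not_or.mpr ⟨ha, single_nsmul_notMem _ hf₀s' N⟩
    refine hγ.mem_dualMonoid_iff.mpr fun v hv => ?_
    have h1 := hperp b hbs v hv
    rw [← ConeHom.ofLE_dualMap_coe hle b, ← hb, AddSubmonoid.coe_add, AddSubmonoidClass.coe_nsmul,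
      ConeHom.ofLE_dualMap_coe, add_dotProduct, smul_dotProduct, (hJ v hv).2, smul_zero,
      add_zero] at h1
    rw [neg_dotProduct, h1, neg_zero]

end Faces

/-! ### Coordinates on a regular cone. -/

section Coordinates

variable {n : ℕ} {σ : RationalCone n}

/-- A lattice point of the dual cone which is not invertible, and not a sum of two points which
are not invertible. -/
structure RationalCone.IsIrreducible (σ : RationalCone n) (p : Fin n → ℤ) : Prop where
  mem : p ∈ σ.dualMonoid
  neg_notMem : -p ∉ σ.dualMonoid
  neg_mem_or : ∀ a ∈ σ.dualMonoid, ∀ b ∈ σ.dualMonoid, a + b = p →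
    -a ∈ σ.dualMonoid ∨ -b ∈ σ.dualMonoid

/-- The sum of the values on the generators is additive and positive on non-invertible points, so
splitting a reducible point terminates. -/
theorem RationalCone.induction_on_irreducible (σ : RationalCone n) 
    {P : (m : Fin n → ℤ) → m ∈ σ.dualMonoid → Prop}
    (unit : ∀ g (hg : g ∈ σ.dualMonoid), -g ∈ σ.dualMonoid → P g hg)
    (irreducible : ∀ p (hp : σ.IsIrreducible p), P p hp.mem)
    (add : ∀ a (ha : a ∈ σ.dualMonoid) b (hb : b ∈ σ.dualMonoid), P a ha → P b hb →
      P (a + b) (add_mem ha hb)) (m : Fin n → ℤ) (hm : m ∈ σ.dualMonoid) : P m hm := by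
  obtain ⟨V, hV⟩ := σ.exists_isGeneratedBy
  let u : (Fin n → ℤ) → ℤ := fun m => ∑ v ∈ V, m ⬝ᵥ v
  have hu_add (a b) : u (a + b) = u a + u b := by
    simp [u, add_dotProduct, Finset.sum_add_distrib]
  have hu_pos (a) (ha : a ∈ σ.dualMonoid) (ha' : -a ∉ σ.dualMonoid) : 0 < u a := by
    have h0 := hV.mem_dualMonoid_iff.mp ha
    refine (Finset.sum_nonneg h0).lt_of_ne fun h => ha' (hV.mem_dualMonoid_iff.mpr fun v hv => ?_)
    rw [neg_dotProduct, (Finset.sum_eq_zero_iff_of_nonneg h0).mp h.symm v hv, neg_zero]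
  suffices ∀ N : ℕ, ∀ m (hm : m ∈ σ.dualMonoid), u m ≤ N → P m hm from
    this (u m).toNat m hm (Int.self_le_toNat _)
  clear hm m
  intro N
  induction N with
  | zero =>
    intro m hm hN
    by_cases hneg : -m ∈ σ.dualMonoid
    · exact unit m hm hneg
    · have := hu_pos m hm hneg
      norm_num at hN
      omega
  | succ N ih =>
    intro m hm hN
    by_cases hneg : -m ∈ σ.dualMonoid
    · exact unit m hm hneg
    by_cases hirr : σ.IsIrreducible m
    · exact irreducible m hirr
    obtain ⟨a, ha, b, hb, hab, ha', hb'⟩ : ∃ a ∈ σ.dualMonoid, ∃ b ∈ σ.dualMonoid, a + b = m ∧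
        -a ∉ σ.dualMonoid ∧ -b ∉ σ.dualMonoid := by
      by_contra! h
      exact hirr ⟨hm, hneg, fun a ha b hb hab => or_iff_not_imp_left.mpr (h a ha b hb hab)⟩
    have h1 := hu_pos a ha ha'
    have h2 := hu_pos b hb hb'
    have h3 := hu_add a b
    push_cast at hN
    subst hab
    exact add a ha b hb (ih a ha (by omega)) (ih b hb (by omega))

theorem RationalCone.exists_mem_interior (σ : RationalCone n) : ∃ m₀ ∈ σ.dualMonoid,
    ∀ m : Fin n → ℤ, ∃ N : ℕ, m + N • m₀ ∈ σ.dualMonoid := by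
  obtain ⟨V, hV⟩ := σ.exists_isGeneratedBy
  obtain ⟨m₀, hm₀⟩ := hV.exists_dotProduct_pos
  have h0 : ∀ v ∈ V, 0 ≤ m₀ ⬝ᵥ v := fun v hv => by
    by_cases hv0 : v = 0
    · simp [hv0]
    · exact (hm₀ v hv hv0).le
  refine ⟨m₀, hV.mem_dualMonoid_iff.mpr h0, fun m => hV.exists_add_nsmul_mem h0 m
    fun v hv h => ?_⟩
  by_cases hv0 : v = 0
  · simp [hv0]
  · exact absurd h (hm₀ v hv hv0).ne'

/-- Strict convexity of σ makes its dual full-dimensional: multiples of an interior point absorb any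
lattice point. -/
theorem RationalCone.exists_eq_sub (σ : RationalCone n) (m : Fin n → ℤ) :
    ∃ a ∈ σ.dualMonoid, ∃ b ∈ σ.dualMonoid, m = a - b := by
  obtain ⟨m₀, hm₀, h⟩ := σ.exists_mem_interior
  obtain ⟨N, hN⟩ := h m
  exact ⟨_, hN, N • m₀, nsmul_mem hm₀ N, by abel⟩

theorem RationalCone.ext_dotProduct (σ : RationalCone n) {e e' : Fin n → ℤ}
    (h : ∀ m ∈ σ.dualMonoid, e ⬝ᵥ m = e' ⬝ᵥ m) : e = e' := by
  refine dotProduct_eq _ _ fun m => ?_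
  obtain ⟨a, ha, b, hb, rfl⟩ := σ.exists_eq_sub m
  rw [dotProduct_sub, dotProduct_sub, h a ha, h b hb]

/-- An additive function on the lattice points of the dual cone is given by an integral vector. -/
theorem RationalCone.exists_dotProduct_eq (σ : RationalCone n) (μ : σ.dualMonoid →+ ℕ) :
    ∃ e : Fin n → ℤ, ∀ m : σ.dualMonoid, e ⬝ᵥ (m : Fin n → ℤ) = μ m := by
  obtain ⟨m₀, hm₀, h⟩ := σ.exists_mem_interior
  choose N hN using h
  -- The extension to the whole lattice, computed after moving m into the dual cone by N m copies of
  -- m₀; additivity shows that the choice does not matter.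
  let ν : (Fin n → ℤ) →+ ℤ := AddMonoidHom.mk' (fun m => (μ ⟨_, hN m⟩ : ℤ) - N m * μ ⟨m₀, hm₀⟩)
    fun a b => by
      have key : (⟨_, hN (a + b)⟩ + (N a + N b) • ⟨m₀, hm₀⟩ : σ.dualMonoid) =
          ⟨_, hN a⟩ + ⟨_, hN b⟩ + N (a + b) • ⟨m₀, hm₀⟩ := by
        refine Subtype.ext ?_
        change a + b + N (a + b) • m₀ + (N a + N b) • m₀ = a + N a • m₀ + (b + N b • m₀) + _
        rw [add_smul]
        change _ = a + N a • m₀ + (b + N b • m₀) + N (a + b) • m₀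
        abel
      have h := congrArg μ key
      simp only [map_add, map_nsmul, smul_eq_mul] at h
      zify at h
      linarith
  refine ⟨fun i => ν (fun j => if i = j then 1 else 0), fun m => ?_⟩
  have h1 : ν m = μ m := by
    have key : (⟨_, hN m⟩ : σ.dualMonoid) = m + N m • ⟨m₀, hm₀⟩ := rfl
    change (μ ⟨_, hN m⟩ : ℤ) - N m * μ ⟨m₀, hm₀⟩ = μ m
    rw [key, map_add, map_nsmul]
    push_cast
    simp
  have h2 := LinearMap.pi_apply_eq_sum_univ ν.toIntLinearMap (m : Fin n → ℤ)
  rw [← h1]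
  refine Eq.trans (Finset.sum_congr rfl fun i _ => ?_) h2.symm
  rw [smul_eq_mul, mul_comm]
  rfl

theorem RationalCone.dotProduct_eq_zero_of_neg_mem {e : Fin n → ℤ}
    (he : ∀ m ∈ σ.dualMonoid, 0 ≤ e ⬝ᵥ m) {g : Fin n → ℤ} (hg : g ∈ σ.dualMonoid)
    (hg' : -g ∈ σ.dualMonoid) : e ⬝ᵥ g = 0 := by
  have h1 := he g hg
  have h2 := he _ hg'
  rw [dotProduct_neg] at h2
  omega

/-- Primitive generators `e i` of the rays of a regular cone, with dual lattice points `p i`. -/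
structure RationalCone.Coordinates (σ : RationalCone n) (ι : Type) [Fintype ι]
    [DecidableEq ι] where
  e : ι → Fin n → ℤ
  p : ι → Fin n → ℤ
  e_dotProduct_p : ∀ i j, e i ⬝ᵥ p j = if i = j then 1 else 0
  mem_iff : ∀ m, m ∈ σ.dualMonoid ↔ ∀ i, 0 ≤ e i ⬝ᵥ m
  castVec_e_mem : ∀ i, castVec (e i) ∈ σ.cone

/-- A cone has coordinates if every irreducible lattice point of the dual cone has a valuation. -/
theorem RationalCone.exists_coordinates (σ : RationalCone n)
    (h : ∀ p, σ.IsIrreducible p → ∃ e : Fin n → ℤ, (∀ m ∈ σ.dualMonoid, 0 ≤ e ⬝ᵥ m) ∧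
      e ⬝ᵥ p = 1 ∧ ∀ q, σ.IsIrreducible q → e ⬝ᵥ q ≠ 0 →
        p - q ∈ σ.dualMonoid ∧ q - p ∈ σ.dualMonoid) :
    ∃ (ι : Type) (_ : Fintype ι) (_ : DecidableEq ι), Nonempty (σ.Coordinates ι) := by
  classical
  choose E hE0 hE1 hE using h
  let E' : {p // σ.IsIrreducible p} → Fin n → ℤ := fun p => E p.1 p.2
  -- By hypothesis p and q differ by an invertible point. Both functionals vanish on invertible
  -- points and equal 1 on the irreducible points equivalent to p, 0 on all others.
  have hEeq (p q : {p // σ.IsIrreducible p}) (h : E' p ⬝ᵥ q.1 ≠ 0) : E' p = E' q := by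
    obtain ⟨h1, h2⟩ := hE p.1 p.2 q.1 q.2 h
    refine σ.ext_dotProduct fun m hm => ?_
    induction m, hm using σ.induction_on_irreducible with
    | unit g hg hg' =>
      rw [dotProduct_eq_zero_of_neg_mem (hE0 p.1 p.2) hg hg',
        dotProduct_eq_zero_of_neg_mem (hE0 q.1 q.2) hg hg']
    | irreducible r hr =>
      have key (a b : {p // σ.IsIrreducible p}) (hab : a.1 - b.1 ∈ σ.dualMonoid)
          (hba : b.1 - a.1 ∈ σ.dualMonoid) (hr0 : E' a ⬝ᵥ r ≠ 0) : E' b ⬝ᵥ r = 1 := by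
        obtain ⟨h3, h4⟩ := hE a.1 a.2 r hr hr0
        have h5 : r - b.1 ∈ σ.dualMonoid := by
          have := add_mem h4 hab
          rwa [sub_add_sub_cancel] at this
        have h6 : -(r - b.1) ∈ σ.dualMonoid := by
          have := add_mem hba h3
          rwa [sub_add_sub_cancel, ← neg_sub] at this
        have h7 := dotProduct_eq_zero_of_neg_mem (hE0 b.1 b.2) h5 h6
        rw [dotProduct_sub, hE1, sub_eq_zero] at h7
        exact h7
      by_cases hp0 : E' p ⬝ᵥ r = 0
      · by_cases hq0 : E' q ⬝ᵥ r = 0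
        · rw [hp0, hq0]
        · have := key q p h2 h1 hq0
          omega
      · have h3 := key p q h1 h2 hp0
        rw [h3, key q p h2 h1 (by omega)]
    | add a ha b hb iha ihb => rw [dotProduct_add, dotProduct_add, iha, ihb]
  -- Indexing by the functionals, not by irreducible points, keeps one ray per class modulo
  -- invertible points. Duality makes the chosen P i linearly independent, so the index set is
  -- finite.
  let ι : Type := Set.range E'
  have hdec : DecidableEq ι := Classical.decEq ι
  let P : ι → {p // σ.IsIrreducible p} := fun i => i.2.choose
  have hP (i : ι) : E' (P i) = i.1 := i.2.choose_spec
  have hdual (i j : ι) : i.1 ⬝ᵥ (P j).1 = if i = j then 1 else 0 := by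
    split_ifs with hij
    · rw [hij, ← hP j]
      exact hE1 _ _
    · by_contra hne
      rw [← hP i] at hne
      have := hEeq _ _ hne
      rw [hP, hP] at this
      exact hij (Subtype.ext this)
  have hnonneg (i : ι) : ∀ m ∈ σ.dualMonoid, 0 ≤ i.1 ⬝ᵥ m := by
    rw [← hP i]
    exact hE0 _ _
  have hsum (s : Finset ι) (c : ι → ℤ) (i : ι) :
      i.1 ⬝ᵥ ∑ j ∈ s, c j • (P j).1 = if i ∈ s then c i else 0 := by
    simp only [dotProduct_sum, dotProduct_smul, hdual, smul_eq_mul, mul_ite, mul_one, mul_zero,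
      Finset.sum_ite_eq]
  have hlin : LinearIndependent ℤ fun i => (P i).1 := by
    rw [linearIndependent_iff']
    intro s c hc i hi
    have := hsum s c i
    rw [hc, dotProduct_zero, if_pos hi] at this
    exact this.symm
  have : Finite ι := hlin.finite
  have : Fintype ι := Fintype.ofFinite ι
  -- Every lattice point is a combination of the P i up to an invertible point: this holds for
  -- invertible and irreducible points and is additive.
  have hunit (m : Fin n → ℤ) : m - ∑ i : ι, (i.1 ⬝ᵥ m) • (P i).1 ∈ σ.dualMonoid ∧
      -(m - ∑ i : ι, (i.1 ⬝ᵥ m) • (P i).1) ∈ σ.dualMonoid := by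
    have hadd (a b : Fin n → ℤ) : a + b - ∑ i : ι, (i.1 ⬝ᵥ (a + b)) • (P i).1 =
        (a - ∑ i : ι, (i.1 ⬝ᵥ a) • (P i).1) + (b - ∑ i : ι, (i.1 ⬝ᵥ b) • (P i).1) := by
      simp only [dotProduct_add, add_smul, Finset.sum_add_distrib]
      abel
    have hneg (a : Fin n → ℤ) : -a - ∑ i : ι, (i.1 ⬝ᵥ (-a)) • (P i).1 =
        -(a - ∑ i : ι, (i.1 ⬝ᵥ a) • (P i).1) := by
      simp only [dotProduct_neg, neg_smul, Finset.sum_neg_distrib]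
      abel
    have hmem : ∀ m ∈ σ.dualMonoid, m - ∑ i : ι, (i.1 ⬝ᵥ m) • (P i).1 ∈ σ.dualMonoid ∧
        -(m - ∑ i : ι, (i.1 ⬝ᵥ m) • (P i).1) ∈ σ.dualMonoid := by
      intro m hm
      induction m, hm using σ.induction_on_irreducible with
      | unit g hg hg' =>
        have h0 : ∑ i : ι, (i.1 ⬝ᵥ g) • (P i).1 = 0 := Finset.sum_eq_zero fun i _ => by
          rw [dotProduct_eq_zero_of_neg_mem (hnonneg i) hg hg', zero_smul]
        rw [h0, sub_zero]
        exact ⟨hg, hg'⟩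
      | irreducible r hr =>
        let i₀ : ι := ⟨E' ⟨r, hr⟩, _, rfl⟩
        have h1 : i₀.1 ⬝ᵥ r = 1 := hE1 r hr
        have h2 (i : ι) : i.1 ⬝ᵥ r = if i = i₀ then 1 else 0 := by
          split_ifs with hi
          · rw [hi, h1]
          · by_contra hne
            rw [← hP i] at hne
            have := hEeq _ ⟨r, hr⟩ hne
            rw [hP] at this
            exact hi (Subtype.ext this)
        have h3 : ∑ i : ι, (i.1 ⬝ᵥ r) • (P i).1 = (P i₀).1 := by
          simp [h2]
        rw [h3, neg_sub]
        have h4 : E' (P i₀) ⬝ᵥ r ≠ 0 := by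
          rw [hP, h1]
          exact one_ne_zero
        exact (hE _ _ r hr h4).symm
      | add a ha b hb iha ihb =>
        rw [hadd, neg_add]
        exact ⟨add_mem iha.1 ihb.1, add_mem iha.2 ihb.2⟩
    obtain ⟨a, ha, b, hb, rfl⟩ := σ.exists_eq_sub m
    obtain ⟨ha1, ha2⟩ := hmem a ha
    obtain ⟨hb1, hb2⟩ := hmem b hb
    rw [sub_eq_add_neg a b, hadd, hneg, neg_add, neg_neg]
    exact ⟨add_mem ha1 hb2, add_mem ha2 hb1⟩
  have hmem_iff (m : Fin n → ℤ) : m ∈ σ.dualMonoid ↔ ∀ i : ι, 0 ≤ i.1 ⬝ᵥ m := by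
    refine ⟨fun hm i => hnonneg i m hm, fun hm => ?_⟩
    rw [← sub_add_cancel m (∑ i : ι, (i.1 ⬝ᵥ m) • (P i).1)]
    refine add_mem (hunit m).1 (sum_mem fun i _ => ?_)
    rw [← Int.toNat_of_nonneg (hm i), natCast_zsmul]
    exact nsmul_mem (P i).2.mem _
  refine ⟨ι, inferInstance, hdec, ⟨⟨fun i => i.1, fun i => (P i).1, hdual, hmem_iff,
    fun i => ?_⟩⟩⟩
  obtain ⟨V, hV⟩ := σ.exists_isGeneratedBy
  -- N exceeds every value of P i on a generator. A generator v on which -P i + N ∑_{j ≠ i} P j is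
  -- negative must then be killed by all P j with j ≠ i, so v is a positive multiple of the
  -- functional i, which therefore lies in σ.
  let N : ℤ := ∑ v ∈ V, (P i).1 ⬝ᵥ v + 1
  have hpV (j : ι) : ∀ v ∈ V, 0 ≤ (P j).1 ⬝ᵥ v := hV.mem_dualMonoid_iff.mp (P j).2.mem
  have hN : ∀ v ∈ V, (P i).1 ⬝ᵥ v < N := fun v hv =>
    Int.lt_add_one_of_le (Finset.single_le_sum (hpV i) hv)
  have hnot : -(P i).1 + N • ∑ j ∈ Finset.univ.erase i, (P j).1 ∉ σ.dualMonoid := by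
    intro hmem
    have h1 := hnonneg i _ hmem
    rw [dotProduct_add, dotProduct_neg, dotProduct_smul, hdual, if_pos rfl] at h1
    have h2 := hsum (Finset.univ.erase i) 1 i
    simp only [Pi.one_apply, one_smul, Finset.mem_erase, ne_eq, not_true_eq_false, false_and,
      if_false] at h2
    rw [h2, smul_zero] at h1
    omega
  rw [hV.mem_dualMonoid_iff] at hnot
  push Not at hnot
  obtain ⟨v, hv, hvneg⟩ := hnot
  rw [add_dotProduct, neg_dotProduct, smul_dotProduct, sum_dotProduct, smul_eq_mul] at hvneg
  have hs0 : 0 ≤ ∑ j ∈ Finset.univ.erase i, (P j).1 ⬝ᵥ v :=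
    Finset.sum_nonneg fun j _ => hpV j v hv
  have hs1 : ∑ j ∈ Finset.univ.erase i, (P j).1 ⬝ᵥ v = 0 := by
    by_contra hne
    have h1 : 1 ≤ ∑ j ∈ Finset.univ.erase i, (P j).1 ⬝ᵥ v := by omega
    have h2 := hN v hv
    have h3 := hpV i v hv
    nlinarith
  have hs2 (j : ι) (hj : j ≠ i) : (P j).1 ⬝ᵥ v = 0 :=
    (Finset.sum_eq_zero_iff_of_nonneg fun j _ => hpV j v hv).mp hs1 j
      (Finset.mem_erase.mpr ⟨hj, Finset.mem_univ j⟩)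
  rw [hs1, mul_zero, add_zero] at hvneg
  have hpos : 0 < (P i).1 ⬝ᵥ v := by omega
  have hvE : v = ((P i).1 ⬝ᵥ v) • i.1 := by
    refine σ.ext_dotProduct fun m _ => ?_
    have h1 := dotProduct_eq_zero_of_neg_mem (σ := σ) (e := v) (fun m hm => by
      rw [dotProduct_comm]
      exact hV.mem_dualMonoid_iff.mp hm v hv) (hunit m).1 (hunit m).2
    rw [dotProduct_sub, dotProduct_sum, sub_eq_zero] at h1
    rw [h1, Finset.sum_eq_single i, smul_dotProduct, dotProduct_smul, smul_eq_mul, smul_eq_mul,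
      mul_comm, dotProduct_comm v]
    · intro j _ hj
      rw [dotProduct_smul, dotProduct_comm v, hs2 j hj, smul_zero]
    · intro hi
      exact absurd (Finset.mem_univ i) hi
  have hposR : (0 : ℝ) < ((P i).1 ⬝ᵥ v : ℤ) := by exact_mod_cast hpos
  have hcast : castVec i.1 = (((P i).1 ⬝ᵥ v : ℤ) : ℝ)⁻¹ • castVec v := by
    rw [eq_inv_smul_iff₀ hposR.ne']
    ext j
    have := congrFun hvE j
    simp only [Pi.smul_apply, smul_eq_mul, castVec] at this ⊢
    rw [this]
    push_cast
    rfl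
  change castVec i.1 ∈ _
  rw [hcast]
  exact σ.cone.smul_mem (inv_nonneg.mpr hposR.le) (hV.castVec_mem hv)

end Coordinates

/-! ### Tangent vectors and primes of order one. -/

section DualNumbers

theorem isUnit_of_isLocalization_atPrime {A R : Type*} [CommRing A] [CommRing R] (φ : A →+* R)
    (P : Ideal A) [P.IsPrime] (hφ : let := φ.toAlgebra; IsLocalization.AtPrime R P) {a : A}
    (ha : a ∉ P) : IsUnit (φ a) := by
  let := φ.toAlgebra
  exact IsLocalization.map_units (M := P.primeCompl) R ⟨a, ha⟩

/-- A map to the dual numbers extends to the localization, because elements outside P become units,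
and to the completion, because it kills the square of the maximal ideal. -/
theorem exists_adicCompletion_dualNumber_hom {k A R : Type*} [Field k] [CommRing A] [CommRing R]
    [IsLocalRing R] (φ : A →+* R) (P : Ideal A) [P.IsPrime]
    (hφ : let := φ.toAlgebra; IsLocalization.AtPrime R P)
    (D₀ : A →+* DualNumber k) (hD₀ : ∀ a, a ∉ P → (D₀ a).fst ≠ 0)
    (hsurj : ∀ c : k, ∃ a, (D₀ a).fst = c) :
    ∃ D : AdicCompletion (maximalIdeal R) R →+* DualNumber k,
      ∀ a, D (algebraMap R _ (φ a)) = D₀ a := by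
  let := φ.toAlgebra
  let D₁ : R →+* DualNumber k := IsLocalization.lift (M := P.primeCompl) (g := D₀) fun y =>
    TrivSqZeroExt.isUnit_iff_isUnit_fst.mpr (isUnit_iff_ne_zero.mpr (hD₀ y y.2))
  have hD₁ (a : A) : D₁ (φ a) = D₀ a := IsLocalization.lift_eq _ a
  let f : R →+* k := (TrivSqZeroExt.fstHom k k k : DualNumber k →+* k).comp D₁
  have hf (r : R) : f r = (D₁ r).fst := rfl
  have hker : RingHom.ker f = maximalIdeal R :=
    eq_maximalIdeal (RingHom.ker_isMaximal_of_surjective f fun c => by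
      obtain ⟨a, ha⟩ := hsurj c
      exact ⟨φ a, by rw [hf, hD₁, ha]⟩)
  have hsq : ∀ r ∈ maximalIdeal R ^ 2, D₁ r = 0 := by
    intro r hr
    rw [pow_two] at hr
    refine (Ideal.mul_le (K := RingHom.ker D₁)).mpr (fun a ha b hb => ?_) hr
    rw [← hker, RingHom.mem_ker, hf] at ha hb
    rw [RingHom.mem_ker, map_mul]
    ext <;> simp [ha, hb]
  refine ⟨(Ideal.Quotient.lift _ D₁ hsq).comp
    (AdicCompletion.evalₐ (maximalIdeal R) 2 : _ →+* R ⧸ maximalIdeal R ^ 2), fun a => ?_⟩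
  rw [← hD₁, RingHom.comp_apply, RingHom.coe_coe, evalₐ_algebraMap, Ideal.Quotient.lift_mk]

/-- The properties of the completed local rings of nonsingular varieties over `k`, at rational
points, which are used here. -/
structure IsRegularCompletion (k : Type*) [Field k] (R : Type*) [CommRing R] : Prop where
  isDomain : IsDomain R
  isNoetherianRing : IsNoetherianRing R
  prime : ∀ D : R →+* DualNumber k, (∀ c : k, ∃ y, (D y).fst = c) → ∀ y : R, (D y).fst = 0 →
    (D y).snd ≠ 0 → Prime y

theorem IsRegularCompletion.of_ringEquiv {k R R' : Type*} [Field k] [CommRing R] [CommRing R']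
    (h : IsRegularCompletion k R) (e : R ≃+* R') : IsRegularCompletion k R' where
  isDomain := by
    have := h.isDomain
    exact e.symm.toMulEquiv.isDomain _
  isNoetherianRing := by
    have := h.isNoetherianRing
    exact isNoetherianRing_of_ringEquiv _ e
  prime D hD y hy hy' := by
    rw [← MulEquiv.prime_iff e.symm.toMulEquiv]
    refine h.prime (D.comp (e : R →+* R')) (fun c => ?_) _ ?_ ?_
    · obtain ⟨z, hz⟩ := hD c
      exact ⟨e.symm z, by simpa using hz⟩
    · simpa using hy
    · simpa using hy'

/-- The homomorphism kills the square of the maximal ideal, so an element with nonzero ε-part and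
zero constant part has order exactly one. -/
theorem isRegularCompletion_of_isRegularLocalRing {k R : Type*} [Field k] [Infinite k]
    [CommRing R] [Algebra k R] [IsRegularLocalRing R]
    (hres : ∀ a : R, ∃ c : k, a - algebraMap k R c ∈ maximalIdeal R) :
    IsRegularCompletion k (AdicCompletion (maximalIdeal R) R) where
  isDomain := (adicCompletion_isDomain_and_isNoetherianRing hres).1
  isNoetherianRing := (adicCompletion_isDomain_and_isNoetherianRing hres).2
  prime D hD y hy hy' := by
    let f : AdicCompletion (maximalIdeal R) R →+* k :=
      (TrivSqZeroExt.fstHom k k k : DualNumber k →+* k).comp D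
    have hker : RingHom.ker f = maximalIdeal _ :=
      eq_maximalIdeal (RingHom.ker_isMaximal_of_surjective f hD)
    refine prime_of_notMem_sq hres y (hker ▸ hy) fun h => hy' ?_
    rw [pow_two] at h
    have : y ∈ RingHom.ker D := (Ideal.mul_le (K := RingHom.ker D)).mpr (fun a ha b hb => by
      have ha' : (D a).fst = 0 := by
        rw [← hker] at ha
        exact ha
      have hb' : (D b).fst = 0 := by
        rw [← hker] at hb
        exact hb
      rw [RingHom.mem_ker, map_mul]
      ext <;> simp [ha', hb']) h
    rw [RingHom.mem_ker] at this
    rw [this, TrivSqZeroExt.snd_zero]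

end DualNumbers

/-! ### The tangent vector attached to an irreducible lattice point. -/

section UnitValues

variable {k : Type u} [Field k] {n : ℕ} {σ : RationalCone n}

open Classical in
/-- The value of a homomorphism to `k` at the invertible characters, extended by zero. -/
noncomputable def unitValue (ev : σ.ring k →ₐ[k] k) (a : Fin n → ℤ) : k :=
  if h : a ∈ σ.dualMonoid ∧ -a ∈ σ.dualMonoid then
    ev (AddMonoidAlgebra.single ⟨a, h.1⟩ 1) else 0

variable (ev : σ.ring k →ₐ[k] k)

theorem unitValue_of_mem {a : Fin n → ℤ} (ha : a ∈ σ.dualMonoid) (ha' : -a ∈ σ.dualMonoid) :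
    unitValue ev a = ev (AddMonoidAlgebra.single ⟨a, ha⟩ 1) :=
  dif_pos ⟨ha, ha'⟩

theorem unitValue_of_notMem {a : Fin n → ℤ} (ha : ¬(a ∈ σ.dualMonoid ∧ -a ∈ σ.dualMonoid)) :
    unitValue ev a = 0 :=
  dif_neg ha

theorem unitValue_zero : unitValue ev 0 = 1 := by
  rw [unitValue_of_mem ev (zero_mem _) (by rw [neg_zero]; exact zero_mem _)]
  exact map_one ev

theorem unitValue_add {a : Fin n → ℤ} (ha : a ∈ σ.dualMonoid) (ha' : -a ∈ σ.dualMonoid)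
    (b : Fin n → ℤ) : unitValue ev (a + b) = unitValue ev a * unitValue ev b := by
  by_cases hb : b ∈ σ.dualMonoid ∧ -b ∈ σ.dualMonoid
  · rw [unitValue_of_mem ev ha ha', unitValue_of_mem ev hb.1 hb.2, ← map_mul,
      AddMonoidAlgebra.single_mul_single, one_mul, unitValue_of_mem ev (add_mem ha hb.1)
        (by rw [neg_add]; exact add_mem ha' hb.2)]
    rfl
  · rw [unitValue_of_notMem ev hb, mul_zero, unitValue_of_notMem]
    rintro ⟨h1, h2⟩
    refine hb ⟨?_, ?_⟩
    · simpa using add_mem ha' h1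
    · simpa using add_mem ha h2

theorem RationalCone.IsIrreducible.unitValue_eq_zero {p : Fin n → ℤ} (hp : σ.IsIrreducible p) :
    unitValue ev p = 0 :=
  unitValue_of_notMem ev fun h => hp.neg_notMem h.2

/-- The Leibniz rule making χ^a ↦ u(a) + u(a - p) ε multiplicative. If a or b is invertible, one
term on the right survives; if neither is, irreducibility of p makes both sides vanish. -/
theorem RationalCone.IsIrreducible.unitValue_add_sub {p : Fin n → ℤ} (hp : σ.IsIrreducible p)
    {a b : Fin n → ℤ} (ha : a ∈ σ.dualMonoid) (hb : b ∈ σ.dualMonoid) :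
    unitValue ev (a + b - p) =
      unitValue ev a * unitValue ev (b - p) + unitValue ev b * unitValue ev (a - p) := by
  have key (a : Fin n → ℤ) (ha' : -a ∈ σ.dualMonoid) : unitValue ev (a - p) = 0 := by
    refine unitValue_of_notMem ev fun h => hp.neg_notMem ?_
    rw [show -p = -a + (a - p) by abel]
    exact add_mem ha' h.1
  by_cases ha' : -a ∈ σ.dualMonoid
  · rw [key a ha', mul_zero, add_zero, add_sub_assoc, unitValue_add ev ha ha']
  by_cases hb' : -b ∈ σ.dualMonoid
  · rw [key b hb', mul_zero, zero_add, add_comm a b, add_sub_assoc, unitValue_add ev hb hb']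
  rw [unitValue_of_notMem ev (a := a) (by tauto), unitValue_of_notMem ev (a := b) (by tauto),
    zero_mul, zero_mul, add_zero]
  refine unitValue_of_notMem ev fun h => ?_
  -- If a + b - p were invertible, it could be absorbed into b, writing p as a sum of two
  -- non-invertible points.
  rcases hp.neg_mem_or a ha (b + (p - (a + b))) (add_mem hb (by simpa using h.2)) (by abel)
    with h1 | h1
  · exact ha' h1
  · refine hb' ?_
    rw [show -b = -(b + (p - (a + b))) + -(a + b - p) by abel]
    exact add_mem h1 h.2

/-- The homomorphism to the dual numbers defined by an irreducible lattice point. -/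
noncomputable def irreducibleHom {p : Fin n → ℤ} (hp : σ.IsIrreducible p) :
    σ.ring k →ₐ[k] DualNumber k :=
  AddMonoidAlgebra.lift k (DualNumber k) σ.dualMonoid
    { toFun a := (unitValue ev a.toAdd, unitValue ev ((a.toAdd : Fin n → ℤ) - p))
      map_one' := by
        refine TrivSqZeroExt.ext (unitValue_zero ev) ?_
        refine unitValue_of_notMem ev fun h => hp.neg_notMem ?_
        simpa using h.1
      map_mul' a b := by
        refine TrivSqZeroExt.ext ?_ ?_
        · change unitValue ev ((a.toAdd : Fin n → ℤ) + b.toAdd) = unitValue ev _ * unitValue ev _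
          by_cases ha : -(a.toAdd : Fin n → ℤ) ∈ σ.dualMonoid
          · rw [unitValue_add ev a.toAdd.2 ha]
          · rw [unitValue_of_notMem ev (a := a.toAdd) (by tauto), zero_mul]
            refine unitValue_of_notMem ev fun h => ha ?_
            simpa using add_mem b.toAdd.2 h.2
        · refine Eq.trans ?_ (TrivSqZeroExt.snd_mul _ _).symm
          refine (hp.unitValue_add_sub ev a.toAdd.2 b.toAdd.2).trans ?_
          rw [mul_comm (unitValue ev b.toAdd)]
          rfl }

theorem irreducibleHom_single {p : Fin n → ℤ} (hp : σ.IsIrreducible p) (a : σ.dualMonoid) :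
    irreducibleHom ev hp (AddMonoidAlgebra.single a 1) =
      (unitValue ev a, unitValue ev ((a : Fin n → ℤ) - p)) := by
  rw [irreducibleHom, AddMonoidAlgebra.lift_single, one_smul]
  rfl

end UnitValues

/-! ### Characters in the completed local ring. -/

section CompletedCharacters

variable {k : Type u} [Field k] {n : ℕ} {σ : RationalCone n}

/-- The homomorphism from the coordinate ring to a local ring of `X_σ`. -/
noncomputable def RationalCone.toStalk (σ : RationalCone n) (s : (σ.toricVariety k).left) :
    σ.ring k →+* (σ.toricVariety k).left.presheaf.stalk s :=
  (StructureSheaf.toStalk (σ.ring k) s).hom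

theorem RationalCone.stalkIdeal_setOf_mem (s : (σ.toricVariety k).left) (a : σ.ring k) :
    stalkIdeal (σ.toricVariety k).left {q : Spec (.of (σ.ring k)) | a ∈ PrimeSpectrum.asIdeal q} s =
      (Ideal.span {σ.toStalk s a}).radical :=
  stalkIdeal_Spec_setOf_mem a s

/-- The homomorphism from the coordinate ring to a completed local ring of `X_σ`. -/
noncomputable def RationalCone.toCompletedStalk (σ : RationalCone n)
    (s : (σ.toricVariety k).left) : σ.ring k →+* CompletedStalk (σ.toricVariety k).left s :=
  (algebraMap ((σ.toricVariety k).left.presheaf.stalk s) _).comp (σ.toStalk s)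

/-- The image of a character in a completed local ring of `X_σ`. -/
noncomputable def RationalCone.character (σ : RationalCone n) (s : (σ.toricVariety k).left)
    (a : σ.dualMonoid) : CompletedStalk (σ.toricVariety k).left s :=
  σ.toCompletedStalk s (AddMonoidAlgebra.single a 1)

theorem RationalCone.character_add (s : (σ.toricVariety k).left) (a b : σ.dualMonoid) :
    σ.character s (a + b) = σ.character s a * σ.character s b := by
  rw [character, character, character, ← map_mul, AddMonoidAlgebra.single_mul_single, one_mul]

theorem RationalCone.character_zero (s : (σ.toricVariety k).left) :
    σ.character s 0 = 1 :=
  map_one (σ.toCompletedStalk s)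

theorem RationalCone.isUnit_character (s : (σ.toricVariety k).left) {a : σ.dualMonoid}
    (ha : -(a : Fin n → ℤ) ∈ σ.dualMonoid) : IsUnit (σ.character s a) := by
  refine IsUnit.of_mul_eq_one (σ.character s ⟨_, ha⟩) ?_
  rw [← character_add, ← character_zero]
  congr 1
  exact Subtype.ext (add_neg_cancel _)

theorem RationalCone.toCompletedStalk_algebraMap (s : (σ.toricVariety k).left) (c : k) :
    σ.toCompletedStalk s (algebraMap k (σ.ring k) c) = scalars (σ.toricVariety k) s c := by
  have h : (Scheme.ΓSpecIso (.of k)).inv ≫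
      (Spec.map (CommRingCat.ofHom (algebraMap k (σ.ring k)))).appTop ≫
      (Spec (.of (σ.ring k))).presheaf.germ ⊤ s trivial =
      CommRingCat.ofHom (algebraMap k (σ.ring k)) ≫ StructureSheaf.toStalk (σ.ring k) s := by
    rw [← Scheme.ΓSpecIso_inv_naturality_assoc]
    rfl
  exact congrArg (algebraMap ((σ.toricVariety k).left.presheaf.stalk s) _) congr($h c).symm

/-- A function not vanishing at s is a unit in the completion, so every function is congruent at s
to a constant. The condition is phrased in the completion, so it passes through a local model. -/
theorem RationalCone.exists_algHom_ker_eq (s : (σ.toricVariety k).left)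
    (hres : ∀ y : CompletedStalk (σ.toricVariety k).left s,
      ∃ c : k, ¬ IsUnit (y - scalars (σ.toricVariety k) s c)) :
    ∃ ev : σ.ring k →ₐ[k] k, ∀ a, ev a = 0 ↔ a ∈ PrimeSpectrum.asIdeal s := by
  have hprime : (PrimeSpectrum.asIdeal s).IsPrime := PrimeSpectrum.isPrime s
  have hbij : Function.Bijective (Algebra.ofId k (σ.ring k ⧸ PrimeSpectrum.asIdeal s)) := by
    refine ⟨RingHom.injective _, fun y => ?_⟩
    obtain ⟨a, rfl⟩ := Ideal.Quotient.mk_surjective y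
    obtain ⟨c, hc⟩ := hres (σ.toCompletedStalk s a)
    refine ⟨c, ((Ideal.Quotient.mk_eq_mk_iff_sub_mem _ _).mpr ?_).symm⟩
    by_contra hmem
    rw [← toCompletedStalk_algebraMap, ← map_sub] at hc
    refine hc ?_
    refine RingHom.isUnit_map (algebraMap ((σ.toricVariety k).left.presheaf.stalk s) _) ?_
    exact isUnit_of_isLocalization_atPrime (σ.toStalk s)
      (PrimeSpectrum.asIdeal s) (StructureSheaf.IsLocalization.to_stalk (σ.ring k) s) hmem
  let e := AlgEquiv.ofBijective _ hbij
  refine ⟨e.symm.toAlgHom.comp (Ideal.Quotient.mkₐ k (PrimeSpectrum.asIdeal s)), fun a => ?_⟩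
  change e.symm (Ideal.Quotient.mk _ a) = 0 ↔ _
  rw [map_eq_zero_iff _ e.symm.injective, Ideal.Quotient.eq_zero_iff_mem]

variable {s : (σ.toricVariety k).left} {ev : σ.ring k →ₐ[k] k}

theorem fst_irreducibleHom (hev : ∀ a, ev a = 0 ↔ a ∈ PrimeSpectrum.asIdeal s)
    (hred : ∀ a : σ.dualMonoid, AddMonoidAlgebra.single a (1 : k) ∉ PrimeSpectrum.asIdeal s →
        -(a : Fin n → ℤ) ∈ σ.dualMonoid) {p : Fin n → ℤ} (hp : σ.IsIrreducible p)
    (a : σ.ring k) : (irreducibleHom ev hp a).fst = ev a := by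
  have : (TrivSqZeroExt.fstHom k k k).comp (irreducibleHom ev hp) = ev := by
    refine AddMonoidAlgebra.algHom_ext (A := k) (M := σ.dualMonoid) (fun m => ?_) (by ext)
    rw [AlgHom.comp_apply, irreducibleHom_single]
    change unitValue ev m = _
    by_cases hm : -(m : Fin n → ℤ) ∈ σ.dualMonoid
    · exact unitValue_of_mem ev m.2 hm
    · rw [unitValue_of_notMem ev (by tauto), eq_comm, hev]
      by_contra h
      exact hm (hred m h)
  exact congr($this a)

theorem RationalCone.IsIrreducible.exists_hom
    (hev : ∀ a, ev a = 0 ↔ a ∈ PrimeSpectrum.asIdeal s)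
    (hred : ∀ a : σ.dualMonoid, AddMonoidAlgebra.single a (1 : k) ∉ PrimeSpectrum.asIdeal s →
        -(a : Fin n → ℤ) ∈ σ.dualMonoid) {p : Fin n → ℤ} (hp : σ.IsIrreducible p) :
    ∃ D : CompletedStalk (σ.toricVariety k).left s →+* DualNumber k,
      (∀ c : k, ∃ y, (D y).fst = c) ∧ ∀ a : σ.dualMonoid,
        D (σ.character s a) = (unitValue ev a, unitValue ev ((a : Fin n → ℤ) - p)) := by
  have hsurj (c : k) : ∃ a, (irreducibleHom ev hp a).fst = c :=
    ⟨algebraMap k _ c, by rw [fst_irreducibleHom hev hred, AlgHom.commutes]; rfl⟩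
  have hprime : (PrimeSpectrum.asIdeal s).IsPrime := PrimeSpectrum.isPrime s
  obtain ⟨D, hD⟩ := exists_adicCompletion_dualNumber_hom
    (R := (σ.toricVariety k).left.presheaf.stalk s) (σ.toStalk s)
    (PrimeSpectrum.asIdeal s) (StructureSheaf.IsLocalization.to_stalk (σ.ring k) s)
    (irreducibleHom ev hp : σ.ring k →+* DualNumber k)
    (fun a ha => by
      rw [RingHom.coe_coe, fst_irreducibleHom hev hred]
      exact (hev a).not.mpr ha) hsurj
  refine ⟨D, fun c => ?_, fun a => ?_⟩
  · obtain ⟨a, ha⟩ := hsurj c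
    exact ⟨_, (congrArg TrivSqZeroExt.fst (hD a)).trans ha⟩
  · rw [← irreducibleHom_single ev hp]
    exact hD _

/-- The tangent vector attached to p sends χ^p to ε. -/
theorem RationalCone.IsIrreducible.prime_character
    (hreg : IsRegularCompletion k (CompletedStalk (σ.toricVariety k).left s))
    (hev : ∀ a, ev a = 0 ↔ a ∈ PrimeSpectrum.asIdeal s)
    (hred : ∀ a : σ.dualMonoid, AddMonoidAlgebra.single a (1 : k) ∉ PrimeSpectrum.asIdeal s →
        -(a : Fin n → ℤ) ∈ σ.dualMonoid) {p : Fin n → ℤ} (hp : σ.IsIrreducible p) :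
    Prime (σ.character s ⟨p, hp.mem⟩) := by
  obtain ⟨D, hD, hDa⟩ := hp.exists_hom hev hred
  refine hreg.prime D hD _ ?_ ?_
  · rw [hDa]
    exact hp.unitValue_eq_zero ev
  · rw [hDa]
    change unitValue ev (p - p) ≠ 0
    rw [sub_self, unitValue_zero]
    exact one_ne_zero

/-- The tangent vector attached to q sends χ^q to ε, but kills χ^p, and hence its multiples, unless
p - q is invertible. -/
theorem RationalCone.IsIrreducible.sub_mem_of_dvd
    (hev : ∀ a, ev a = 0 ↔ a ∈ PrimeSpectrum.asIdeal s)
    (hred : ∀ a : σ.dualMonoid, AddMonoidAlgebra.single a (1 : k) ∉ PrimeSpectrum.asIdeal s →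
        -(a : Fin n → ℤ) ∈ σ.dualMonoid) {p q : Fin n → ℤ} (hp : σ.IsIrreducible p)
    (hq : σ.IsIrreducible q)
    (hdvd : σ.character s ⟨p, hp.mem⟩ ∣ σ.character s ⟨q, hq.mem⟩) :
    p - q ∈ σ.dualMonoid ∧ q - p ∈ σ.dualMonoid := by
  obtain ⟨D, hD, hDa⟩ := hq.exists_hom hev hred
  obtain ⟨c, hc⟩ := hdvd
  by_contra hne
  have h1 : D (σ.character s ⟨p, hp.mem⟩) = 0 := by
    rw [hDa]
    refine TrivSqZeroExt.ext (hp.unitValue_eq_zero ev) ?_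
    refine unitValue_of_notMem ev fun h => hne ⟨h.1, ?_⟩
    have := h.2
    rwa [neg_sub] at this
  have h2 := congrArg (fun y => (D y).snd) hc
  simp only [map_mul, h1, zero_mul, TrivSqZeroExt.snd_zero] at h2
  rw [hDa] at h2
  change unitValue ev (q - q) = 0 at h2
  rw [sub_self, unitValue_zero] at h2
  exact one_ne_zero h2

theorem RationalCone.character_ne_zero
    (hreg : IsRegularCompletion k (CompletedStalk (σ.toricVariety k).left s))
    (hev : ∀ a, ev a = 0 ↔ a ∈ PrimeSpectrum.asIdeal s)
    (hred : ∀ a : σ.dualMonoid, AddMonoidAlgebra.single a (1 : k) ∉ PrimeSpectrum.asIdeal s →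
        -(a : Fin n → ℤ) ∈ σ.dualMonoid) (a : σ.dualMonoid) : σ.character s a ≠ 0 := by
  have := hreg.isDomain
  obtain ⟨m, hm⟩ := a
  induction m, hm using σ.induction_on_irreducible with
  | unit g hg hg' => exact (isUnit_character s (a := ⟨g, hg⟩) hg').ne_zero
  | irreducible p hp => exact (hp.prime_character hreg hev hred).ne_zero
  | add a ha b hb iha ihb =>
    have := σ.character_add s ⟨a, ha⟩ ⟨b, hb⟩
    exact this.trans_ne (mul_ne_zero iha ihb)

/-- An affine toric variety which is regular at a point has coordinates there. -/
theorem RationalCone.exists_coordinates_of_isRegularCompletion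
    (hreg : IsRegularCompletion k (CompletedStalk (σ.toricVariety k).left s))
    (hev : ∀ a, ev a = 0 ↔ a ∈ PrimeSpectrum.asIdeal s)
    (hred : ∀ a : σ.dualMonoid, AddMonoidAlgebra.single a (1 : k) ∉ PrimeSpectrum.asIdeal s →
        -(a : Fin n → ℤ) ∈ σ.dualMonoid) :
    ∃ (ι : Type) (_ : Fintype ι) (_ : DecidableEq ι), Nonempty (σ.Coordinates ι) := by
  have := hreg.isDomain
  have := hreg.isNoetherianRing
  refine σ.exists_coordinates fun p hp => ?_
  have hprime := hp.prime_character hreg hev hred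
  have hfin (a : σ.dualMonoid) : FiniteMultiplicity (σ.character s ⟨p, hp.mem⟩) (σ.character s a) :=
    FiniteMultiplicity.of_prime_left hprime (character_ne_zero hreg hev hred a)
  -- The order along the prime χ^p is finite in a noetherian domain and additive on characters; it
  -- is the functional dual to p.
  let μ : σ.dualMonoid →+ ℕ :=
    { toFun a := multiplicity (σ.character s ⟨p, hp.mem⟩) (σ.character s a)
      map_zero' := by
        rw [character_zero, multiplicity_eq_zero]
        exact fun h => hprime.not_isUnit (isUnit_of_dvd_one h)
      map_add' a b := by
        have := hfin (a + b)
        rw [character_add] at this ⊢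
        exact multiplicity_mul hprime this }
  obtain ⟨e, he⟩ := σ.exists_dotProduct_eq μ
  refine ⟨e, fun m hm => ?_, ?_, fun q hq hne => ?_⟩
  · rw [he ⟨m, hm⟩]
    positivity
  · rw [he ⟨p, hp.mem⟩]
    have : μ ⟨p, hp.mem⟩ = 1 := multiplicity_self
    rw [this, Nat.cast_one]
  · rw [he ⟨q, hq.mem⟩, Nat.cast_ne_zero] at hne
    refine hp.sub_mem_of_dvd hev hred hq ?_
    by_contra h
    exact hne (multiplicity_eq_zero.mpr h)

end CompletedCharacters

/-! ### Coordinate functions and the toric boundary. -/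

section CoordinateCharacters

variable {n : ℕ} {σ : RationalCone n} {ι : Type} [Fintype ι] [DecidableEq ι]

theorem RationalCone.Coordinates.p_mem (C : σ.Coordinates ι) (i : ι) : C.p i ∈ σ.dualMonoid :=
  (C.mem_iff _).mpr fun j => by
    rw [C.e_dotProduct_p]
    split_ifs <;> norm_num

theorem RationalCone.Coordinates.e_dotProduct_sum (C : σ.Coordinates ι) (s : Finset ι)
    (c : ι → ℤ) (i : ι) : C.e i ⬝ᵥ ∑ j ∈ s, c j • C.p j = if i ∈ s then c i else 0 := by
  simp only [dotProduct_sum, dotProduct_smul, C.e_dotProduct_p, smul_eq_mul, mul_ite, mul_one,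
    mul_zero, Finset.sum_ite_eq]

theorem RationalCone.Coordinates.e_dotProduct_sum_p (C : σ.Coordinates ι) (s : Finset ι) (i : ι) :
    C.e i ⬝ᵥ ∑ j ∈ s, C.p j = if i ∈ s then 1 else 0 := by
  simpa using C.e_dotProduct_sum s 1 i

theorem RationalCone.Coordinates.nonneg (C : σ.Coordinates ι) (m : σ.dualMonoid) (i : ι) :
    0 ≤ C.e i ⬝ᵥ (m : Fin n → ℤ) :=
  (C.mem_iff _).mp m.2 i

theorem RationalCone.Coordinates.isIrreducible (C : σ.Coordinates ι) (i : ι) :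
    σ.IsIrreducible (C.p i) where
  mem := C.p_mem i
  neg_notMem h := by
    have := (C.mem_iff _).mp h i
    rw [dotProduct_neg, C.e_dotProduct_p, if_pos rfl] at this
    omega
  neg_mem_or a ha b hb hab := by
    by_contra! h
    rw [C.mem_iff, C.mem_iff] at h
    push Not at h
    obtain ⟨⟨j, hj⟩, l, hl⟩ := h
    have hsum (j : ι) : C.e j ⬝ᵥ a + C.e j ⬝ᵥ b = if j = i then 1 else 0 := by
      rw [← dotProduct_add, hab, C.e_dotProduct_p]
    have h1 := (C.mem_iff a).mp ha
    have h2 := (C.mem_iff b).mp hb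
    rw [dotProduct_neg] at hj hl
    have hji : j = i := by
      by_contra hne
      have h3 := hsum j
      rw [if_neg hne] at h3
      have := h1 j
      have := h2 j
      omega
    have hli : l = i := by
      by_contra hne
      have h3 := hsum l
      rw [if_neg hne] at h3
      have := h1 l
      have := h2 l
      omega
    rw [hji] at hj
    rw [hli] at hl
    have h3 := hsum i
    rw [if_pos rfl] at h3
    omega

/-- A lattice point in the interior of the dual cone. -/
def RationalCone.Coordinates.interior (C : σ.Coordinates ι) : σ.dualMonoid :=
  ⟨∑ i, C.p i, sum_mem fun i _ => C.p_mem i⟩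

theorem RationalCone.Coordinates.e_dotProduct_interior (C : σ.Coordinates ι) (i : ι) :
    C.e i ⬝ᵥ (C.interior : Fin n → ℤ) = 1 :=
  (C.e_dotProduct_sum_p Finset.univ i).trans (if_pos (Finset.mem_univ i))

variable {k : Type u} [Field k]

theorem RationalCone.Coordinates.torus_eq (C : σ.Coordinates ι) :
    σ.torus k = {q : Spec (.of (σ.ring k)) |
      AddMonoidAlgebra.single C.interior (1 : k) ∉ PrimeSpectrum.asIdeal q} := by
  obtain ⟨V, hV⟩ := σ.exists_isGeneratedBy
  refine hV.torus_eq _ fun v hv hv0 =>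
    (hV.mem_dualMonoid_iff.mp C.interior.2 v hv).lt_of_ne fun h => hv0 ?_
  -- A generator killed by all p i is zero, since the p i span the lattice modulo invertible points,
  -- on which v also vanishes.
  have hpv (i : ι) : C.p i ⬝ᵥ v = 0 := by
    have h1 : ∑ i, C.p i ⬝ᵥ v = 0 := by
      rw [← sum_dotProduct]
      exact h.symm
    exact (Finset.sum_eq_zero_iff_of_nonneg fun i _ =>
      hV.mem_dualMonoid_iff.mp (C.p_mem i) v hv).mp h1 i (Finset.mem_univ i)
  refine σ.ext_dotProduct fun m _ => ?_
  have hunit (c : ℤ) : c • (m - ∑ i, (C.e i ⬝ᵥ m) • C.p i) ∈ σ.dualMonoid := by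
    refine (C.mem_iff _).mpr fun i => ?_
    rw [dotProduct_smul, dotProduct_sub, C.e_dotProduct_sum, if_pos (Finset.mem_univ i), sub_self,
      smul_zero]
  have h1 := RationalCone.dotProduct_eq_zero_of_neg_mem (σ := σ) (e := v) (fun m hm => by
    rw [dotProduct_comm]
    exact hV.mem_dualMonoid_iff.mp hm v hv) (one_smul ℤ (m - ∑ i, (C.e i ⬝ᵥ m) • C.p i) ▸ hunit 1)
    (neg_one_smul ℤ (m - ∑ i, (C.e i ⬝ᵥ m) • C.p i) ▸ hunit (-1))
  rw [dotProduct_sub, dotProduct_sum, sub_eq_zero] at h1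
  rw [h1, zero_dotProduct]
  refine Finset.sum_eq_zero fun i _ => ?_
  rw [dotProduct_smul, dotProduct_comm v, hpv, smul_zero]

/-- The affine toric variety of `σ` is regular at `s`, the point `s` is rational, and `σ` is the
smallest cone with `s` in its affine toric variety. -/
structure RationalCone.IsRegularAt (σ : RationalCone n) (s : (σ.toricVariety k).left) : Prop where
  isRegularCompletion : IsRegularCompletion k (CompletedStalk (σ.toricVariety k).left s)
  exists_ev : ∃ ev : σ.ring k →ₐ[k] k, ∀ a, ev a = 0 ↔ a ∈ PrimeSpectrum.asIdeal s
  neg_mem : ∀ a : σ.dualMonoid, AddMonoidAlgebra.single a (1 : k) ∉ PrimeSpectrum.asIdeal s →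
    -(a : Fin n → ℤ) ∈ σ.dualMonoid

variable {s : (σ.toricVariety k).left}

theorem RationalCone.IsRegularAt.exists_coordinates (h : σ.IsRegularAt s) :
    ∃ (ι : Type) (_ : Fintype ι) (_ : DecidableEq ι), Nonempty (σ.Coordinates ι) := by
  obtain ⟨ev, hev⟩ := h.exists_ev
  exact exists_coordinates_of_isRegularCompletion h.isRegularCompletion hev h.neg_mem

/-- The coordinate functions in the completed local ring. -/
noncomputable def RationalCone.Coordinates.x (C : σ.Coordinates ι) (s : (σ.toricVariety k).left)
    (i : ι) : CompletedStalk (σ.toricVariety k).left s :=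
  σ.character s ⟨C.p i, C.p_mem i⟩

theorem RationalCone.Coordinates.prime_x (C : σ.Coordinates ι) (h : σ.IsRegularAt s) (i : ι) :
    Prime (C.x s i) := by
  obtain ⟨ev, hev⟩ := h.exists_ev
  exact (C.isIrreducible i).prime_character h.isRegularCompletion hev h.neg_mem

theorem RationalCone.Coordinates.eq_of_x_dvd (C : σ.Coordinates ι) (h : σ.IsRegularAt s)
    {i j : ι} (hij : C.x s i ∣ C.x s j) : i = j := by
  obtain ⟨ev, hev⟩ := h.exists_ev
  obtain ⟨h1, -⟩ := (C.isIrreducible i).sub_mem_of_dvd hev h.neg_mem (C.isIrreducible j) hij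
  have h2 := (C.mem_iff _).mp h1 j
  rw [dotProduct_sub, C.e_dotProduct_p, C.e_dotProduct_p, if_pos rfl] at h2
  by_contra hne
  rw [if_neg (Ne.symm hne)] at h2
  omega

theorem RationalCone.character_dvd {a b : σ.dualMonoid} (s : (σ.toricVariety k).left)
    (h : (b : Fin n → ℤ) - a ∈ σ.dualMonoid) : σ.character s a ∣ σ.character s b := by
  refine ⟨σ.character s ⟨_, h⟩, ?_⟩
  rw [← character_add]
  congr 1
  exact Subtype.ext (add_sub_cancel _ _).symm

theorem RationalCone.Coordinates.x_dvd_character (C : σ.Coordinates ι)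
    (s : (σ.toricVariety k).left) (m : σ.dualMonoid) {i : ι}
    (hi : 0 < C.e i ⬝ᵥ (m : Fin n → ℤ)) : C.x s i ∣ σ.character s m := by
  refine character_dvd s ((C.mem_iff _).mpr fun j => ?_)
  have := C.nonneg m j
  rw [dotProduct_sub, C.e_dotProduct_p]
  split_ifs with hij
  · rw [hij]
    omega
  · omega

theorem RationalCone.character_sum {κ : Type*} (s : (σ.toricVariety k).left) (S : Finset κ)
    (a : κ → σ.dualMonoid) : σ.character s (∑ i ∈ S, a i) = ∏ i ∈ S, σ.character s (a i) := by
  classical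
  induction S using Finset.induction_on with
  | empty => exact character_zero s
  | insert i S hi ih => rw [Finset.sum_insert hi, Finset.prod_insert hi, character_add, ih]

theorem RationalCone.character_nsmul (s : (σ.toricVariety k).left) (N : ℕ) (a : σ.dualMonoid) :
    σ.character s (N • a) = σ.character s a ^ N := by
  rw [← Finset.card_range N, ← Finset.sum_const, character_sum, Finset.prod_const]

theorem RationalCone.Coordinates.exists_nsmul_sub_mem (C : σ.Coordinates ι) (m : σ.dualMonoid) :
    ∃ N : ℕ, N • (∑ i with 0 < C.e i ⬝ᵥ (m : Fin n → ℤ), C.p i) - (m : Fin n → ℤ) ∈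
      σ.dualMonoid := by
  refine ⟨∑ i, (C.e i ⬝ᵥ (m : Fin n → ℤ)).toNat, (C.mem_iff _).mpr fun i => ?_⟩
  have h0 := C.nonneg m i
  rw [dotProduct_sub, dotProduct_smul, C.e_dotProduct_sum_p]
  simp only [Finset.mem_filter_univ]
  split_ifs with hi
  · have : (C.e i ⬝ᵥ (m : Fin n → ℤ)).toNat ≤ ∑ i, (C.e i ⬝ᵥ (m : Fin n → ℤ)).toNat :=
      Finset.single_le_sum (f := fun i => (C.e i ⬝ᵥ (m : Fin n → ℤ)).toNat)
        (fun _ _ => Nat.zero_le _) (Finset.mem_univ i)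
    rw [nsmul_one]
    omega
  · rw [smul_zero]
    omega

theorem RationalCone.Coordinates.exists_character_dvd_prod_pow (C : σ.Coordinates ι)
    (s : (σ.toricVariety k).left) (m : σ.dualMonoid) :
    ∃ N : ℕ, σ.character s m ∣ (∏ i with 0 < C.e i ⬝ᵥ (m : Fin n → ℤ), C.x s i) ^ N := by
  obtain ⟨N, hN⟩ := C.exists_nsmul_sub_mem m
  refine ⟨N, ?_⟩
  unfold x
  rw [← character_sum, ← character_nsmul]
  refine character_dvd s ?_
  convert hN
  simp

/-- The ideal of the zero locus of a character in a completed local ring. -/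
theorem RationalCone.Coordinates.completedIdeal_eq (C : σ.Coordinates ι) (h : σ.IsRegularAt s)
    (m : σ.dualMonoid) :
    completedIdeal (σ.toricVariety k).left {q : Spec (.of (σ.ring k)) |
      AddMonoidAlgebra.single m (1 : k) ∈ PrimeSpectrum.asIdeal q} s =
      Ideal.span {∏ i with 0 < C.e i ⬝ᵥ (m : Fin n → ℤ), C.x s i} := by
  have := h.isRegularCompletion.isDomain
  rw [completedIdeal, RationalCone.stalkIdeal_setOf_mem]
  refine le_antisymm ?_ ?_
  · refine map_radical_le_span_prod _ _ (fun i _ => C.prime_x h i)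
      (fun i _ j _ => C.eq_of_x_dvd h) fun i hi a ha => ?_
    obtain ⟨c, rfl⟩ := Ideal.mem_span_singleton.mp ha
    rw [map_mul]
    exact (C.x_dvd_character s m ((Finset.mem_filter_univ i).mp hi)).mul_right _
  · obtain ⟨N, hN⟩ := C.exists_nsmul_sub_mem m
    -- The product of the x i is itself a character, so its membership in the radical is checked
    -- before completing.
    let q : σ.dualMonoid := ∑ i with 0 < C.e i ⬝ᵥ (m : Fin n → ℤ), ⟨C.p i, C.p_mem i⟩
    rw [Ideal.span_singleton_le_iff_mem]
    have hq : ∏ i with 0 < C.e i ⬝ᵥ (m : Fin n → ℤ), C.x s i = σ.character s q :=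
      (character_sum s _ _).symm
    rw [hq]
    refine Ideal.mem_map_of_mem (algebraMap ((σ.toricVariety k).left.presheaf.stalk s) _)
      ⟨N, Ideal.mem_span_singleton.mpr ⟨σ.toStalk s
        (AddMonoidAlgebra.single ⟨_, hN⟩ 1), ?_⟩⟩
    rw [← map_pow, ← map_mul, AddMonoidAlgebra.single_mul_single, AddMonoidAlgebra.single_pow,
      one_pow, one_mul]
    congr 2
    refine Subtype.ext ?_
    simp [q]

theorem RationalCone.Coordinates.completedIdeal_torus_compl (C : σ.Coordinates ι)
    (h : σ.IsRegularAt s) :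
    completedIdeal (σ.toricVariety k).left (σ.torus k)ᶜ s = Ideal.span {∏ i, C.x s i} := by
  have h1 := C.completedIdeal_eq h C.interior
  simp only [C.e_dotProduct_interior, zero_lt_one, Finset.filter_true] at h1
  rw [← h1, C.torus_eq]
  congr 1
  ext q
  exact not_not

end CoordinateCharacters

/-! ### Local models at nonsingular points. -/

section RegularLocalModels

variable {k : Type u} [Field k]

theorem ConeHom.stalkMap_toStalk {n m : ℕ} {σ : RationalCone n} {τ : RationalCone m}
    (g : ConeHom σ τ) (s : (σ.toricVariety k).left) (a : τ.ring k) :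
    ((g.toricMap k).left.stalkMap s).hom (τ.toStalk ((g.toricMap k).left s) a) =
      σ.toStalk s (AddMonoidAlgebra.mapDomainRingHom k g.dualMap a) :=
  congr($(AlgebraicGeometry.stalkMap_toStalk
    (CommRingCat.ofHom (AddMonoidAlgebra.mapDomainRingHom k g.dualMap)) s) a)

theorem ConeHom.completedStalkMap_character {n m : ℕ} {σ : RationalCone n} {τ : RationalCone m}
    (g : ConeHom σ τ) (s : (σ.toricVariety k).left) (a : τ.dualMonoid) :
    completedStalkMap (g.toricMap k).left s (τ.character ((g.toricMap k).left s) a) =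
      σ.character s (g.dualMap a) := by
  rw [RationalCone.character, RationalCone.toCompletedStalk, RingHom.comp_apply,
    completedStalkMap_algebraMap, g.stalkMap_toStalk, AddMonoidAlgebra.mapDomainRingHom_apply,
    AddMonoidAlgebra.mapDomain_single]
  rfl

/-- The residue field of `X` at `x` is `k`. -/
def IsRationalPoint (X : Over (Spec (.of k))) (x : X.left) : Prop :=
  ∀ a : X.left.presheaf.stalk x, ∃ c : k, a - stalkScalars X x c ∈ maximalIdeal _

theorem IsRationalPoint.map {X B : Over (Spec (.of k))} (f : X ⟶ B) {x : X.left}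
    (hx : IsRationalPoint X x) : IsRationalPoint B (f.left x) := by
  intro a
  obtain ⟨c, hc⟩ := hx ((f.left.stalkMap x).hom a)
  refine ⟨c, fun hunit => hc ?_⟩
  have := hunit.map (f.left.stalkMap x).hom
  rwa [map_sub, stalkMap_stalkScalars] at this

theorem IsRationalPoint.exists_not_isUnit {X : Over (Spec (.of k))} {x : X.left}
    (hx : IsRationalPoint X x) (z : CompletedStalk X.left x) :
    ∃ c : k, ¬ IsUnit (z - scalars X x c) := by
  obtain ⟨r, hr⟩ := Ideal.Quotient.mk_surjective (AdicCompletion.evalₐ (maximalIdeal _) 1 z)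
  obtain ⟨c, hc⟩ := hx r
  refine ⟨c, fun hunit => ?_⟩
  have h1 : AdicCompletion.evalₐ (maximalIdeal (X.left.presheaf.stalk x)) 1
      (z - scalars X x c) = 0 := by
    rw [map_sub, scalars_apply, evalₐ_algebraMap, ← hr, ← map_sub, Ideal.Quotient.eq_zero_iff_mem,
      pow_one]
    exact hc
  have h2 := hunit.map (AdicCompletion.evalₐ (maximalIdeal (X.left.presheaf.stalk x)) 1)
  rw [h1] at h2
  have : Nontrivial (X.left.presheaf.stalk x ⧸ maximalIdeal (X.left.presheaf.stalk x) ^ 1) :=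
    Ideal.Quotient.nontrivial_iff.mpr (by rw [pow_one]; exact Ideal.IsPrime.ne_top')
  exact not_isUnit_zero h2

theorem IsRationalPoint.isRegularCompletion [Infinite k] {X : Over (Spec (.of k))} {x : X.left}
    (hx : IsRationalPoint X x) (hreg : IsRegularLocalRing (X.left.presheaf.stalk x)) :
    IsRegularCompletion k (CompletedStalk X.left x) := by
  let := (stalkScalars X x).toAlgebra
  exact isRegularCompletion_of_isRegularLocalRing hx

variable {X : Over (Spec (.of k))} {U : X.left.Opens} {x : X.left} {n : ℕ} {σ : RationalCone n}
  {s : (σ.toricVariety k).left}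

theorem LocalModel.isRegularAt [Infinite k] (φ : LocalModel X U x σ s) (hx : IsRationalPoint X x)
    (hreg : IsRegularLocalRing (X.left.presheaf.stalk x))
    (hred : ∀ a : σ.dualMonoid, AddMonoidAlgebra.single a (1 : k) ∉ PrimeSpectrum.asIdeal s →
      -(a : Fin n → ℤ) ∈ σ.dualMonoid) : σ.IsRegularAt s where
  isRegularCompletion := (hx.isRegularCompletion hreg).of_ringEquiv φ.iso
  exists_ev := σ.exists_algHom_ker_eq s fun y => by
    obtain ⟨c, hc⟩ := hx.exists_not_isUnit (φ.iso.symm y)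
    refine ⟨c, fun hunit => hc ?_⟩
    have := hunit.map φ.iso.symm
    rwa [map_sub, ← φ.iso_scalars, RingEquiv.symm_apply_apply] at this
  neg_mem := hred

theorem LocalModel.exists_face (φ : LocalModel X U x σ s) :
    ∃ (γ : RationalCone n) (s' : (γ.toricVariety k).left),
      (∀ a : γ.dualMonoid, AddMonoidAlgebra.single a (1 : k) ∉ PrimeSpectrum.asIdeal s' →
        -(a : Fin n → ℤ) ∈ γ.dualMonoid) ∧ Nonempty (LocalModel X U x γ s') := by
  obtain ⟨γ, h, s', hopen, rfl, htorus, hred⟩ := σ.exists_face s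
  exact ⟨γ, s', hred, ⟨φ.restrict _ s' U (σ.torus k) htorus φ.map_ideal⟩⟩

theorem faithfullyFlat_adicCompletion {R : Type*} [CommRing R] [IsLocalRing R]
    [IsNoetherianRing R] : Module.FaithfullyFlat R (AdicCompletion (maximalIdeal R) R) :=
  Module.FaithfullyFlat.of_flat_of_isLocalHom

theorem LocalModel.exists_stalkIdeal_eq_span_of_isRegularAt
    (φ : LocalModel X U x σ s) (hreg : IsRegularLocalRing (X.left.presheaf.stalk x))
    (hs : σ.IsRegularAt s) {ι : Type} [Fintype ι] [DecidableEq ι] (C : σ.Coordinates ι) :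
    ∃ h, stalkIdeal X.left (U : Set X.left)ᶜ x = Ideal.span {h} ∧
      Ideal.span {algebraMap _ (CompletedStalk X.left x) h} =
        Ideal.span {∏ i, φ.iso.symm (C.x s i)} := by
  have := faithfullyFlat_adicCompletion (R := X.left.presheaf.stalk x)
  refine exists_eq_span_of_map_eq_span ?_
  have h := φ.map_ideal
  rw [C.completedIdeal_torus_compl hs] at h
  have h2 := congrArg (Ideal.map φ.iso.symm) h
  rw [Ideal.map_span, Set.image_singleton, map_prod, Ideal.map_symm, Ideal.comap_map_of_bijective]
    at h2
  · exact h2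
  · exact φ.iso.bijective

/-- The conclusion does not mention the model, so σ may be replaced by the face adapted to the
point, where the boundary has the equation ∏ x i. -/
theorem LocalModel.exists_stalkIdeal_eq_span [Infinite k] (φ : LocalModel X U x σ s)
    (hx : IsRationalPoint X x) (hreg : IsRegularLocalRing (X.left.presheaf.stalk x)) :
    ∃ h, stalkIdeal X.left (U : Set X.left)ᶜ x = Ideal.span {h} := by
  obtain ⟨γ, s', hred, ⟨φ'⟩⟩ := φ.exists_face
  have hs := φ'.isRegularAt hx hreg hred
  obtain ⟨ι, _, _, ⟨C⟩⟩ := hs.exists_coordinates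
  obtain ⟨h, hh, -⟩ := φ'.exists_stalkIdeal_eq_span_of_isRegularAt hreg hs C
  exact ⟨h, hh⟩

/-- Besides cutting out the boundary, an interior character has a power divisible by any given
character. -/
theorem RationalCone.exists_torus_eq (σ : RationalCone n) : ∃ m₀ : σ.dualMonoid,
    (σ.torus k = {q : Spec (.of (σ.ring k)) |
      AddMonoidAlgebra.single m₀ (1 : k) ∉ PrimeSpectrum.asIdeal q}) ∧
    ∀ m : σ.dualMonoid, ∃ N : ℕ, N • (m₀ : Fin n → ℤ) - m ∈ σ.dualMonoid := by
  obtain ⟨V, hV⟩ := σ.exists_isGeneratedBy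
  obtain ⟨m₀, hm₀⟩ := hV.exists_dotProduct_pos
  have h0 : ∀ v ∈ V, 0 ≤ m₀ ⬝ᵥ v := fun v hv => by
    by_cases hv0 : v = 0
    · simp [hv0]
    · exact (hm₀ v hv hv0).le
  refine ⟨⟨m₀, hV.mem_dualMonoid_iff.mpr h0⟩, hV.torus_eq _ hm₀, fun m => ?_⟩
  obtain ⟨N, hN⟩ := hV.exists_add_nsmul_mem h0 (-m) fun v hv h => by
    by_cases hv0 : v = 0
    · simp [hv0]
    · exact absurd h (hm₀ v hv hv0).ne'
  refine ⟨N, ?_⟩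
  rwa [neg_add_eq_sub] at hN

end RegularLocalModels

/-! ### The ideal of the preimage of the boundary. -/

section Preimage

variable {k : Type u} [Field k] [Infinite k] {X B : Over (Spec (.of k))} {UX : X.left.Opens}
  {UB : B.left.Opens} {f : X ⟶ B} {x : X.left} {n m : ℕ} {σ : RationalCone n}
  {τ : RationalCone m} {g : ConeHom σ τ} {s : (σ.toricVariety k).left}

/-- The ideal of the preimage of the boundary of `B` corresponds to the ideal of the preimage of
the toric boundary. -/
theorem map_completedIdeal_preimage (φ : LocalModel X UX x σ s)
    (ψ : LocalModel B UB (f.left x) τ ((g.toricMap k).left s))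
    (hcomp : ∀ a, φ.iso (completedStalkMap f.left x a) =
      completedStalkMap (g.toricMap k).left s (ψ.iso a))
    (hx : IsRationalPoint X x) (hregX : IsRegularLocalRing (X.left.presheaf.stalk x))
    (hregB : IsRegularLocalRing (B.left.presheaf.stalk (f.left x))) (hs : σ.IsRegularAt s)
    {ι : Type} [Fintype ι] [DecidableEq ι] (C : σ.Coordinates ι) :
    (completedIdeal X.left ((f.left ⁻¹ᵁ UB : X.left.Opens) : Set X.left)ᶜ x).map φ.iso =
      completedIdeal (σ.toricVariety k).left ((g.toricMap k).left ⁻¹' τ.torus k)ᶜ s := by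
  have := (hx.isRegularCompletion hregX).isDomain
  have := faithfullyFlat_adicCompletion (R := X.left.presheaf.stalk x)
  obtain ⟨hB, hhB⟩ := ψ.exists_stalkIdeal_eq_span (hx.map f) hregB
  obtain ⟨h, -, hh⟩ := φ.exists_stalkIdeal_eq_span_of_isRegularAt hregX hs C
  obtain ⟨m₀, hm₀, -⟩ := τ.exists_torus_eq (k := k)
  have hpre : ((g.toricMap k).left ⁻¹' τ.torus k)ᶜ = {q : Spec (.of (σ.ring k)) |
      AddMonoidAlgebra.single (g.dualMap m₀) (1 : k) ∈ PrimeSpectrum.asIdeal q} := by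
    rw [hm₀]
    ext q
    exact not_not.trans (g.single_mem_toricMap q m₀)
  rw [(congrArg (completedIdeal (σ.toricVariety k).left · s) hpre).trans (C.completedIdeal_eq hs _)]
  set s₁ := Finset.univ.filter fun i => 0 < C.e i ⬝ᵥ (g.dualMap m₀ : Fin n → ℤ) with hs₁
  have hprime (i : ι) : Prime (φ.iso.symm (C.x s i)) :=
    (MulEquiv.prime_iff φ.iso.symm.toMulEquiv).mpr (C.prime_x hs i)
  -- τ is not assumed adapted to the image point, so its boundary ideal is kept as the extension of
  -- a radical instead of a product of coordinates.
  have htorus : completedIdeal (τ.toricVariety k).left (τ.torus k)ᶜ ((g.toricMap k).left s) =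
      (Ideal.span {τ.toStalk ((g.toricMap k).left s) (AddMonoidAlgebra.single m₀ 1)}).radical.map
        (algebraMap _ (CompletedStalk (τ.toricVariety k).left ((g.toricMap k).left s))) := by
    rw [← RationalCone.stalkIdeal_setOf_mem, hm₀, completedIdeal]
    congr 2
    ext q
    exact not_not
  have hmapψ := ψ.map_ideal
  rw [completedIdeal, hhB, Ideal.map_span, Set.image_singleton, Ideal.map_span,
    Set.image_singleton, htorus] at hmapψ
  set b := (f.left.stalkMap x).hom hB with hb
  have hφb : φ.iso (algebraMap _ (CompletedStalk X.left x) b) =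
      completedStalkMap (g.toricMap k).left s (ψ.iso (algebraMap _ _ hB)) := by
    rw [← hcomp, completedStalkMap_algebraMap]
  have hideal : stalkIdeal X.left ((f.left ⁻¹ᵁ UB : X.left.Opens) : Set X.left)ᶜ x =
      (Ideal.span {b}).radical := by
    have := stalkIdeal_preimage f.left x UB.isOpen.isClosed_compl
    rw [hhB, Ideal.map_span, Set.image_singleton] at this
    exact this
  -- The pulled-back equation b of the boundary of B has exactly the primes x i with i ∈ s₁: it lies
  -- in the extension of the radical of χ^{m₀}, so each of these divides it, and it divides the
  -- pullback of χ^{m₀}, hence a power of their product.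
  have key := map_radical_eq_span_prod (R' := CompletedStalk X.left x)
    (fun i => φ.iso.symm (C.x s i)) hprime
    (fun i j hij => C.eq_of_x_dvd hs ((map_dvd_iff φ.iso.symm).mp hij)) h b hh s₁
    (fun i hi => by
      rw [← map_dvd_iff φ.iso, RingEquiv.apply_symm_apply, hφb]
      have hle : (Ideal.span {τ.toStalk ((g.toricMap k).left s)
          (AddMonoidAlgebra.single m₀ 1)}).radical.map (algebraMap _ (CompletedStalk
            (τ.toricVariety k).left ((g.toricMap k).left s))) ≤
          (Ideal.span {C.x s i}).comap (completedStalkMap (g.toricMap k).left s) := by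
        rw [Ideal.map_le_iff_le_comap]
        rintro a ⟨N, ha⟩
        obtain ⟨c, hc⟩ := Ideal.mem_span_singleton.mp ha
        rw [Ideal.mem_comap, Ideal.mem_comap, Ideal.mem_span_singleton]
        refine (C.prime_x hs i).dvd_of_dvd_pow (n := N) ?_
        rw [← map_pow, ← map_pow, hc, map_mul, map_mul]
        refine Dvd.dvd.mul_right ?_ _
        have := C.x_dvd_character s (g.dualMap m₀) ((Finset.mem_filter_univ i).mp hi)
        rwa [← g.completedStalkMap_character] at this
      have hmem := hle (hmapψ ▸ Ideal.mem_span_singleton_self _)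
      exact Ideal.mem_span_singleton.mp hmem)
    (by
      obtain ⟨N, hN⟩ := C.exists_character_dvd_prod_pow s (g.dualMap m₀)
      refine ⟨N, ?_⟩
      rw [← map_dvd_iff φ.iso, map_pow, map_prod]
      simp only [RingEquiv.apply_symm_apply]
      refine dvd_trans ?_ hN
      rw [hφb, ← g.completedStalkMap_character]
      refine map_dvd _ (Ideal.mem_span_singleton.mp ?_)
      rw [hmapψ]
      exact Ideal.mem_map_of_mem _ (Ideal.le_radical (Ideal.mem_span_singleton_self _)))
  rw [completedIdeal, hideal, key, Ideal.map_span, Set.image_singleton, map_prod]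
  simp only [RingEquiv.apply_symm_apply]

end Preimage

/-! ### Translating coordinates. -/

section Shift

variable {k : Type u} [Field k] {n m : ℕ} {σ : RationalCone n} {ι : Type} [Fintype ι]
  [DecidableEq ι] (C : σ.Coordinates ι)

/-- The part of a lattice point which does not involve the coordinates in `s`. -/
def RationalCone.Coordinates.proj (s : Finset ι) (a : σ.dualMonoid) : σ.dualMonoid :=
  ⟨(a : Fin n → ℤ) - ∑ i ∈ s, (C.e i ⬝ᵥ (a : Fin n → ℤ)) • C.p i, (C.mem_iff _).mpr fun i => by
    rw [dotProduct_sub, C.e_dotProduct_sum]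
    have := C.nonneg a i
    split_ifs <;> omega⟩

theorem RationalCone.Coordinates.proj_add (s : Finset ι) (a b : σ.dualMonoid) :
    C.proj s (a + b) = C.proj s a + C.proj s b := by
  refine Subtype.ext ?_
  change (a : Fin n → ℤ) + b - ∑ i ∈ s, (C.e i ⬝ᵥ ((a : Fin n → ℤ) + b)) • C.p i =
    ((a : Fin n → ℤ) - ∑ i ∈ s, (C.e i ⬝ᵥ (a : Fin n → ℤ)) • C.p i) +
      ((b : Fin n → ℤ) - ∑ i ∈ s, (C.e i ⬝ᵥ (b : Fin n → ℤ)) • C.p i)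
  simp only [dotProduct_add, add_smul, Finset.sum_add_distrib]
  abel

theorem RationalCone.Coordinates.proj_eq_self (s : Finset ι) (a : σ.dualMonoid)
    (ha : ∀ i ∈ s, C.e i ⬝ᵥ (a : Fin n → ℤ) = 0) : C.proj s a = a := by
  refine Subtype.ext ?_
  change (a : Fin n → ℤ) - ∑ i ∈ s, (C.e i ⬝ᵥ (a : Fin n → ℤ)) • C.p i = a
  rw [Finset.sum_eq_zero fun i hi => by rw [ha i hi, zero_smul], sub_zero]

theorem RationalCone.Coordinates.proj_p (s : Finset ι) {i : ι} (hi : i ∈ s) :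
    C.proj s ⟨C.p i, C.p_mem i⟩ = 0 := by
  refine Subtype.ext ?_
  change C.p i - ∑ j ∈ s, (C.e j ⬝ᵥ C.p i) • C.p j = 0
  rw [Finset.sum_eq_single i]
  · rw [C.e_dotProduct_p, if_pos rfl, one_smul, sub_self]
  · intro j _ hj
    rw [C.e_dotProduct_p, if_neg hj, zero_smul]
  · exact fun h => absurd hi h

theorem RationalCone.Coordinates.e_dotProduct_proj (s : Finset ι) (a : σ.dualMonoid) {i : ι}
    (hi : i ∈ s) : C.e i ⬝ᵥ (C.proj s a : Fin n → ℤ) = 0 := by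
  change C.e i ⬝ᵥ ((a : Fin n → ℤ) - ∑ i ∈ s, (C.e i ⬝ᵥ (a : Fin n → ℤ)) • C.p i) = 0
  rw [dotProduct_sub, C.e_dotProduct_sum, if_pos hi, sub_self]

/-- Separates the coordinates in s, the only factors that a shift changes. -/
theorem RationalCone.Coordinates.single_eq (s : Finset ι) (a : σ.dualMonoid) :
    AddMonoidAlgebra.single a (1 : k) = AddMonoidAlgebra.single (C.proj s a) 1 *
      ∏ i ∈ s, AddMonoidAlgebra.single (⟨C.p i, C.p_mem i⟩ : σ.dualMonoid) (1 : k) ^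
        (C.e i ⬝ᵥ (a : Fin n → ℤ)).toNat := by
  have h (s : Finset ι) : ∏ i ∈ s, AddMonoidAlgebra.single
      (⟨C.p i, C.p_mem i⟩ : σ.dualMonoid) (1 : k) ^ (C.e i ⬝ᵥ (a : Fin n → ℤ)).toNat =
      AddMonoidAlgebra.single (∑ i ∈ s, (C.e i ⬝ᵥ (a : Fin n → ℤ)).toNat •
        (⟨C.p i, C.p_mem i⟩ : σ.dualMonoid)) 1 := by
    induction s using Finset.induction_on with
    | empty => rfl
    | insert i s hi ih =>
      rw [Finset.prod_insert hi, Finset.sum_insert hi, ih, AddMonoidAlgebra.single_pow, one_pow,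
        AddMonoidAlgebra.single_mul_single, one_mul]
  rw [h, AddMonoidAlgebra.single_mul_single, one_mul]
  congr 1
  refine Subtype.ext ?_
  rw [AddSubmonoid.coe_add, AddSubmonoid.coe_finsetSum]
  change _ = (a : Fin n → ℤ) - ∑ i ∈ s, (C.e i ⬝ᵥ (a : Fin n → ℤ)) • C.p i +
    ∑ i ∈ s, (C.e i ⬝ᵥ (a : Fin n → ℤ)).toNat • C.p i
  have : ∑ i ∈ s, (C.e i ⬝ᵥ (a : Fin n → ℤ)).toNat • C.p i =
      ∑ i ∈ s, (C.e i ⬝ᵥ (a : Fin n → ℤ)) • C.p i := Finset.sum_congr rfl fun i _ => by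
    rw [← natCast_zsmul, Int.toNat_of_nonneg (C.nonneg a i)]
  rw [this, sub_add_cancel]

/-- The endomorphism of the coordinate ring which adds the constant `c` to the coordinates
in `s`. -/
noncomputable def RationalCone.Coordinates.shift (s : Finset ι) (c : k) :
    σ.ring k →ₐ[k] σ.ring k :=
  AddMonoidAlgebra.lift k (σ.ring k) σ.dualMonoid
    { toFun a := AddMonoidAlgebra.single (C.proj s a.toAdd) 1 *
        ∏ i ∈ s, (AddMonoidAlgebra.single (⟨C.p i, C.p_mem i⟩ : σ.dualMonoid) (1 : k) +
          algebraMap k _ c) ^ (C.e i ⬝ᵥ (a.toAdd : Fin n → ℤ)).toNat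
      map_one' := by
        rw [toAdd_one, C.proj_eq_self s 0 fun i _ => dotProduct_zero _]
        simp only [ZeroMemClass.coe_zero, dotProduct_zero, Int.toNat_zero, pow_zero,
          Finset.prod_const_one, mul_one]
        rfl
      map_mul' a b := by
        rw [toAdd_mul, C.proj_add, ← one_mul (1 : k), ← AddMonoidAlgebra.single_mul_single,
          one_mul]
        simp only [AddSubmonoid.coe_add, dotProduct_add,
          Int.toNat_add (C.nonneg _ _) (C.nonneg _ _), pow_add, Finset.prod_mul_distrib]
        ring }

theorem RationalCone.Coordinates.shift_single (s : Finset ι) (c : k) (a : σ.dualMonoid) :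
    C.shift s c (AddMonoidAlgebra.single a 1) = AddMonoidAlgebra.single (C.proj s a) 1 *
        ∏ i ∈ s, (AddMonoidAlgebra.single (⟨C.p i, C.p_mem i⟩ : σ.dualMonoid) (1 : k) +
          algebraMap k _ c) ^ (C.e i ⬝ᵥ (a : Fin n → ℤ)).toNat := by
  rw [shift, AddMonoidAlgebra.lift_single, one_smul]
  rfl

theorem RationalCone.Coordinates.shift_single_of_eq_zero (s : Finset ι) (c : k) (a : σ.dualMonoid)
    (ha : ∀ i ∈ s, C.e i ⬝ᵥ (a : Fin n → ℤ) = 0) :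
    C.shift s c (AddMonoidAlgebra.single a 1) = AddMonoidAlgebra.single a 1 := by
  rw [shift_single, C.proj_eq_self s a ha, Finset.prod_eq_one, mul_one]
  intro i hi
  rw [ha i hi, Int.toNat_zero, pow_zero]

theorem RationalCone.Coordinates.shift_single_p (s : Finset ι) (c : k) {i : ι} (hi : i ∈ s) :
    C.shift s c (AddMonoidAlgebra.single ⟨C.p i, C.p_mem i⟩ 1) =
      AddMonoidAlgebra.single ⟨C.p i, C.p_mem i⟩ 1 + algebraMap k _ c := by
  rw [shift_single, C.proj_p s hi, Finset.prod_eq_single i]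
  · rw [C.e_dotProduct_p, if_pos rfl, Int.toNat_one, pow_one]
    exact one_mul _
  · intro j _ hj
    rw [C.e_dotProduct_p, if_neg hj, Int.toNat_zero, pow_zero]
  · exact fun h => absurd hi h

theorem RationalCone.Coordinates.shift_comp_shift (s : Finset ι) (c d : k) (h : c + d = 0) :
    (C.shift s c).comp (C.shift s d) = AlgHom.id k (σ.ring k) := by
  refine AddMonoidAlgebra.algHom_ext (A := k) (M := σ.dualMonoid) (fun a => ?_) (by ext)
  rw [AlgHom.comp_apply, shift_single, map_mul, map_prod,
    C.shift_single_of_eq_zero s c (C.proj s a) fun i hi => C.e_dotProduct_proj s a hi,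
    AlgHom.id_apply, C.single_eq s a]
  congr 1
  refine Finset.prod_congr rfl fun i hi => ?_
  rw [map_pow, map_add, AlgHom.commutes, C.shift_single_p s c hi, add_assoc, ← map_add, h,
    map_zero, add_zero]

theorem toricHom_comp {l : ℕ} {τ : RationalCone m} {ρ : RationalCone l}
    (θ : τ.ring k →ₐ[k] σ.ring k) (θ' : ρ.ring k →ₐ[k] τ.ring k) :
    toricHom θ ≫ toricHom θ' = toricHom (θ.comp θ') := by
  ext1
  change Spec.map _ ≫ Spec.map _ = Spec.map _
  rw [← Spec.map_comp, ← CommRingCat.ofHom_comp]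
  rfl

theorem toricHom_id : toricHom (AlgHom.id k (σ.ring k)) = 𝟙 (σ.toricVariety k) := by
  ext1
  exact Spec.map_id _

theorem RationalCone.Coordinates.toricHom_shift_comp (s : Finset ι) (c d : k) (h : c + d = 0) :
    toricHom (C.shift s c) ≫ toricHom (C.shift s d) = 𝟙 _ := by
  rw [toricHom_comp, C.shift_comp_shift s c d h, toricHom_id]

theorem RationalCone.Coordinates.isIso_toricHom_shift (s : Finset ι) (c : k) :
    IsIso (toricHom (C.shift s c)) :=
  ⟨toricHom (C.shift s (-c)), C.toricHom_shift_comp s c (-c) (add_neg_cancel c),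
    C.toricHom_shift_comp s (-c) c (neg_add_cancel c)⟩

/-- Characters pulled back from X_τ do not involve the shifted coordinates, so the shift is an
automorphism over X_τ although it is not toric. -/
theorem RationalCone.Coordinates.toricHom_shift_comp_toricMap {τ : RationalCone m}
    (g : ConeHom σ τ) (s : Finset ι) (c : k)
    (hg : ∀ a : τ.dualMonoid, ∀ i ∈ s, C.e i ⬝ᵥ (g.dualMap a : Fin n → ℤ) = 0) :
    toricHom (C.shift s c) ≫ g.toricMap k = g.toricMap k := by
  ext1
  change Spec.map _ ≫ Spec.map _ = Spec.map _
  rw [← Spec.map_comp, ← CommRingCat.ofHom_comp]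
  congr 2
  refine AddMonoidAlgebra.ringHom_ext (fun r => ?_) fun a => ?_
  · have h (r : k) : AddMonoidAlgebra.mapDomainRingHom k g.dualMap
        (AddMonoidAlgebra.single (0 : τ.dualMonoid) r) = algebraMap k (σ.ring k) r := by
      rw [AddMonoidAlgebra.mapDomainRingHom_apply, AddMonoidAlgebra.mapDomain_single, map_zero]
      rfl
    rw [RingHom.comp_apply, h]
    exact AlgHom.commutes (C.shift s c) r
  · rw [RingHom.comp_apply, AddMonoidAlgebra.mapDomainRingHom_apply,
      AddMonoidAlgebra.mapDomain_single]
    exact C.shift_single_of_eq_zero s c _ (hg a)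

end Shift

/-! ### Faces of a regular cone. -/

section Subcone

variable {k : Type u} [Field k] {n m : ℕ} {σ : RationalCone n} {ι : Type} [Fintype ι]
  [DecidableEq ι] (C : σ.Coordinates ι)

/-- The cone generated by the rays in `s`. -/
def RationalCone.Coordinates.subcone (s : Finset ι) : RationalCone n :=
  σ.generate (s.image C.e) fun v hv => by
    obtain ⟨i, -, rfl⟩ := Finset.mem_image.mp hv
    exact C.castVec_e_mem i

theorem RationalCone.Coordinates.subcone_isGeneratedBy (s : Finset ι) :
    (C.subcone s).IsGeneratedBy (s.image C.e) :=
  rfl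

theorem RationalCone.Coordinates.subcone_le (s : Finset ι) : (C.subcone s).cone ≤ σ.cone :=
  σ.generate_le _ _

theorem RationalCone.Coordinates.mem_subcone_dualMonoid_iff (s : Finset ι) (a : Fin n → ℤ) :
    a ∈ (C.subcone s).dualMonoid ↔ ∀ i ∈ s, 0 ≤ C.e i ⬝ᵥ a := by
  rw [(C.subcone_isGeneratedBy s).mem_dualMonoid_iff]
  simp [dotProduct_comm a]

/-- The affine toric variety of a face of a regular cone is the locus where the other coordinates
do not vanish. -/
theorem RationalCone.Coordinates.isOpenImmersion_subcone (s : Finset ι) :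
    IsOpenImmersion ((ConeHom.ofLE (C.subcone_le s)).toricMap k).left ∧
    Set.range ((ConeHom.ofLE (C.subcone_le s)).toricMap k).left =
      {q : Spec (.of (σ.ring k)) | AddMonoidAlgebra.single
        (∑ i ∈ sᶜ, (⟨C.p i, C.p_mem i⟩ : σ.dualMonoid)) (1 : k) ∉ PrimeSpectrum.asIdeal q} := by
  have hcoe : ((∑ i ∈ sᶜ, (⟨C.p i, C.p_mem i⟩ : σ.dualMonoid) : σ.dualMonoid) : Fin n → ℤ) =
      ∑ i ∈ sᶜ, C.p i := AddSubmonoid.coe_finsetSum _ _ _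
  have hneg : -∑ i ∈ sᶜ, C.p i ∈ (C.subcone s).dualMonoid := by
    refine (C.mem_subcone_dualMonoid_iff s _).mpr fun i hi => ?_
    rw [dotProduct_neg, C.e_dotProduct_sum_p, if_neg (by simpa using hi), neg_zero]
  refine isOpenImmersion_mapDomainRingHom (k := k) (ConeHom.ofLE (C.subcone_le s)).dualMap
    (fun a b hab => Subtype.ext (by
      rw [← ConeHom.ofLE_dualMap_coe (C.subcone_le s) a, hab, ConeHom.ofLE_dualMap_coe]))
    _ ⟨_, hneg⟩ (Subtype.ext ?_) fun a => ?_
  · rw [AddSubmonoid.coe_add, ConeHom.ofLE_dualMap_coe, hcoe]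
    exact neg_add_cancel _
  · have hmem : (a : Fin n → ℤ) + (∑ i, (C.e i ⬝ᵥ (a : Fin n → ℤ)).natAbs) • ∑ i ∈ sᶜ, C.p i ∈
        σ.dualMonoid := by
      refine (C.mem_iff _).mpr fun i => ?_
      rw [dotProduct_add, dotProduct_smul, C.e_dotProduct_sum_p]
      by_cases hi : i ∈ s
      · rw [if_neg (by simpa using hi), smul_zero, add_zero]
        exact (C.mem_subcone_dualMonoid_iff s _).mp a.2 i hi
      · rw [if_pos (by simpa using hi), nsmul_one]
        have : (C.e i ⬝ᵥ (a : Fin n → ℤ)).natAbs ≤ ∑ i, (C.e i ⬝ᵥ (a : Fin n → ℤ)).natAbs :=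
          Finset.single_le_sum (f := fun i => (C.e i ⬝ᵥ (a : Fin n → ℤ)).natAbs)
            (fun _ _ => Nat.zero_le _) (Finset.mem_univ i)
        omega
    refine ⟨∑ i, (C.e i ⬝ᵥ (a : Fin n → ℤ)).natAbs, ⟨_, hmem⟩, Subtype.ext ?_⟩
    rw [ConeHom.ofLE_dualMap_coe, AddSubmonoid.coe_add, AddSubmonoidClass.coe_nsmul,
      ConeHom.ofLE_dualMap_coe, hcoe]

end Subcone

/-! ### The local model for the preimage. -/

section NewModels

variable {k : Type u} [Field k]

theorem isDominant_of_isOpenImmersion {X Y : Scheme.{u}} (h : X ⟶ Y) [IsOpenImmersion h]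
    [Nonempty X] [IrreducibleSpace Y] : IsDominant h :=
  ⟨h.isOpenEmbedding.isOpen_range.dense (Set.range_nonempty _)⟩

theorem LocalModel.exists_of_comp_eq {X : Over (Spec (.of k))} {U : X.left.Opens} {x : X.left}
    {n n' m : ℕ} {σ : RationalCone n} {σ' : RationalCone n'} {τ : RationalCone m}
    (h : σ'.toricVariety k ⟶ σ.toricVariety k) (g : σ.toricVariety k ⟶ τ.toricVariety k)
    (g' : σ'.toricVariety k ⟶ τ.toricVariety k) (hg : h ≫ g = g') (s : (σ'.toricVariety k).left)
    (ψ : LocalModel X U x τ (g.left (h.left s))) :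
    ∃ ψ' : LocalModel X U x τ (g'.left s), ∀ a, completedStalkMap g'.left s (ψ'.iso a) =
      completedStalkMap h.left s (completedStalkMap g.left (h.left s) (ψ.iso a)) := by
  subst hg
  exact ⟨ψ, fun a => completedStalkMap_comp h.left g.left s (ψ.iso a)⟩

variable {X B : Over (Spec (.of k))} {UX : X.left.Opens}
  {UB : B.left.Opens} {f : X ⟶ B} {x : X.left} {n m : ℕ} {σ : RationalCone n}
  {τ : RationalCone m} {g : ConeHom σ τ}

/-- Local models of a morphism can be restricted along an open immersion of toric varieties. -/
theorem LocalModel.exists_restrict {σ' : RationalCone n}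
    (h : σ'.toricVariety k ⟶ σ.toricVariety k) [IsOpenImmersion h.left]
    (s : (σ'.toricVariety k).left) (φ : LocalModel X UX x σ (h.left s))
    (ψ : LocalModel B UB (f.left x) τ ((g.toricMap k).left (h.left s)))
    (hcomp : ∀ a, φ.iso (completedStalkMap f.left x a) =
      completedStalkMap (g.toricMap k).left (h.left s) (ψ.iso a))
    (hdom : IsDominant (g.toricMap k).left) (g' : ConeHom σ' τ)
    (hg' : h ≫ g.toricMap k = g'.toricMap k) (U' : X.left.Opens)
    (W : Set (σ.toricVariety k).left) (hW : h.left ⁻¹' W = σ'.torus k)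
    (hU' : (completedIdeal X.left (U' : Set X.left)ᶜ x).map φ.iso =
      completedIdeal (σ.toricVariety k).left Wᶜ (h.left s)) :
    ∃ (φ' : LocalModel X U' x σ' s) (ψ' : LocalModel B UB (f.left x) τ ((g'.toricMap k).left s)),
      IsDominant (g'.toricMap k).left ∧ ∀ a, φ'.iso (completedStalkMap f.left x a) =
        completedStalkMap (g'.toricMap k).left s (ψ'.iso a) := by
  obtain ⟨ψ', hψ'⟩ := LocalModel.exists_of_comp_eq h (g.toricMap k) (g'.toricMap k) hg' s ψ
  refine ⟨φ.restrict h s U' W hW hU', ψ', ?_, fun a => ?_⟩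
  · have : Nonempty (σ'.toricVariety k).left := ⟨s⟩
    have : IrreducibleSpace (σ.toricVariety k).left :=
      inferInstanceAs (IrreducibleSpace (Spec (.of (σ.ring k))))
    have := isDominant_of_isOpenImmersion h.left
    rw [← hg']
    exact inferInstanceAs (IsDominant (h.left ≫ (g.toricMap k).left))
  · rw [hψ', ← hcomp]
    rfl

/-- Local models of a morphism of nonsingular varieties for the boundary of the source can be
changed into local models for the preimage of the boundary of the target. -/
theorem LocalModel.exists_preimage [Infinite k] {s : (σ.toricVariety k).left}
    (φ : LocalModel X UX x σ s) (ψ : LocalModel B UB (f.left x) τ ((g.toricMap k).left s))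
    (hcomp : ∀ a, φ.iso (completedStalkMap f.left x a) =
      completedStalkMap (g.toricMap k).left s (ψ.iso a))
    (hdom : IsDominant (g.toricMap k).left)
    (hx : IsRationalPoint X x) (hregX : IsRegularLocalRing (X.left.presheaf.stalk x))
    (hregB : IsRegularLocalRing (B.left.presheaf.stalk (f.left x))) (hs : σ.IsRegularAt s) :
    ∃ (σ' : RationalCone n) (g' : ConeHom σ' τ) (s' : (σ'.toricVariety k).left)
      (φ' : LocalModel X (f.left ⁻¹ᵁ UB) x σ' s')
      (ψ' : LocalModel B UB (f.left x) τ ((g'.toricMap k).left s')),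
      IsDominant (g'.toricMap k).left ∧ ∀ a, φ'.iso (completedStalkMap f.left x a) =
        completedStalkMap (g'.toricMap k).left s' (ψ'.iso a) := by
  obtain ⟨ι, _, _, ⟨C⟩⟩ := hs.exists_coordinates
  have hsprime : (PrimeSpectrum.asIdeal s).IsPrime := PrimeSpectrum.isPrime s
  have hideal := map_completedIdeal_preimage φ ψ hcomp hx hregX hregB hs C
  obtain ⟨m₀, hm₀, hm₀N⟩ := τ.exists_torus_eq (k := k)
  let I : Finset ι := Finset.univ.filter fun i => 0 < C.e i ⬝ᵥ (g.dualMap m₀ : Fin n → ℤ)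
  have hI (i : ι) : i ∈ I ↔ 0 < C.e i ⬝ᵥ (g.dualMap m₀ : Fin n → ℤ) := Finset.mem_filter_univ i
  -- The character of a divides a power of χ^{m₀}, whose pullback has order zero along x i.
  have hzero (a : τ.dualMonoid) : ∀ i ∈ Iᶜ, C.e i ⬝ᵥ (g.dualMap a : Fin n → ℤ) = 0 := by
    intro i hi
    rw [Finset.mem_compl, hI] at hi
    obtain ⟨N, hN⟩ := hm₀N a
    have h1 := C.nonneg (g.dualMap (⟨_, hN⟩ + a)) i
    have h2 : (⟨_, hN⟩ : τ.dualMonoid) + a = N • m₀ := Subtype.ext (sub_add_cancel _ _)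
    have h3 := C.nonneg (g.dualMap ⟨_, hN⟩) i
    have h4 := C.nonneg (g.dualMap a) i
    have h5 := C.nonneg (g.dualMap m₀) i
    have h6 : (g.dualMap ⟨_, hN⟩ : Fin n → ℤ) + g.dualMap a = N • (g.dualMap m₀ : Fin n → ℤ) := by
      have := congrArg (fun z => (g.dualMap z : Fin n → ℤ)) h2
      simpa only [map_add, map_nsmul, AddSubmonoid.coe_add, AddSubmonoidClass.coe_nsmul] using this
    have h7 := congrArg (C.e i ⬝ᵥ ·) h6
    simp only [dotProduct_add, dotProduct_smul] at h7
    have h8 : C.e i ⬝ᵥ (g.dualMap m₀ : Fin n → ℤ) = 0 := by omega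
    rw [h8, smul_zero] at h7
    omega
  obtain ⟨hopen, hrange⟩ := C.isOpenImmersion_subcone (k := k) I
  let j := (ConeHom.ofLE (C.subcone_le I)).toricMap k
  -- The coordinates outside I vanish at s. The shift by 1 makes them equal to 1, so the moved point
  -- lies in the open toric variety of the subcone; α moves it back to s.
  let α := toricHom (C.shift Iᶜ (-1 : k))
  have hα : IsIso α := C.isIso_toricHom_shift Iᶜ (-1)
  have hα' : IsIso α.left := inferInstanceAs (IsIso ((Over.forget _).map α))
  have hj : IsOpenImmersion j.left := hopen
  have hjopen : IsOpenImmersion (j ≫ α).left :=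
    inferInstanceAs (IsOpenImmersion (j.left ≫ α.left))
  obtain ⟨s', hs'⟩ : (toricHom (C.shift Iᶜ (1 : k))).left s ∈ Set.range j.left := by
    refine hrange.ge ?_
    change C.shift Iᶜ 1 _ ∉ PrimeSpectrum.asIdeal s
    have hprod : AddMonoidAlgebra.single (∑ i ∈ Iᶜ, (⟨C.p i, C.p_mem i⟩ : σ.dualMonoid)) (1 : k) =
        ∏ i ∈ Iᶜ, AddMonoidAlgebra.single (⟨C.p i, C.p_mem i⟩ : σ.dualMonoid) (1 : k) := by
      induction Iᶜ using Finset.induction_on with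
      | empty => rfl
      | insert i t hi ih =>
        rw [Finset.sum_insert hi, Finset.prod_insert hi, ← ih, AddMonoidAlgebra.single_mul_single,
          one_mul]
    rw [hprod, map_prod, hsprime.prod_mem_iff]
    rintro ⟨i, hi, hmem⟩
    rw [C.shift_single_p _ _ hi, map_one] at hmem
    have hp : AddMonoidAlgebra.single (⟨C.p i, C.p_mem i⟩ : σ.dualMonoid) (1 : k) ∈
        PrimeSpectrum.asIdeal s := by
      by_contra h
      exact (C.isIrreducible i).neg_notMem (hs.neg_mem _ h)
    exact hsprime.ne_top ((Ideal.eq_top_iff_one _).mpr ((Ideal.add_mem_iff_right _ hp).mp hmem))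
  have hss' : (j ≫ α).left s' = s := by
    have h1 : (j ≫ α).left s' = α.left (j.left s') := rfl
    have h2 := C.toricHom_shift_comp Iᶜ (1 : k) (-1) (add_neg_cancel 1)
    rw [h1, hs']
    exact congr($(congrArg CommaMorphism.left h2) s)
  have hcompg : (j ≫ α) ≫ g.toricMap k = (g.comp (ConeHom.ofLE (C.subcone_le I))).toricMap k := by
    rw [Category.assoc, C.toricHom_shift_comp_toricMap g Iᶜ (-1) hzero, ConeHom.toricMap_comp]
  -- The pullback of m₀ is positive on every ray of the subcone, so its nonvanishing locus there is
  -- the torus.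
  have htorus : (j ≫ α).left ⁻¹' ((g.toricMap k).left ⁻¹' τ.torus k) =
      (C.subcone I).torus k := by
    have h1 : (j ≫ α).left ⁻¹' ((g.toricMap k).left ⁻¹' τ.torus k) =
        ((g.comp (ConeHom.ofLE (C.subcone_le I))).toricMap k).left ⁻¹' τ.torus k := by
      rw [← hcompg]
      rfl
    have hdual : ((g.comp (ConeHom.ofLE (C.subcone_le I))).dualMap m₀ : Fin n → ℤ) =
        g.dualMap m₀ := by
      rw [ConeHom.dualMap_coe, ConeHom.dualMap_coe]
      simp [ConeHom.comp, ConeHom.ofLE]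
    rw [h1, (C.subcone_isGeneratedBy I).torus_eq
      ((g.comp (ConeHom.ofLE (C.subcone_le I))).dualMap m₀), hm₀]
    · ext q
      exact (ConeHom.single_mem_toricMap _ q m₀).not
    · intro v hv _
      obtain ⟨i, hi, rfl⟩ := Finset.mem_image.mp hv
      rw [hdual, dotProduct_comm]
      exact (hI i).mp hi
  subst hss'
  obtain ⟨φ', ψ', h1, h2⟩ := LocalModel.exists_restrict (j ≫ α) s' φ ψ hcomp hdom
    (g.comp (ConeHom.ofLE (C.subcone_le I))) hcompg (f.left ⁻¹ᵁ UB) _ htorus hideal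
  exact ⟨C.subcone I, g.comp (ConeHom.ofLE (C.subcone_le I)), s', φ', ψ', h1, h2⟩

end NewModels

/-! ### Toroidality of the preimage. -/

section MainProof

variable {k : Type u} [Field k] [IsAlgClosed k] {X B : Over (Spec (.of k))}
  {UX : X.left.Opens} {UB : B.left.Opens} {f : X ⟶ B}

theorem IsToroidalMorphism.exists_preimage_localModel (hf : IsToroidalMorphism UX UB f)
    (hX : IsNonsingular X.left) (hB : IsNonsingular B.left) (x : X.left) (hx : IsClosed {x}) :
    ∃ (n m : ℕ) (σ : RationalCone n) (τ : RationalCone m) (g : ConeHom σ τ)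
      (s : (σ.toricVariety k).left) (φ : LocalModel X (f.left ⁻¹ᵁ UB) x σ s)
      (ψ : LocalModel B UB (f.left x) τ ((g.toricMap k).left s)),
      IsDominant (g.toricMap k).left ∧
      ∀ a : CompletedStalk B.left (f.left x), φ.iso (completedStalkMap f.left x a) =
        completedStalkMap (g.toricMap k).left s (ψ.iso a) := by
  have := hf.source.isVariety.locallyOfFiniteType
  have hrat : IsRationalPoint X x := exists_sub_stalkScalars_mem_maximalIdeal X x hx
  obtain ⟨n, m, σ, τ, g, s, φ, ψ, hdom, hcomp⟩ := hf.exists_localModel x hx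
  -- Only σ is shrunk; the map to X_τ and the model on B are composed with the inclusion of the
  -- face.
  obtain ⟨γ, h, s', hopen, rfl, htorus, hred⟩ := σ.exists_face s
  obtain ⟨φ', ψ', hdom', hcomp'⟩ := LocalModel.exists_restrict
    ((ConeHom.ofLE h).toricMap k) s' φ ψ hcomp hdom (g.comp (ConeHom.ofLE h))
    (ConeHom.toricMap_comp _ _) UX (σ.torus k) htorus φ.map_ideal
  obtain ⟨σ'', g'', s'', φ'', ψ'', h1, h2⟩ := φ'.exists_preimage ψ' hcomp' hdom' hrat (hX x)
    (hB _) (φ'.isRegularAt hrat (hX x) hred)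
  exact ⟨n, m, σ'', τ, g'', s'', φ'', ψ'', h1, h2⟩

theorem IsToroidalMorphism.isToroidalEmbedding_preimage (hf : IsToroidalMorphism UX UB f)
    (hX : IsNonsingular X.left) (hB : IsNonsingular B.left) :
    IsToroidalEmbedding X (f.left ⁻¹ᵁ UB) where
  isVariety := hf.source.isVariety
  isNormal := hf.source.isNormal
  exists_localModel x hx := by
    obtain ⟨n, m, σ, τ, g, s, φ, ψ, -⟩ := hf.exists_preimage_localModel hX hB x hx
    exact ⟨n, σ, s, ⟨φ⟩⟩

theorem IsToroidalMorphism.preimage (hf : IsToroidalMorphism UX UB f)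
    (hX : IsNonsingular X.left) (hB : IsNonsingular B.left) :
    IsToroidalMorphism (f.left ⁻¹ᵁ UB) UB f where
  source := hf.isToroidalEmbedding_preimage hX hB
  target := hf.target
  isDominant := hf.isDominant
  le_preimage := le_refl _
  exists_localModel := hf.exists_preimage_localModel hX hB

end MainProof

/-! ### Irreducible components of nested closed subsets. -/

section Components

theorem exists_isPrime_of_specializes {X : Scheme.{u}} {x y : X} (h : y ⤳ x) :
    ∃ p : PrimeSpectrum (X.presheaf.stalk x), X.fromSpecStalk x p = y := by
  have : y ∈ Set.range (X.fromSpecStalk x) := by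
    rw [Scheme.range_fromSpecStalk]
    exact h
  exact this

theorem fromSpecStalk_specializes_iff {X : Scheme.{u}} {x : X}
    (p q : PrimeSpectrum (X.presheaf.stalk x)) :
    X.fromSpecStalk x p ⤳ X.fromSpecStalk x q ↔ p.asIdeal ≤ q.asIdeal :=
  (X.fromSpecStalk x).isEmbedding.isInducing.specializes_iff.trans
    (PrimeSpectrum.le_iff_specializes p q).symm

theorem stalkIdeal_le_iff {X : Scheme.{u}} {Z : Set X} (hZ : IsClosed Z) {x : X}
    (p : PrimeSpectrum (X.presheaf.stalk x)) :
    stalkIdeal X Z x ≤ p.asIdeal ↔ X.fromSpecStalk x p ∈ Z := by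
  have hcl : IsClosed {p : PrimeSpectrum (X.presheaf.stalk x) | X.fromSpecStalk x p ∈ Z} :=
    hZ.preimage (X.fromSpecStalk x).continuous
  change p ∈ PrimeSpectrum.zeroLocus (stalkIdeal X Z x : Set (X.presheaf.stalk x)) ↔ _
  rw [stalkIdeal, PrimeSpectrum.zeroLocus_vanishingIdeal_eq_closure, hcl.closure_eq]
  rfl

/-- Let `Z ⊆ Z'` be closed subsets of a noetherian integral scheme. If `Z'` is a proper subset and
`Z` is locally defined by one equation, then the irreducible components of `Z` are irreducible
components of `Z'`. -/
theorem maximal_isIrreducible_of_subset {X : Scheme.{u}} [CompactSpace X] {Z Z' : Set X}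
    (hZ : IsClosed Z) (hZ' : IsClosed Z') (hsub : Z ⊆ Z')
    (hnoeth : ∀ x : X, IsNoetherianRing (X.presheaf.stalk x))
    (hdom : ∀ x : X, IsDomain (X.presheaf.stalk x))
    (hprinc : ∀ x : X, IsClosed {x} → ∃ h, stalkIdeal X Z x = Ideal.span {h})
    (hne : ∀ x : X, IsClosed {x} → stalkIdeal X Z' x ≠ ⊥) {E : Set X}
    (hE : Maximal (fun F : Set X => IsIrreducible F ∧ F ⊆ Z) E) :
    Maximal (fun F : Set X => IsIrreducible F ∧ F ⊆ Z') E := by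
  obtain ⟨⟨hEirr, hEZ⟩, hEmax⟩ := hE
  have hEcl : IsClosed E := isClosed_of_closure_subset
    (hEmax ⟨hEirr.closure, closure_minimal hEZ hZ⟩ subset_closure)
  refine ⟨⟨hEirr, hEZ.trans hsub⟩, fun F hF hEF => ?_⟩
  -- At a closed point of E, the generic points of E and of the closure of F become primes p ≥ q of
  -- the local ring, and the claim becomes p = q.
  obtain ⟨x, hxE, hx⟩ := hEcl.exists_closed_singleton hEirr.nonempty
  have hgE := hEirr.isGenericPoint_genericPoint hEcl
  have hgF := hF.1.closure.isGenericPoint_genericPoint isClosed_closure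
  obtain ⟨p, hp⟩ := exists_isPrime_of_specializes (hgE.specializes hxE)
  obtain ⟨q, hq⟩ := exists_isPrime_of_specializes
    (hgF.specializes (subset_closure (hEF hxE)))
  have hqp : q.asIdeal ≤ p.asIdeal := by
    refine (fromSpecStalk_specializes_iff q p).mp ?_
    rw [hp, hq]
    exact hgF.specializes (subset_closure (hEF hgE.mem))
  -- A smaller prime would give an irreducible subset of Z larger than E.
  have hpmin : p.asIdeal ∈ (stalkIdeal X Z x).minimalPrimes := by
    refine ⟨⟨p.2, (stalkIdeal_le_iff hZ p).mpr (by rw [hp]; exact hEZ hgE.mem)⟩,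
      fun r ⟨hr, hZr⟩ hrp => ?_⟩
    have h1 := (stalkIdeal_le_iff hZ ⟨r, hr⟩).mp hZr
    have h2 : X.fromSpecStalk x ⟨r, hr⟩ ⤳ hEirr.genericPoint := by
      rw [← hp]
      exact (fromSpecStalk_specializes_iff ⟨r, hr⟩ p).mpr hrp
    have h3 := hEmax (y := closure {X.fromSpecStalk x ⟨r, hr⟩})
      ⟨isIrreducible_singleton.closure, closure_minimal (Set.singleton_subset_iff.mpr h1) hZ⟩
      (by
        rw [← hgE.def]
        exact closure_minimal (Set.singleton_subset_iff.mpr h2.mem_closure) isClosed_closure)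
    have h4 := hgE.specializes (h3 (subset_closure rfl))
    rw [← hp] at h4
    exact (fromSpecStalk_specializes_iff p ⟨r, hr⟩).mp h4
  obtain ⟨h, hh⟩ := hprinc x hx
  have hheight : p.asIdeal.height ≤ 1 := by
    have := hnoeth x
    have : Submodule.IsPrincipal (stalkIdeal X Z x) := ⟨h, hh⟩
    exact Ideal.height_le_one_of_isPrincipal_of_mem_minimalPrimes _ _ hpmin
  have hqbot : q.asIdeal ≠ ⊥ := by
    intro hbot
    refine hne x hx (le_bot_iff.mp ?_)
    rw [← hbot]
    refine (stalkIdeal_le_iff hZ' q).mpr ?_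
    rw [hq]
    exact closure_minimal hF.2 hZ' hgF.mem
  -- Otherwise 0 < q < p would give p height at least two, against Krull's principal ideal theorem.
  have hqp' : q.asIdeal = p.asIdeal := by
    have := hdom x
    have := p.2
    have := q.2
    refine hqp.eq_or_lt.resolve_right fun hlt => ?_
    have h1 := Ideal.height_add_one_le_of_lt_of_isPrime hlt
    have h2 := Ideal.height_add_one_le_of_lt_of_isPrime (bot_lt_iff_ne_bot.mpr hqbot)
    rw [Ideal.height_bot, zero_add] at h2
    have h3 : (1 : ℕ∞) + 1 ≤ 1 := (add_le_add_left h2 1).trans (h1.trans hheight)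
    exact absurd h3 (by decide)
  have hgen : hF.1.closure.genericPoint = hEirr.genericPoint := by
    rw [← hp, ← hq, PrimeSpectrum.ext hqp']
  refine (subset_closure (s := F)).trans ?_
  rw [← hgF.def, hgen, hgE.def]

end Components

/-! ### Absence of self-intersections. -/

section MainTheorem

variable {k : Type u} [Field k]

/-- In the completion the ideal is generated by a product of primes, which is nonzero in a domain.
-/
theorem LocalModel.stalkIdeal_ne_bot [Infinite k] {X : Over (Spec (.of k))} {U : X.left.Opens}
    {x : X.left} {n : ℕ} {σ : RationalCone n} {s : (σ.toricVariety k).left}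
    (φ : LocalModel X U x σ s) (hx : IsRationalPoint X x)
    (hreg : IsRegularLocalRing (X.left.presheaf.stalk x)) :
    stalkIdeal X.left (U : Set X.left)ᶜ x ≠ ⊥ := by
  obtain ⟨γ, s', hred, ⟨φ'⟩⟩ := φ.exists_face
  have hs := φ'.isRegularAt hx hreg hred
  obtain ⟨ι, _, _, ⟨C⟩⟩ := hs.exists_coordinates
  intro hbot
  have h := φ'.map_ideal
  rw [C.completedIdeal_torus_compl hs, completedIdeal, hbot, Ideal.map_bot, Ideal.map_bot,
    eq_comm, Ideal.span_singleton_eq_bot] at h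
  have := hs.isRegularCompletion.isDomain
  exact Finset.prod_ne_zero_iff.mpr (fun i _ => (C.prime_x hs i).ne_zero) h

theorem IsToroidalMorphism.isWithoutSelfIntersection_preimage [IsAlgClosed k]
    {X B : Over (Spec (.of k))} {UX : X.left.Opens} {UB : B.left.Opens} {f : X ⟶ B}
    (hf : IsToroidalMorphism UX UB f)
    (hX : IsNonsingular X.left) (hB : IsNonsingular B.left)
    (hself : IsWithoutSelfIntersection X UX) :
    IsWithoutSelfIntersection X (f.left ⁻¹ᵁ UB) := by
  intro E hE
  refine hself E ?_
  have := hf.source.isVariety.locallyOfFiniteType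
  have := hf.source.isVariety.quasiCompact
  have : CompactSpace X.left := QuasiCompact.compactSpace_of_compactSpace X.hom
  have hrat (x : X.left) (hx : IsClosed {x}) : IsRationalPoint X x :=
    exists_sub_stalkScalars_mem_maximalIdeal X x hx
  refine maximal_isIrreducible_of_subset (f.left ⁻¹ᵁ UB).isOpen.isClosed_compl
    UX.isOpen.isClosed_compl (Set.compl_subset_compl.mpr hf.le_preimage)
    (fun x => have := hX x; inferInstance) (fun x => (hf.source.isNormal x).1)
    (fun x hx => ?_) (fun x hx => ?_) hE
  · obtain ⟨n, σ, s, ⟨φ⟩⟩ := (hf.isToroidalEmbedding_preimage hX hB).exists_localModel x hx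
    exact φ.exists_stalkIdeal_eq_span (hrat x hx) (hX x)
  · obtain ⟨n, σ, s, ⟨φ⟩⟩ := hf.source.exists_localModel x hx
    exact φ.stalkIdeal_ne_bot (hrat x hx) (hX x)

end MainTheorem

end Toroidal

theorem mainTheorem7 {k : Type*} [Field k] [IsAlgClosed k] [CharZero k]
    (X B : Over (Spec (.of k))) (UX : X.left.Opens) (UB : B.left.Opens) (f : X ⟶ B)
    (hX : Toroidal.IsNonsingular X.left) (hB : Toroidal.IsNonsingular B.left)
    (hf : Toroidal.IsToroidalMorphism UX UB f) (hsurj : Function.Surjective f.left) :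
    UX ≤ f.left ⁻¹ᵁ UB ∧
    Toroidal.IsToroidalEmbedding X (f.left ⁻¹ᵁ UB) ∧
    Toroidal.IsToroidalMorphism (f.left ⁻¹ᵁ UB) UB f ∧
    (Toroidal.IsWithoutSelfIntersection X UX →
      Toroidal.IsWithoutSelfIntersection X (f.left ⁻¹ᵁ UB)) :=
  ⟨hf.le_preimage, hf.isToroidalEmbedding_preimage hX hB, hf.preimage hX hB,
    hf.isWithoutSelfIntersection_preimage hX hB⟩
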